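/- \textbf{Theorem.} An instance of $k$-in-a-tree is a pair $(G,K)$, where $G$ is a finite simple graph and $K\subseteq V(G)$ is a set of $k$ terminals ($k$ is part of the input); it is a yes-instance if some set $S\subseteq V(G)$ with $K\subseteq S$ induces a tree in $G$. A feedback edge set of $G$ is a set $F\subseteq E(G)$ such that $G\setminus F$ is a forest. There is an algorithm for random access machines (one step per elementary instruction, graphs stored by adjacency lists) that, given an instance $(G,K)$ with $n$ vertices, outputs an instance $(G',K')$ such that $(G',K')$ is a yes-instance if and only if $(G,K)$ is one and such that, for every integer $q\ge 1$ for which $G$ has a feedback edge set of size at most $q$, the algorithm takes $O(q^2+qn)$ steps (with an absolute constant), $G'$ has at most $16q$ vertices and at most $17q$ edges, and $G'$ has a feedback edge set of size at most $q$. In other words, $k$-in-a-tree parameterized by the size $q$ of a feedback edge set admits a kernel with $16q$ vertices and $17q$ edges that can be computed in $O(q^2+qn)$ time. -/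

import Mathlib

namespace InTree

/-- `F` is a feedback edge set of `G`: a set of edges of `G` whose removal leaves a forest. -/
def IsFeedbackEdgeSet {V : Type*} (G : SimpleGraph V) (F : Finset (Sym2 V)) : Prop :=
  (F : Set (Sym2 V)) ⊆ G.edgeSet ∧ (G.deleteEdges (F : Set (Sym2 V))).IsAcyclic

/-- `(G, K)` is a positive instance of `k`-in-a-tree: some induced subgraph of `G` is a tree and
contains every terminal. -/
def HasInducedTree {V : Type*} (G : SimpleGraph V) (K : Finset V) : Prop :=
  ∃ S : Set V, (K : Set V) ⊆ S ∧ (G.induce S).IsTree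

/-! ### Random access machine programs with a step count

Programs work on scalar registers and on arrays, both holding natural numbers. A program is a
finite object and names its registers and arrays explicitly, so it uses finitely many of them;
array cells are addressed by computed values. The only arithmetic is increment and (truncated)
decrement, so a run of `t` steps never creates a number larger than `t` plus the largest number
that occurs in the input or in the program: no computation can be hidden in long words, and the
same step bounds hold up to a constant factor on a unit-cost RAM with logarithmic word length. -/

/-- The memory: scalar registers and arrays. -/
structure Mem where
  /-- The content of each register. -/
  reg : ℕ → ℕ
  /-- `arr a i` is the content of cell `i` of array `a`. -/
  arr : ℕ → ℕ → ℕ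

/-- Overwrite register `x`. -/
def Mem.setReg (s : Mem) (x v : ℕ) : Mem :=
  { s with reg := Function.update s.reg x v }

/-- Overwrite cell `i` of array `a`. -/
def Mem.setArr (s : Mem) (a i v : ℕ) : Mem :=
  { s with arr := Function.update s.arr a (Function.update (s.arr a) i v) }

/-- Arithmetic expressions. -/
inductive Expr where
  | const (k : ℕ)
  | reg (x : ℕ)
  | read (a : ℕ) (i : Expr)
  | succ (e : Expr)
  | pred (e : Expr)

/-- The value of an expression. -/
def Expr.eval (s : Mem) : Expr → ℕ
  | const k => k
  | reg x => s.reg x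
  | read a i => s.arr a (i.eval s)
  | succ e => e.eval s + 1
  | pred e => e.eval s - 1

/-- The number of steps that evaluating an expression takes: one for each node. -/
def Expr.cost : Expr → ℕ
  | const _ => 1
  | reg _ => 1
  | read _ i => i.cost + 1
  | succ e => e.cost + 1
  | pred e => e.cost + 1

/-- Tests. -/
inductive Test where
  | lt (e f : Expr)
  | eq (e f : Expr)
  | neg (b : Test)
  | conj (b c : Test)

/-- The truth value of a test. -/
def Test.Holds (s : Mem) : Test → Prop
  | lt e f => e.eval s < f.eval s
  | eq e f => e.eval s = f.eval s
  | neg b => ¬ b.Holds s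
  | conj b c => b.Holds s ∧ c.Holds s

/-- The number of steps that evaluating a test takes: one for each node. -/
def Test.cost : Test → ℕ
  | lt e f => e.cost + f.cost + 1
  | eq e f => e.cost + f.cost + 1
  | neg b => b.cost + 1
  | conj b c => b.cost + c.cost + 1

/-- Programs. -/
inductive Prog where
  | skip
  | assign (x : ℕ) (e : Expr)
  | write (a : ℕ) (i e : Expr)
  | seq (p q : Prog)
  | ite (b : Test) (p q : Prog)
  | loop (b : Test) (p : Prog)

/-- `Exec p s t s'`: started in memory `s`, the program `p` halts after exactly `t` steps, in
memory `s'`. -/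
inductive Exec : Prog → Mem → ℕ → Mem → Prop where
  | skip (s : Mem) : Exec Prog.skip s 1 s
  | assign (s : Mem) (x : ℕ) (e : Expr) :
      Exec (Prog.assign x e) s (e.cost + 1) (s.setReg x (e.eval s))
  | write (s : Mem) (a : ℕ) (i e : Expr) :
      Exec (Prog.write a i e) s (i.cost + e.cost + 1) (s.setArr a (i.eval s) (e.eval s))
  | seq {p q : Prog} {s s' s'' : Mem} {t t' : ℕ} :
      Exec p s t s' → Exec q s' t' s'' → Exec (Prog.seq p q) s (t + t' + 1) s''
  | iteTrue {b : Test} {p q : Prog} {s s' : Mem} {t : ℕ} :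
      b.Holds s → Exec p s t s' → Exec (Prog.ite b p q) s (b.cost + t + 1) s'
  | iteFalse {b : Test} {p q : Prog} {s s' : Mem} {t : ℕ} :
      ¬ b.Holds s → Exec q s t s' → Exec (Prog.ite b p q) s (b.cost + t + 1) s'
  | loopTrue {b : Test} {p : Prog} {s s' s'' : Mem} {t t' : ℕ} :
      b.Holds s → Exec p s t s' → Exec (Prog.loop b p) s' t' s'' →
        Exec (Prog.loop b p) s (b.cost + t + t' + 1) s''
  | loopFalse {b : Test} {p : Prog} {s : Mem} :
      ¬ b.Holds s → Exec (Prog.loop b p) s (b.cost + 1) s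

/-! ### Instances in memory -/

/-- Block `b` of the memory stores the graph `G` with vertices `0, …, n - 1`, by adjacency lists,
and the set `K` of terminals. Register `b` holds `n`. Array `3 * b + 1` holds the neighbours of
vertex `0`, then those of vertex `1`, and so on, each list in any order and without repetition;
the list of `v` starts at the position in cell `v` of array `3 * b` and ends before the position in
cell `v + 1`. Array `3 * b + 2` holds the characteristic vector of `K`. -/
def Stores (b : ℕ) (s : Mem) {n : ℕ} (G : SimpleGraph (Fin n)) (K : Finset (Fin n)) : Prop :=
  s.reg b = n ∧
  s.arr (3 * b) 0 = 0 ∧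
  (∀ v : Fin n, s.arr (3 * b) v ≤ s.arr (3 * b) (v + 1)) ∧
  (∀ v : Fin n, Set.BijOn (s.arr (3 * b + 1))
    (Set.Ico (s.arr (3 * b) v) (s.arr (3 * b) (v + 1)))
    ((fun w : Fin n => (w : ℕ)) '' G.neighborSet v)) ∧
  (∀ v : Fin n, s.arr (3 * b + 2) v = if v ∈ K then 1 else 0)

/-- An initial memory for the instance `(G, K)`: the instance is stored in block `0`, and all
registers and arrays outside that block are zero. -/
def IsInput (s : Mem) {n : ℕ} (G : SimpleGraph (Fin n)) (K : Finset (Fin n)) : Prop :=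
  Stores 0 s G K ∧ (∀ x, x ≠ 0 → s.reg x = 0) ∧ (∀ a, 3 ≤ a → ∀ i, s.arr a i = 0)

/-- A final memory whose result is the instance `(G, K)`: the instance is stored in block `1`. -/
def IsOutput (s : Mem) {n : ℕ} (G : SimpleGraph (Fin n)) (K : Finset (Fin n)) : Prop :=
  Stores 1 s G K

end InTree

/-!
# A kernel for `k`-in-a-tree parameterized by a feedback edge set

Three reduction rules keep the answer and do not increase the feedback edge number.

* A leaf is deleted; if it is a terminal, then its neighbour becomes one (`yes_isolate_leaf`).
* If `y` is the middle of a path `x, y, z` of vertices of degree two, and `x` and `z` are not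
  adjacent, then `y` is replaced by an edge between `x` and `z`. An induced tree that meets a path of
  vertices of degree two contains all of it or ends on it, and its ends can be shifted along the path.
  So all that matters is which statuses, terminal or not, occur on the path, and two vertices suffice
  to remember this (`yes_bypass_status`). The rule does not increase the feedback edge number
  (`Fes.bypass`). If `x` and `z` were adjacent, then a triangle would be lost.
* Isolated vertices that are no terminals are dropped, and of the isolated terminals only two are
  kept: two of them already make the instance negative (`hasInducedTree_comap_iff`).

In a graph to which the first two rules do not apply (`Reduced`), a nonisolated vertex has degree at
least three, or has degree two and a neighbour of degree at least three, or lies in a component that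
is a triangle. The sum of the degrees exceeds twice the number of nonisolated vertices by at most
`2 * q`, hence there are at most `2 * q` vertices of degree at least three, and the sum of their
degrees is at most `6 * q`. This bounds the number of their neighbours. Every triangle component
contains an edge of the feedback edge set, so at most `6 * q` vertices lie in such components, by the
crude bound of three for each end of an edge. Altogether there are at most `14 * q` nonisolated
vertices and `15 * q` edges (`Reduced.card_le`).

A single pass for each rule suffices: following chains of leaves deletes all of them, and bypassing a
vertex never makes the second rule applicable to a vertex where it was not applicable before
(`Settled.bypass`). Hence the program consists of loops with loop-free bodies, and its running time is
read off from ranking functions (`exec_loop`). Each pass takes time linear in the number of vertices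
and the total length of the adjacency lists. That length is the sum of the degrees, at most
`2 * n + 2 * q` (`IsFeedbackEdgeSet.sum_degree_le`). The program never uses `q`.

If there is no terminal, then vertex `0` is made one at the beginning, because a single vertex is a
tree; from then on every instance with a vertex has a terminal, which excludes degenerate cases in the
rules. Deleted vertices stay in memory as isolated vertices of a graph on the natural numbers, until
the last two passes number the vertices that are kept and write the output.
-/

namespace InTree

/-! ### Straight-line programs and loops with a ranking function -/

open Classical in
/-- The effect on the memory of a program without loops. A loop is treated as `skip`, a junk value
that is never used. -/
noncomputable def Prog.run : Prog → Mem → Mem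
  | skip, s => s
  | assign x e, s => s.setReg x (e.eval s)
  | write a i e, s => s.setArr a (i.eval s) (e.eval s)
  | seq p q, s => q.run (p.run s)
  | ite b p q, s => if b.Holds s then p.run s else q.run s
  | loop _ _, s => s

/-- The program contains no loop. -/
def Prog.LoopFree : Prog → Prop
  | seq p q => p.LoopFree ∧ q.LoopFree
  | ite _ p q => p.LoopFree ∧ q.LoopFree
  | loop _ _ => False
  | _ => True

/-- An upper bound on the number of steps of a program without loops. -/
def Prog.bound : Prog → ℕ
  | skip => 1
  | assign _ e => e.cost + 1
  | write _ i e => i.cost + e.cost + 1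
  | seq p q => p.bound + q.bound + 1
  | ite b p q => b.cost + (p.bound + q.bound) + 1
  | loop _ _ => 0

theorem Prog.exec_run {p : Prog} (hp : p.LoopFree) (s : Mem) :
    ∃ t, Exec p s t (p.run s) ∧ t ≤ p.bound := by
  induction p generalizing s with
  | skip => exact ⟨_, Exec.skip s, le_rfl⟩
  | assign x e => exact ⟨_, Exec.assign s x e, le_rfl⟩
  | write a i e => exact ⟨_, Exec.write s a i e, le_rfl⟩
  | seq p q ihp ihq =>
    obtain ⟨t, ht, ht'⟩ := ihp hp.1 s
    obtain ⟨u, hu, hu'⟩ := ihq hp.2 (p.run s)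
    exact ⟨_, Exec.seq ht hu, by simp only [Prog.bound]; omega⟩
  | ite b p q ihp ihq =>
    by_cases hb : b.Holds s
    · obtain ⟨t, ht, ht'⟩ := ihp hp.1 s
      exact ⟨_, by simpa only [Prog.run, if_pos hb] using Exec.iteTrue hb ht,
        by simp only [Prog.bound]; omega⟩
    · obtain ⟨t, ht, ht'⟩ := ihq hp.2 s
      exact ⟨_, by simpa only [Prog.run, if_neg hb] using Exec.iteFalse hb ht,
        by simp only [Prog.bound]; omega⟩
  | loop b p => exact hp.elim

theorem Prog.run_ite_pos {b : Test} {p q : Prog} {s : Mem} (h : b.Holds s) :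
    (Prog.ite b p q).run s = p.run s := if_pos h

theorem Prog.run_ite_neg {b : Test} {p q : Prog} {s : Mem} (h : ¬ b.Holds s) :
    (Prog.ite b p q).run s = q.run s := if_neg h

/-- A loop with a loop-free body, an invariant `I` and a rank `r` that every round decreases: it
halts, the number of rounds being at most the initial rank. -/
theorem exec_loop {b : Test} {p : Prog} (hp : p.LoopFree) (I : Mem → Prop) (r : Mem → ℕ)
    (step : ∀ s, I s → b.Holds s → I (p.run s) ∧ r (p.run s) < r s) (s : Mem) (hs : I s) :
    ∃ t s', Exec (Prog.loop b p) s t s' ∧ I s' ∧ ¬ b.Holds s' ∧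
      t ≤ (b.cost + p.bound + 1) * (r s + 1) := by
  induction h : r s using Nat.strong_induction_on generalizing s with
  | _ m ih =>
    by_cases hb : b.Holds s
    · obtain ⟨hI, hr⟩ := step s hs hb
      obtain ⟨t, ht, ht'⟩ := Prog.exec_run hp s
      obtain ⟨u, s', hu, hI', hb', hu'⟩ := ih _ (h ▸ hr) _ hI rfl
      refine ⟨_, s', Exec.loopTrue hb ht hu, hI', hb', ?_⟩
      have : (b.cost + p.bound + 1) * (r (p.run s) + 1) ≤ (b.cost + p.bound + 1) * m :=
        Nat.mul_le_mul_left _ (by omega)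
      rw [Nat.mul_add, Nat.mul_one]
      omega
    · exact ⟨_, s, Exec.loopFalse hb, hs, hb,
        le_trans (by omega) (Nat.le_mul_of_pos_right _ (Nat.succ_pos _))⟩

@[simp] theorem Mem.reg_setReg (s : Mem) (x v y : ℕ) :
    (s.setReg x v).reg y = if y = x then v else s.reg y := by
  simp [Mem.setReg, Function.update_apply]

@[simp] theorem Mem.arr_setReg (s : Mem) (x v a : ℕ) : (s.setReg x v).arr a = s.arr a := rfl

@[simp] theorem Mem.reg_setArr (s : Mem) (a i v : ℕ) : (s.setArr a i v).reg = s.reg := rfl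

@[simp] theorem Mem.arr_setArr (s : Mem) (a i v b : ℕ) :
    (s.setArr a i v).arr b = if b = a then Function.update (s.arr a) i v else s.arr b := by
  simp only [Mem.setArr, Function.update_apply]

/-! ### Trees and forests described by finite sets of vertices -/

section Sets

variable {V : Type*}

/-- The finite set `S` induces a connected graph: it is nonempty, and no nonempty proper subset is
closed under adjacency within `S`. -/
def Conn (G : SimpleGraph V) (S : Finset V) : Prop :=
  S.Nonempty ∧ ∀ A ⊆ S, A.Nonempty → (∀ a ∈ A, ∀ b ∈ S, G.Adj a b → b ∈ A) → S ⊆ A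

/-- The finite set `S` induces a forest: every nonempty subset `A` has a vertex with at most one
neighbour in `A`. -/
def Acyc (G : SimpleGraph V) (S : Finset V) : Prop :=
  ∀ A ⊆ S, A.Nonempty → ∃ a ∈ A, ∀ b ∈ A, ∀ c ∈ A, G.Adj a b → G.Adj a c → b = c

/-- `(G, K)` is a positive instance, witnessed by a finite set of vertices. -/
def Yes (G : SimpleGraph V) (K : Finset V) : Prop :=
  ∃ S, K ⊆ S ∧ Conn G S ∧ Acyc G S

/-- All finite sets induce forests once at most `q` pairs are removed from the edges of `G`. -/
def Fes (G : SimpleGraph V) (q : ℕ) : Prop :=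
  ∃ F : Finset (Sym2 V), F.card ≤ q ∧ ∀ S, Acyc (G.deleteEdges (F : Set (Sym2 V))) S

variable {G H : SimpleGraph V} {S T : Finset V}

theorem Acyc.subset (h : Acyc G S) (hT : T ⊆ S) : Acyc G T :=
  fun A hA => h A (hA.trans hT)

theorem Acyc.anti (h : Acyc G S) (hH : ∀ a ∈ S, ∀ b ∈ S, H.Adj a b → G.Adj a b) : Acyc H S := by
  intro A hA hne
  obtain ⟨a, ha, h1⟩ := h A hA hne
  exact ⟨a, ha, fun b hb c hc hab hac =>
    h1 b hb c hc (hH a (hA ha) b (hA hb) hab) (hH a (hA ha) c (hA hc) hac)⟩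

/-- The far end of a longest path in a finite acyclic graph has at most one neighbour. -/
theorem acyc_of_isAcyclic (h : (G.induce (S : Set V)).IsAcyclic) : Acyc G S := by
  intro A hA hne
  have hA' : (G.induce (A : Set V)).IsAcyclic :=
    h.embedding (SimpleGraph.induceHomOfLE G (Finset.coe_subset.2 hA))
  have : Nonempty (A : Set V) := hne.to_subtype
  obtain ⟨u, v, p, hp, hmax⟩ :=
    SimpleGraph.Walk.exists_isPath_forall_isPath_length_le_length (G.induce (A : Set V))
  have key : ∀ w, (G.induce (A : Set V)).Adj u w → w = p.snd := by
    intro w hw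
    apply hA'.eq_snd_of_adj_start hp hw
    by_contra hsupp
    have := hmax _ _ _ (hp.cons (h := hw.symm) hsupp)
    simp at this
  exact ⟨u, u.2, fun b hb c hc hb' hc' =>
    congrArg Subtype.val ((key ⟨b, hb⟩ hb').trans (key ⟨c, hc⟩ hc').symm)⟩

/-- Every vertex of a cycle has two neighbours on it. -/
theorem isAcyclic_of_acyc (h : Acyc G S) : (G.induce (S : Set V)).IsAcyclic := by
  classical
  intro v c hc
  obtain ⟨a, ha, h1⟩ := h (c.support.toFinset.image Subtype.val)
    (fun x hx => by
      simp only [Finset.mem_image] at hx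
      obtain ⟨y, -, rfl⟩ := hx
      exact y.2)
    ⟨v, by simp⟩
  simp only [Finset.mem_image, List.mem_toFinset] at ha h1
  obtain ⟨a', ha', rfl⟩ := ha
  have h2 := hc.ncard_neighborSet_toSubgraph_eq_two ha'
  obtain ⟨b, d, hbd, hset⟩ := Set.ncard_eq_two.1 h2
  have hb : b ∈ c.toSubgraph.neighborSet a' := by rw [hset]; simp
  have hd : d ∈ c.toSubgraph.neighborSet a' := by rw [hset]; simp
  have hb' : c.toSubgraph.Adj a' b := hb
  have hd' : c.toSubgraph.Adj a' d := hd
  apply hbd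
  apply Subtype.ext
  exact h1 b ⟨b, by simpa using hb'.snd_mem, rfl⟩ d ⟨d, by simpa using hd'.snd_mem, rfl⟩
    hb'.adj_sub hd'.adj_sub

theorem conn_iff : Conn G S ↔ (G.induce (S : Set V)).Connected := by
  constructor
  · rintro ⟨hne, h⟩
    have : Nonempty (S : Set V) := hne.to_subtype
    refine ⟨fun a b => ?_⟩
    classical
    have := h (S.filter fun x => ∃ hx : x ∈ S,
      (G.induce (S : Set V)).Reachable a ⟨x, hx⟩) (Finset.filter_subset _ _)
      ⟨a, by simp⟩ (by
        intro x hx y hy hxy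
        simp only [Finset.mem_filter] at hx ⊢
        obtain ⟨-, hx', hr⟩ := hx
        exact ⟨hy, hy, hr.trans (SimpleGraph.Adj.reachable
          (show (G.induce (S : Set V)).Adj ⟨x, hx'⟩ ⟨y, hy⟩ from hxy))⟩) b.2
    simp only [Finset.mem_filter] at this
    exact this.2.2
  · intro h
    refine ⟨(Set.nonempty_coe_sort.1 h.nonempty), fun A hA ⟨a, ha⟩ hcl b hb => ?_⟩
    have key : ∀ x y : (S : Set V), (G.induce (S : Set V)).Walk x y → x.1 ∈ A → y.1 ∈ A := by
      intro x y p
      induction p with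
      | nil => exact id
      | cons hadj p ih => exact fun hx => ih (hcl _ hx _ (Subtype.prop _) hadj)
    obtain ⟨p⟩ := h.preconnected ⟨a, hA ha⟩ ⟨b, hb⟩
    exact key _ _ p ha

theorem isTree_induce_iff : (G.induce (S : Set V)).IsTree ↔ Conn G S ∧ Acyc G S :=
  ⟨fun h => ⟨conn_iff.2 h.connected, acyc_of_isAcyclic h.isAcyclic⟩,
    fun h => ⟨conn_iff.1 h.1, isAcyclic_of_acyc h.2⟩⟩

theorem isAcyclic_iff_acyc : G.IsAcyclic ↔ ∀ S, Acyc G S := by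
  classical
  refine ⟨fun h S => acyc_of_isAcyclic (h.induce _), fun h v c hc => ?_⟩
  have h1 := isAcyclic_of_acyc (h c.support.toFinset)
  have hs : ∀ x ∈ c.support, x ∈ (c.support.toFinset : Set V) := by simp
  exact h1 (c.induce _ hs) (by
    rw [← SimpleGraph.Walk.isCycle_map_iff_of_injective
      (f := (SimpleGraph.Embedding.induce (G := G) (c.support.toFinset : Set V)).toHom)
      Subtype.val_injective]
    rw [SimpleGraph.Walk.map_induce]
    exact hc)

theorem conn_image [DecidableEq V] {W : Type*} (f : W → V) (hf : Function.Injective f)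
    (T : Finset W) : Conn G (T.image f) ↔ Conn (G.comap f) T := by
  refine and_congr (by simp) ⟨fun h A hA hne hcl x hx => ?_, fun h A hA hne hcl => ?_⟩
  · have := h (A.image f) (Finset.image_subset_image hA) (hne.image f) (by
      simp only [Finset.forall_mem_image]
      exact fun a ha b hb hab => Finset.mem_image_of_mem f (hcl a ha b hb hab))
      (Finset.mem_image_of_mem f hx)
    obtain ⟨y, hy, hxy⟩ := Finset.mem_image.1 this
    exact hf hxy ▸ hy
  · obtain ⟨B, hB, rfl⟩ := Finset.subset_image_iff.1 hA
    refine Finset.image_subset_image (h B (fun x hx => hB hx) (by simpa using hne) ?_)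
    intro a ha b hb hab
    have := hcl (f a) (Finset.mem_image_of_mem f ha) (f b) (Finset.mem_image_of_mem f hb) hab
    obtain ⟨y, hy, hxy⟩ := Finset.mem_image.1 this
    exact hf hxy ▸ hy

theorem acyc_image [DecidableEq V] {W : Type*} (f : W → V) (hf : Function.Injective f)
    (T : Finset W) : Acyc G (T.image f) ↔ Acyc (G.comap f) T := by
  refine ⟨fun h A hA hne => ?_, fun h A hA hne => ?_⟩
  · have := h (A.image f) (Finset.image_subset_image hA) (hne.image f)
    simp only [Finset.exists_mem_image, Finset.forall_mem_image] at this
    obtain ⟨a, ha, h1⟩ := this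
    exact ⟨a, ha, fun b hb c hc hab hac => hf (h1 hb hc hab hac)⟩
  · obtain ⟨B, hB, rfl⟩ := Finset.subset_image_iff.1 hA
    obtain ⟨a, ha, h1⟩ := h B (fun x hx => hB hx) (by simpa using hne)
    simp only [Finset.exists_mem_image, Finset.forall_mem_image]
    exact ⟨a, ha, fun b hb c hc hab hac => congrArg f (h1 b hb c hc hab hac)⟩

/-- In a connected set with at least two vertices, every vertex has a neighbour. -/
theorem Conn.exists_adj (h : Conn G S) {v w : V} (hv : v ∈ S) (hw : w ∈ S) (hne : w ≠ v) :
    ∃ u ∈ S, G.Adj v u := by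
  by_contra hcon
  push Not at hcon
  have := h.2 {v} (by simpa using hv) (by simp) (by
    intro a ha b hb hab
    rw [Finset.mem_singleton] at ha
    exact absurd (ha ▸ hab) (hcon b hb)) hw
  exact hne (by simpa using this)

theorem Conn.eq_singleton (h : Conn G S) {v : V} (hv : v ∈ S) (hiso : ∀ u ∈ S, ¬ G.Adj v u) :
    S = {v} := by
  refine Finset.eq_singleton_iff_unique_mem.2 ⟨hv, fun w hw => ?_⟩
  by_contra hne
  obtain ⟨u, hu, huv⟩ := h.exists_adj hv hw hne
  exact hiso u hu huv

theorem conn_singleton (v : V) : Conn G {v} := by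
  refine ⟨by simp, fun A hA hne _ => ?_⟩
  rcases Finset.subset_singleton_iff.1 hA with rfl | rfl
  · exact absurd hne (by simp)
  · exact subset_rfl

theorem acyc_singleton (v : V) : Acyc G {v} := by
  rintro A hA ⟨a, ha⟩
  refine ⟨a, ha, fun b hb c hc _ _ => ?_⟩
  have h1 := hA hb; have h2 := hA hc
  simp only [Finset.mem_singleton] at h1 h2
  rw [h1, h2]

/-- Adding or removing a leaf does not change whether a set induces a tree. -/
theorem tree_insert_leaf [DecidableEq V] {u v : V} (hv : v ∉ S) (hu : u ∈ S)
    (h : ∀ w ∈ S, G.Adj v w ↔ w = u) :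
    (Conn G (insert v S) ∧ Acyc G (insert v S)) ↔ (Conn G S ∧ Acyc G S) := by
  have huv : u ≠ v := fun h => hv (h ▸ hu)
  have hadj : G.Adj v u := (h u hu).2 rfl
  refine ⟨fun ⟨hc, ha⟩ => ⟨⟨⟨u, hu⟩, fun A hA hne hcl => ?_⟩,
    ha.subset (Finset.subset_insert _ _)⟩, fun ⟨hc, ha⟩ => ⟨⟨⟨v, by simp⟩, fun A hA hne hcl => ?_⟩,
    fun A hA hne => ?_⟩⟩
  · by_cases huA : u ∈ A
    · intro x hx
      have := hc.2 (insert v A) (Finset.insert_subset_insert _ hA) (by simp) (by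
        intro a ha b hb hab
        rw [Finset.mem_insert] at ha hb ⊢
        rcases hb with rfl | hb
        · exact Or.inl rfl
        rcases ha with rfl | ha
        · exact Or.inr ((h b hb).1 hab ▸ huA)
        · exact Or.inr (hcl a ha b hb hab)) (Finset.mem_insert_of_mem hx)
      rcases Finset.mem_insert.1 this with rfl | h'
      · exact absurd hx hv
      · exact h'
    · have := hc.2 A (hA.trans (Finset.subset_insert _ _)) hne (by
        intro a haA b hb hab
        rcases Finset.mem_insert.1 hb with rfl | hb
        · exact absurd ((h a (hA haA)).1 hab.symm ▸ haA) huA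
        · exact hcl a haA b hb hab)
      exact (Finset.subset_insert _ _).trans this
  · have huA : u ∈ A := by
      by_cases hA' : (A.erase v).Nonempty
      · have := hc.2 (A.erase v) (fun x hx => by
          rw [Finset.mem_erase] at hx
          exact (Finset.mem_insert.1 (hA hx.2)).resolve_left hx.1) hA' (by
          intro a ha b hb hab
          rw [Finset.mem_erase] at ha ⊢
          exact ⟨fun h => hv (h ▸ hb), hcl a ha.2 b (Finset.mem_insert_of_mem hb) hab⟩) hu
        exact Finset.mem_of_mem_erase this
      · obtain ⟨x, hx⟩ := hne
        have hxv : x = v := by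
          by_contra hxv
          exact hA' ⟨x, Finset.mem_erase.2 ⟨hxv, hx⟩⟩
        exact hcl x hx u (Finset.mem_insert_of_mem hu) (hxv ▸ hadj)
    have hvA : v ∈ A := hcl u huA v (by simp) hadj.symm
    intro x hx
    rcases Finset.mem_insert.1 hx with rfl | hx
    · exact hvA
    have := hc.2 (A.erase v) (fun x hx => by
      rw [Finset.mem_erase] at hx
      exact (Finset.mem_insert.1 (hA hx.2)).resolve_left hx.1)
      ⟨u, Finset.mem_erase.2 ⟨huv, huA⟩⟩ (by
      intro a ha b hb hab
      rw [Finset.mem_erase] at ha ⊢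
      exact ⟨fun h => hv (h ▸ hb), hcl a ha.2 b (Finset.mem_insert_of_mem hb) hab⟩) hx
    exact Finset.mem_of_mem_erase this
  · by_cases hvA : v ∈ A
    · have hn : ∀ b ∈ A, G.Adj v b → b = u := fun b hb hab =>
        (h b ((Finset.mem_insert.1 (hA hb)).resolve_left hab.ne')).1 hab
      exact ⟨v, hvA, fun b hb c hc hab hac => (hn b hb hab).trans (hn c hc hac).symm⟩
    · exact ha A (fun x hx => (Finset.mem_insert.1 (hA hx)).resolve_left
        (fun h => hvA (h ▸ hx))) hne

end Sets

/-! ### Reduction rules -/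

section Rules

variable {V : Type*}

/-- Delete all edges at `v`. An isolated vertex that is no terminal is as good as a deleted one. -/
def isolate (G : SimpleGraph V) (v : V) : SimpleGraph V where
  Adj a b := G.Adj a b ∧ a ≠ v ∧ b ≠ v
  symm := ⟨fun _ _ h => ⟨h.1.symm, h.2.2, h.2.1⟩⟩
  loopless := ⟨fun _ h => h.1.ne rfl⟩

/-- Isolate `y` and join `x` to `z`; used when `x` and `z` are the neighbours of `y`. -/
def bypass (G : SimpleGraph V) (x y z : V) : SimpleGraph V where
  Adj a b := a ≠ b ∧ a ≠ y ∧ b ≠ y ∧ (G.Adj a b ∨ (a = x ∧ b = z) ∨ (a = z ∧ b = x))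
  symm := ⟨fun _ _ h => ⟨h.1.symm, h.2.2.1, h.2.1,
    h.2.2.2.elim (fun h => Or.inl h.symm) fun h => Or.inr (h.symm.imp And.symm And.symm)⟩⟩
  loopless := ⟨fun _ h => h.1 rfl⟩

variable {G H : SimpleGraph V} {S K : Finset V} {a b u v w x y z : V}

theorem isolate_adj : (isolate G v).Adj a b ↔ G.Adj a b ∧ a ≠ v ∧ b ≠ v := Iff.rfl

theorem bypass_adj : (bypass G x y z).Adj a b ↔
    a ≠ b ∧ a ≠ y ∧ b ≠ y ∧ (G.Adj a b ∨ (a = x ∧ b = z) ∨ (a = z ∧ b = x)) := Iff.rfl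

theorem Conn.congr (h : Conn G S) (hH : ∀ a ∈ S, ∀ b ∈ S, G.Adj a b ↔ H.Adj a b) : Conn H S :=
  ⟨h.1, fun A hA hne hcl => h.2 A hA hne fun a ha b hb hab =>
    hcl a ha b hb ((hH a (hA ha) b hb).1 hab)⟩

theorem tree_congr (hH : ∀ a ∈ S, ∀ b ∈ S, G.Adj a b ↔ H.Adj a b) :
    (Conn G S ∧ Acyc G S) ↔ (Conn H S ∧ Acyc H S) :=
  ⟨fun h => ⟨h.1.congr hH, h.2.anti fun a ha b hb => (hH a ha b hb).2⟩,
    fun h => ⟨h.1.congr fun a ha b hb => (hH a ha b hb).symm,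
      h.2.anti fun a ha b hb => (hH a ha b hb).1⟩⟩

theorem Fes.anti {q : ℕ} (h : Fes G q) (hH : H ≤ G) : Fes H q := by
  obtain ⟨F, hF, hA⟩ := h
  refine ⟨F, hF, fun S => (hA S).anti fun a _ b _ hab => ?_⟩
  rw [SimpleGraph.deleteEdges_adj] at hab ⊢
  exact ⟨hH hab.1, hab.2⟩

theorem isolate_le : isolate G v ≤ G := fun _ _ h => h.1

variable [DecidableEq V]

theorem bypass_comm : bypass G x y z = bypass G z y x := by
  ext a b
  simp only [bypass_adj]
  tauto

theorem tree_erase_leaf (hv : v ∈ S) (hu : u ∈ S) (h : ∀ w ∈ S, G.Adj v w ↔ w = u) :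
    (Conn G (S.erase v) ∧ Acyc G (S.erase v)) ↔ (Conn G S ∧ Acyc G S) := by
  have huv : G.Adj v u := (h u hu).2 rfl
  rw [← tree_insert_leaf (S := S.erase v) (v := v) (u := u) (by simp)
    (Finset.mem_erase.2 ⟨huv.ne', hu⟩) (fun w hw => h w (Finset.mem_of_mem_erase hw)),
    Finset.insert_erase hv]

/-- A leaf is deleted; a terminal leaf hands its status on to its neighbour. -/
theorem yes_isolate_leaf (hK : K.Nonempty) (hv : ∀ w, G.Adj v w ↔ w = u) :
    Yes (isolate G v) (if v ∈ K then insert u (K.erase v) else K) ↔ Yes G K := by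
  have huv : u ≠ v := ((hv u).2 rfl).ne'
  constructor
  · rintro ⟨S, hKS, hS⟩
    have hvS : v ∉ S := by
      intro hvS
      have hs := hS.1.eq_singleton hvS (fun w _ h => h.2.1 rfl)
      subst hs
      split_ifs at hKS with h
      · exact huv (by simpa using hKS (Finset.mem_insert_self u _))
      · obtain ⟨k, hk⟩ := hK
        exact h (Finset.mem_singleton.1 (hKS hk) ▸ hk)
    have hS' : Conn G S ∧ Acyc G S := (tree_congr fun a ha b hb => by
      rw [isolate_adj]
      exact ⟨fun h => h.1, fun h => ⟨h, fun e => hvS (e ▸ ha), fun e => hvS (e ▸ hb)⟩⟩).1 hS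
    split_ifs at hKS with h
    · rw [Finset.insert_subset_iff] at hKS
      refine ⟨insert v S, fun k hk => ?_, (tree_insert_leaf hvS hKS.1 fun w _ => hv w).2 hS'⟩
      by_cases hkv : k = v
      · simp [hkv]
      · exact Finset.mem_insert_of_mem (hKS.2 (Finset.mem_erase.2 ⟨hkv, hk⟩))
    · exact ⟨S, hKS, hS'⟩
  · rintro ⟨S, hKS, hS⟩
    have hcongr : ∀ T : Finset V, v ∉ T → (Conn G T ∧ Acyc G T) →
        (Conn (isolate G v) T ∧ Acyc (isolate G v) T) := fun T hT h =>
      (tree_congr fun a ha b hb => by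
        rw [isolate_adj]
        exact ⟨fun h => ⟨h, fun e => hT (e ▸ ha), fun e => hT (e ▸ hb)⟩, fun h => h.1⟩).1 h
    by_cases hvS : v ∈ S
    · by_cases huS : u ∈ S
      · refine ⟨S.erase v, ?_, hcongr _ (by simp)
          ((tree_erase_leaf hvS huS fun w _ => hv w).2 hS)⟩
        split_ifs with h
        · exact Finset.insert_subset (Finset.mem_erase.2 ⟨huv, huS⟩) (Finset.erase_subset_erase _ hKS)
        · exact fun k hk => Finset.mem_erase.2 ⟨fun e => h (e ▸ hk), hKS hk⟩
      · have hs := hS.1.eq_singleton hvS (fun w hw h => huS ((hv w).1 h ▸ hw))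
        subst hs
        have hvK : v ∈ K := by
          obtain ⟨k, hk⟩ := hK
          exact Finset.mem_singleton.1 (hKS hk) ▸ hk
        refine ⟨{u}, ?_, conn_singleton u, acyc_singleton u⟩
        rw [if_pos hvK, Finset.insert_subset_iff]
        refine ⟨by simp, fun k hk => ?_⟩
        rw [Finset.mem_erase] at hk
        exact absurd (Finset.mem_singleton.1 (hKS hk.2)) hk.1
    · rw [if_neg fun h => hvS (hKS h)]
      exact ⟨S, hKS, hcongr S hvS hS⟩

/-- A terminal `x` of degree two may hand its status on to a neighbour `y` of degree two. -/
theorem Yes.move (hx : ∀ w, G.Adj x w ↔ w = a ∨ w = y) (hy : ∀ w, G.Adj y w ↔ w = x ∨ w = b)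
    (hay : a ≠ y) (hbx : b ≠ x) (hxK : x ∈ K) (h : Yes G K) : Yes G (insert y (K.erase x)) := by
  have hxy : x ≠ y := ((hx y).2 (Or.inr rfl)).ne
  have hxa : a ≠ x := ((hx a).2 (Or.inl rfl)).ne'
  have hyb : b ≠ y := ((hy b).2 (Or.inr rfl)).ne'
  obtain ⟨S, hKS, hS⟩ := h
  have hxS := hKS hxK
  have hK' : K.erase x ⊆ S := (Finset.erase_subset _ _).trans hKS
  by_cases hyS : y ∈ S
  · exact ⟨S, Finset.insert_subset hyS hK', hS⟩
  -- If `y` is outside the tree `S`, then `x` is a leaf of it. Either `y` replaces `x`, as a leaf at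
  -- `b`, or it is added as a leaf at `x`.
  by_cases hbS : b ∈ S
  · obtain ⟨w, hw, hxw⟩ := hS.1.exists_adj hxS hbS hbx
    have haS : a ∈ S := by
      rcases (hx w).1 hxw with rfl | rfl
      · exact hw
      · exact absurd hw hyS
    have h1 := (tree_erase_leaf hxS haS fun w hw => by
      rw [hx]
      exact or_iff_left fun e => hyS (e ▸ hw)).2 hS
    have h2 := (tree_insert_leaf (S := S.erase x) (v := y) (u := b)
      (fun h => hyS (Finset.mem_of_mem_erase h)) (Finset.mem_erase.2 ⟨hbx, hbS⟩) fun w hw => by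
      rw [hy]
      exact or_iff_right (Finset.ne_of_mem_erase hw)).2 h1
    exact ⟨_, Finset.insert_subset_insert _ (Finset.erase_subset_erase _ hKS), h2⟩
  · refine ⟨insert y S, Finset.insert_subset_insert _ hK',
      (tree_insert_leaf hyS hxS fun w hw => ?_).2 hS⟩
    rw [hy]
    exact or_iff_left fun e => hbS (e ▸ hw)

/-- If exactly one of two adjacent vertices of degree two is a terminal, it does not matter which. -/
theorem yes_move_iff (hx : ∀ w, G.Adj x w ↔ w = a ∨ w = y) (hy : ∀ w, G.Adj y w ↔ w = x ∨ w = b)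
    (hay : a ≠ y) (hbx : b ≠ x) (hxK : x ∈ K) (hyK : y ∉ K) :
    Yes G (insert y (K.erase x)) ↔ Yes G K := by
  refine ⟨fun h => ?_, fun h => h.move hx hy hay hbx hxK⟩
  have := h.move (x := y) (y := x) (a := b) (b := a) (fun w => (hy w).trans or_comm)
    (fun w => (hx w).trans or_comm) hbx hay (Finset.mem_insert_self _ _)
  rwa [Finset.erase_insert (fun h => hyK (Finset.mem_of_mem_erase h)), Finset.insert_erase hxK]
    at this

/-- Inserting the vertex `y` into the edge between its neighbours preserves connectedness. -/
theorem conn_bypass (hyS : y ∉ S) (hxS : x ∈ S) (hzS : z ∈ S) (hxz : x ≠ z)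
    (hy : ∀ w, G.Adj y w ↔ w = x ∨ w = z) :
    Conn (bypass G x y z) S ↔ Conn G (insert y S) := by
  refine ⟨fun h => ⟨⟨y, by simp⟩, fun A hA hne hcl => ?_⟩, fun h => ⟨⟨x, hxS⟩, fun A hA hne hcl => ?_⟩⟩
  · have hS : ∀ c ∈ A, c ≠ y → S ⊆ A := by
      intro c hc hcy
      have := h.2 (A.erase y) (fun d hd => by
        rw [Finset.mem_erase] at hd
        exact (Finset.mem_insert.1 (hA hd.2)).resolve_left hd.1)
        ⟨c, Finset.mem_erase.2 ⟨hcy, hc⟩⟩ (by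
        intro d hd e he hde
        rw [Finset.mem_erase] at hd
        refine Finset.mem_erase.2 ⟨hde.2.2.1, ?_⟩
        rcases hde.2.2.2 with h' | ⟨rfl, rfl⟩ | ⟨rfl, rfl⟩
        · exact hcl d hd.2 e (Finset.mem_insert_of_mem he) h'
        · exact hcl y (hcl d hd.2 y (by simp) ((hy d).2 (Or.inl rfl)).symm) e
            (Finset.mem_insert_of_mem he) ((hy e).2 (Or.inr rfl))
        · exact hcl y (hcl d hd.2 y (by simp) ((hy d).2 (Or.inr rfl)).symm) e
            (Finset.mem_insert_of_mem he) ((hy e).2 (Or.inl rfl)))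
      exact this.trans (Finset.erase_subset _ _)
    have hxA : x ∈ A := by
      obtain ⟨c, hc⟩ := hne
      by_cases hcy : c = y
      · exact hcl c hc x (Finset.mem_insert_of_mem hxS) (hcy ▸ (hy x).2 (Or.inl rfl))
      · exact hS c hc hcy hxS
    exact Finset.insert_subset (hcl x hxA y (by simp) ((hy x).2 (Or.inl rfl)).symm)
      (hS x hxA fun e => hyS (e ▸ hxS))
  · have hiff : x ∈ A ↔ z ∈ A := by
      have hyx : x ≠ y := fun e => hyS (e ▸ hxS)
      have hyz : z ≠ y := fun e => hyS (e ▸ hzS)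
      exact ⟨fun hx => hcl x hx z hzS ⟨hxz, hyx, hyz, by simp⟩,
        fun hz => hcl z hz x hxS ⟨hxz.symm, hyz, hyx, by simp⟩⟩
    have hcl' : ∀ c ∈ A, ∀ d ∈ S, G.Adj c d → d ∈ A := fun c hc d hd hcd =>
      hcl c hc d hd ⟨hcd.ne, fun e => hyS (e ▸ hA hc), fun e => hyS (e ▸ hd), Or.inl hcd⟩
    by_cases hxA : x ∈ A
    · have := h.2 (insert y A) (Finset.insert_subset_insert _ hA) (by simp) (by
        intro c hc d hd hcd
        rw [Finset.mem_insert] at hc hd ⊢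
        rcases hd with rfl | hd
        · exact Or.inl rfl
        rcases hc with rfl | hc
        · rcases (hy d).1 hcd with rfl | rfl
          · exact Or.inr hxA
          · exact Or.inr (hiff.1 hxA)
        · exact Or.inr (hcl' c hc d hd hcd))
      intro c hc
      exact (Finset.mem_insert.1 (this (Finset.mem_insert_of_mem hc))).resolve_left
        fun e => hyS (e ▸ hc)
    · have := h.2 A (hA.trans (Finset.subset_insert _ _)) hne (by
        intro c hc d hd hcd
        rcases Finset.mem_insert.1 hd with rfl | hd
        · rcases (hy c).1 hcd.symm with rfl | rfl
          · exact absurd hc hxA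
          · exact absurd (hiff.2 hc) hxA
        · exact hcl' c hc d hd hcd)
      exact (Finset.subset_insert _ _).trans this

/-- Inserting the vertex `y` into the edge between its neighbours `x` and `z` preserves acyclicity. If
`x` and `z` were adjacent before, the triangle `x, y, z` would be lost. -/
theorem acyc_bypass (hyS : y ∉ S) (hxS : x ∈ S) (hzS : z ∈ S) (hxz : x ≠ z) (hnxz : ¬ G.Adj x z)
    (hy : ∀ w, G.Adj y w ↔ w = x ∨ w = z) :
    Acyc (bypass G x y z) S ↔ Acyc G (insert y S) := by
  have hyx : x ≠ y := fun e => hyS (e ▸ hxS)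
  have hyz : z ≠ y := fun e => hyS (e ▸ hzS)
  have hle : ∀ c d, c ≠ y → d ≠ y → G.Adj c d → (bypass G x y z).Adj c d := fun c d hc hd h =>
    ⟨h.ne, hc, hd, Or.inl h⟩
  have hxzb : (bypass G x y z).Adj x z := ⟨hxz, hyx, hyz, by simp⟩
  refine ⟨fun h A hA hne => ?_, fun h A hA hne => ?_⟩
  · have hAS : ∀ c ∈ A, c ≠ y → c ∈ S := fun c hc hcy =>
      (Finset.mem_insert.1 (hA hc)).resolve_left hcy
    by_cases hyA : y ∈ A
    · by_cases hxA : x ∈ A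
      · by_cases hzA : z ∈ A
        · -- a low vertex of `A` without `y` after the bypass is low in `A` before it
          obtain ⟨c, hc, h1⟩ := h (A.erase y) (fun d hd => hAS d (Finset.mem_of_mem_erase hd)
            (Finset.ne_of_mem_erase hd)) ⟨x, Finset.mem_erase.2 ⟨hyx, hxA⟩⟩
          rw [Finset.mem_erase] at hc
          refine ⟨c, hc.2, fun d hd e he hcd hce => ?_⟩
          have key : ∀ d ∈ A, d ≠ y → G.Adj c d → ∀ e ∈ A, (bypass G x y z).Adj c e → e = d :=
            fun d hd hdy hcd e he hce => h1 e (Finset.mem_erase.2 ⟨hce.2.2.1, he⟩) d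
              (Finset.mem_erase.2 ⟨hdy, hd⟩) hce (hle _ _ hc.1 hdy hcd)
          have key2 : ∀ d ∈ A, d ≠ y → G.Adj c d → ¬ G.Adj c y := by
            intro d hd hdy hcd hcy
            rcases (hy c).1 hcy.symm with rfl | rfl
            · exact hnxz (key d hd hdy hcd z hzA hxzb ▸ hcd)
            · exact hnxz (key d hd hdy hcd x hxA hxzb.symm ▸ hcd).symm
          by_cases hdy : d = y
          · by_cases hey : e = y
            · rw [hdy, hey]
            · exact absurd (hdy ▸ hcd) (key2 e he hey hce)
          · by_cases hey : e = y
            · exact absurd (hey ▸ hce) (key2 d hd hdy hcd)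
            · exact (key d hd hdy hcd e he (hle _ _ hc.1 hey hce)).symm
        · refine ⟨y, hyA, fun d hd e he hcd hce => ?_⟩
          have : ∀ d ∈ A, G.Adj y d → d = x := fun d hd h =>
            ((hy d).1 h).resolve_right fun e => hzA (e ▸ hd)
          rw [this d hd hcd, this e he hce]
      · refine ⟨y, hyA, fun d hd e he hcd hce => ?_⟩
        have : ∀ d ∈ A, G.Adj y d → d = z := fun d hd h =>
          ((hy d).1 h).resolve_left fun e => hxA (e ▸ hd)
        rw [this d hd hcd, this e he hce]
    · obtain ⟨c, hc, h1⟩ := h A (fun c hc => hAS c hc fun e => hyA (e ▸ hc)) hne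
      have hle' : ∀ d ∈ A, G.Adj c d → (bypass G x y z).Adj c d := fun d hd hcd =>
        hle c d (fun e => hyA (e ▸ hc)) (fun e => hyA (e ▸ hd)) hcd
      exact ⟨c, hc, fun d hd e he hcd hce => h1 d hd e he (hle' d hd hcd) (hle' e he hce)⟩
  · by_cases hxzA : x ∈ A ∧ z ∈ A
    · obtain ⟨c, hc, h1⟩ := h (insert y A) (Finset.insert_subset_insert _ hA) (by simp)
      have hyA : y ∉ A := fun h => hyS (hA h)
      have hcy : c ≠ y := by
        rintro rfl
        exact hxz (h1 x (Finset.mem_insert_of_mem hxzA.1) z (Finset.mem_insert_of_mem hxzA.2)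
          ((hy x).2 (Or.inl rfl)) ((hy z).2 (Or.inr rfl)))
      have hcA : c ∈ A := (Finset.mem_insert.1 hc).resolve_left hcy
      refine ⟨c, hcA, ?_⟩
      by_cases hcy' : G.Adj c y
      · have hno : ∀ d ∈ A, ¬ G.Adj c d := fun d hd hcd => hyA
          (h1 y (Finset.mem_insert_self _ _) d (Finset.mem_insert_of_mem hd) hcy' hcd ▸ hd)
        intro d hd e he hcd hce
        rcases hcd.2.2.2 with h' | ⟨h', rfl⟩ | ⟨h', rfl⟩
        · exact absurd h' (hno d hd)
        all_goals rcases hce.2.2.2 with h'' | ⟨h'', rfl⟩ | ⟨h'', rfl⟩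
        · exact absurd h'' (hno e he)
        · rfl
        · exact absurd (h'.symm.trans h'') hxz
        · exact absurd h'' (hno e he)
        · exact absurd (h''.symm.trans h') hxz
        · rfl
      · have hc' : ∀ d, (bypass G x y z).Adj c d → G.Adj c d := by
          intro d hcd
          rcases hcd.2.2.2 with h' | ⟨rfl, rfl⟩ | ⟨rfl, rfl⟩
          · exact h'
          · exact absurd ((hy c).2 (Or.inl rfl)).symm hcy'
          · exact absurd ((hy c).2 (Or.inr rfl)).symm hcy'
        exact fun d hd e he hcd hce => h1 d (Finset.mem_insert_of_mem hd) e
          (Finset.mem_insert_of_mem he) (hc' d hcd) (hc' e hce)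
    · refine Acyc.anti (h.subset (hA.trans (Finset.subset_insert _ _))) (fun c hc d hd hcd => ?_) A
        subset_rfl hne
      rcases hcd.2.2.2 with h' | ⟨rfl, rfl⟩ | ⟨rfl, rfl⟩
      · exact h'
      · exact absurd ⟨hc, hd⟩ hxzA
      · exact absurd ⟨hd, hc⟩ hxzA

/-- A vertex `y` of degree two is bypassed if a neighbour `x` of degree two has the same status. -/
theorem yes_bypass (hK : K.Nonempty) (hx : ∀ w, G.Adj x w ↔ w = a ∨ w = y)
    (hy : ∀ w, G.Adj y w ↔ w = x ∨ w = z) (hxz : x ≠ z) (hnxz : ¬ G.Adj x z)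
    (hxy : x ∈ K ↔ y ∈ K) : Yes (bypass G x y z) (K.erase y) ↔ Yes G K := by
  have hyx : x ≠ y := ((hy x).2 (Or.inl rfl)).ne'
  have hyz : z ≠ y := ((hy z).2 (Or.inr rfl)).ne'
  have hKe : (K.erase y).Nonempty := by
    by_cases h : y ∈ K
    · exact ⟨x, Finset.mem_erase.2 ⟨hyx, hxy.2 h⟩⟩
    · rwa [Finset.erase_eq_of_notMem h]
  -- a set that does not contain both ends of the new edge does not see the difference
  have hcongr : ∀ S : Finset V, y ∉ S → ¬ (x ∈ S ∧ z ∈ S) →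
      ((Conn (bypass G x y z) S ∧ Acyc (bypass G x y z) S) ↔ (Conn G S ∧ Acyc G S)) := by
    intro S hyS hxzS
    refine tree_congr fun c hc d hd => ⟨fun h => ?_, fun h => ⟨h.ne, fun e => hyS (e ▸ hc),
      fun e => hyS (e ▸ hd), Or.inl h⟩⟩
    rcases h.2.2.2 with h' | ⟨rfl, rfl⟩ | ⟨rfl, rfl⟩
    · exact h'
    · exact absurd ⟨hc, hd⟩ hxzS
    · exact absurd ⟨hd, hc⟩ hxzS
  constructor
  · rintro ⟨S, hKS, hS⟩
    have hyS : y ∉ S := by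
      intro hyS
      have hs := hS.1.eq_singleton hyS (fun w _ h => h.2.1 rfl)
      obtain ⟨k, hk⟩ := hKe
      have := hKS hk
      rw [hs, Finset.mem_singleton] at this
      exact (Finset.ne_of_mem_erase hk) this
    have hKS' : K ⊆ insert y S := fun k hk => by
      by_cases hky : k = y
      · simp [hky]
      · exact Finset.mem_insert_of_mem (hKS (Finset.mem_erase.2 ⟨hky, hk⟩))
    by_cases hxzS : x ∈ S ∧ z ∈ S
    · exact ⟨insert y S, hKS', (conn_bypass hyS hxzS.1 hxzS.2 hxz hy).1 hS.1,
        (acyc_bypass hyS hxzS.1 hxzS.2 hxz hnxz hy).1 hS.2⟩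
    · have hS' := (hcongr S hyS hxzS).1 hS
      by_cases hyK : y ∈ K
      · have hxS : x ∈ S := hKS (Finset.mem_erase.2 ⟨hyx, hxy.2 hyK⟩)
        refine ⟨insert y S, hKS', (tree_insert_leaf hyS hxS fun w hw => ?_).2 hS'⟩
        rw [hy]
        exact or_iff_left fun e => hxzS ⟨hxS, e ▸ hw⟩
      · rw [Finset.erase_eq_of_notMem hyK] at hKS
        exact ⟨S, hKS, hS'⟩
  · rintro ⟨S, hKS, hS⟩
    have hKS' : K.erase y ⊆ S.erase y := Finset.erase_subset_erase _ hKS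
    by_cases hyS : y ∈ S
    · by_cases hxS : x ∈ S
      · by_cases hzS : z ∈ S
        · refine ⟨S.erase y, hKS', ?_⟩
          rw [← Finset.insert_erase hyS] at hS
          have h1 : x ∈ S.erase y := Finset.mem_erase.2 ⟨hyx, hxS⟩
          have h2 : z ∈ S.erase y := Finset.mem_erase.2 ⟨hyz, hzS⟩
          exact ⟨(conn_bypass (by simp) h1 h2 hxz hy).2 hS.1,
            (acyc_bypass (by simp) h1 h2 hxz hnxz hy).2 hS.2⟩
        · refine ⟨S.erase y, hKS', (hcongr _ (by simp) fun h => hzS (Finset.mem_of_mem_erase h.2)).2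
            ((tree_erase_leaf hyS hxS fun w hw => ?_).2 hS)⟩
          rw [hy]
          exact or_iff_left fun e => hzS (e ▸ hw)
      · by_cases hzS : z ∈ S
        · refine ⟨S.erase y, hKS', (hcongr _ (by simp) fun h => hxS (Finset.mem_of_mem_erase h.1)).2
            ((tree_erase_leaf hyS hzS fun w hw => ?_).2 hS)⟩
          rw [hy]
          exact or_iff_right fun e => hxS (e ▸ hw)
        · have hs := hS.1.eq_singleton hyS (fun w hw h => by
            rcases (hy w).1 h with rfl | rfl
            · exact hxS hw
            · exact hzS hw)
          obtain ⟨k, hk⟩ := hKe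
          rw [Finset.mem_erase] at hk
          have := hKS hk.2
          rw [hs, Finset.mem_singleton] at this
          exact absurd this hk.1
    · -- the status of `x` is that of `y`, so `x` is not needed in the tree
      have hyK : y ∉ K := fun h => hyS (hKS h)
      have hxK : x ∉ K := fun h => hyK (hxy.1 h)
      rw [Finset.erase_eq_of_notMem hyK]
      by_cases hxzS : x ∈ S ∧ z ∈ S
      · -- here `x` is a leaf of the tree, and joining it to `z` would close a cycle
        obtain ⟨w, hw, hxw⟩ := hS.1.exists_adj hxzS.1 hxzS.2 hxz.symm
        have haS : a ∈ S := by
          rcases (hx w).1 hxw with rfl | rfl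
          · exact hw
          · exact absurd hw hyS
        refine ⟨S.erase x, fun k hk => Finset.mem_erase.2 ⟨fun e => hxK (e ▸ hk), hKS hk⟩,
          (hcongr _ (fun h => hyS (Finset.mem_of_mem_erase h)) (by simp)).2
            ((tree_erase_leaf hxzS.1 haS fun w hw => ?_).2 hS)⟩
        rw [hx]
        exact or_iff_left fun e => hyS (e ▸ hw)
      · exact ⟨S, hKS, (hcongr S hyS hxzS).2 hS⟩

/-- In the middle of a path `x, y, z` of vertices of degree two, `y` is bypassed. Two of the three
have the same status, and it suffices to remember which statuses occur: if `x` and `z` have the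
same status, then `x` takes over the status of `y`. -/
theorem yes_bypass_status (hK : K.Nonempty) (hx : ∀ w, G.Adj x w ↔ w = a ∨ w = y)
    (hy : ∀ w, G.Adj y w ↔ w = x ∨ w = z) (hz : ∀ w, G.Adj z w ↔ w = b ∨ w = y)
    (hay : a ≠ y) (hxz : x ≠ z) (hnxz : ¬ G.Adj x z) :
    Yes (bypass G x y z)
      ((if x ∈ K ↔ z ∈ K then (if y ∈ K then insert x K else K.erase x) else K).erase y) ↔
    Yes G K := by
  have hyx : x ≠ y := ((hy x).2 (Or.inl rfl)).ne'
  have hyz : z ≠ y := ((hy z).2 (Or.inr rfl)).ne'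
  have hnzx : ¬ G.Adj z x := fun h => hnxz h.symm
  have hyz' : ∀ w, G.Adj y w ↔ w = z ∨ w = x := fun w => (hy w).trans or_comm
  by_cases h : x ∈ K ↔ z ∈ K
  · rw [if_pos h]
    by_cases hyK : y ∈ K
    · rw [if_pos hyK]
      by_cases hxK : x ∈ K
      · rw [Finset.insert_eq_self.2 hxK]
        exact yes_bypass hK hx hy hxz hnxz (by tauto)
      · rw [Finset.erase_insert_of_ne hyx]
        rw [← yes_move_iff (x := y) (y := x) (a := z) (b := a) (fun w => (hyz' w))
          (fun w => (hx w).trans or_comm) hxz.symm hay hyK hxK]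
        have hz2 : (z ∈ insert x (K.erase y)) ↔ (y ∈ insert x (K.erase y)) := by
          simp [hxz.symm, hyx.symm, h.symm.trans (iff_false_intro hxK)]
        rw [bypass_comm, ← yes_bypass (by simp) hz hyz' hxz.symm hnzx hz2,
          Finset.erase_insert_of_ne hyx, Finset.erase_idem]
    · rw [if_neg hyK]
      by_cases hxK : x ∈ K
      · rw [← yes_move_iff hx hy hay hxz.symm hxK hyK]
        have hz2 : (z ∈ insert y (K.erase x)) ↔ (y ∈ insert y (K.erase x)) := by
          simp [hxz.symm, h.1 hxK]
        rw [bypass_comm, ← yes_bypass (by simp) hz hyz' hxz.symm hnzx hz2,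
          Finset.erase_insert_eq_erase]
      · rw [Finset.erase_eq_of_notMem hxK]
        exact yes_bypass hK hx hy hxz hnxz (by tauto)
  · rw [if_neg h]
    by_cases hxy : x ∈ K ↔ y ∈ K
    · exact yes_bypass hK hx hy hxz hnxz hxy
    · rw [bypass_comm]
      exact yes_bypass hK hz hyz' hxz.symm hnzx (by tauto)

/-- Bypassing keeps the size of a feedback edge set: an edge of it at `y` is replaced by the new
edge. -/
theorem Fes.bypass {q : ℕ} (h : Fes G q) (hy : ∀ w, G.Adj y w ↔ w = x ∨ w = z) (hxz : x ≠ z)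
    (hnxz : ¬ G.Adj x z) : Fes (bypass G x y z) q := by
  have hyx : x ≠ y := ((hy x).2 (Or.inl rfl)).ne'
  have hyz : z ≠ y := ((hy z).2 (Or.inr rfl)).ne'
  obtain ⟨F, hF, hA⟩ := h
  have key : ∀ u, s(u, y) ∈ F → Fes (InTree.bypass G x y z) q := by
    intro u hu
    refine ⟨insert s(x, z) (F.erase s(u, y)), ?_, fun S => (hA S).anti fun c _ d _ hcd => ?_⟩
    · have := Finset.card_insert_le s(x, z) (F.erase s(u, y))
      rw [Finset.card_erase_of_mem hu] at this
      have := Finset.card_pos.2 ⟨_, hu⟩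
      omega
    · rw [SimpleGraph.deleteEdges_adj, Finset.mem_coe, Finset.mem_insert, not_or,
        Finset.mem_erase, not_and] at hcd
      rw [SimpleGraph.deleteEdges_adj, Finset.mem_coe]
      obtain ⟨h1, h2, h3⟩ := hcd
      have hne : s(c, d) ≠ s(u, y) := by
        intro e
        have : y ∈ s(c, d) := e ▸ Sym2.mem_mk_right u y
        rcases Sym2.mem_iff.1 this with e' | e'
        · exact h1.2.1 e'.symm
        · exact h1.2.2.1 e'.symm
      refine ⟨?_, h3 hne⟩
      rcases h1.2.2.2 with h' | ⟨rfl, rfl⟩ | ⟨rfl, rfl⟩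
      · exact h'
      · exact absurd rfl h2
      · exact absurd Sym2.eq_swap h2
  by_cases hxF : s(x, y) ∈ F
  · exact key x hxF
  by_cases hzF : s(z, y) ∈ F
  · exact key z hzF
  refine ⟨F, hF, fun S => ?_⟩
  have h1 : Acyc (InTree.bypass (G.deleteEdges (F : Set (Sym2 V))) x y z)
      (insert x (insert z (S.erase y))) := by
    refine (acyc_bypass (by simp [hyx.symm, hyz.symm]) (by simp) (by simp) hxz
      (fun h => hnxz (SimpleGraph.deleteEdges_le _ h)) fun w => ?_).2 (hA _)
    rw [SimpleGraph.deleteEdges_adj, hy, Finset.mem_coe, and_iff_left_iff_imp]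
    rintro (rfl | rfl)
    · rwa [Sym2.eq_swap]
    · rwa [Sym2.eq_swap]
  have h2 : Acyc ((InTree.bypass G x y z).deleteEdges (F : Set (Sym2 V))) (S.erase y) := by
    refine (h1.subset (fun c hc => by simp only [Finset.mem_insert]; tauto)).anti ?_
    intro c _ d _ hcd
    rw [SimpleGraph.deleteEdges_adj, bypass_adj] at hcd
    rw [bypass_adj, SimpleGraph.deleteEdges_adj]
    tauto
  intro A hA hne
  by_cases hyA : y ∈ A
  · exact ⟨y, hyA, fun b _ c _ hb _ => absurd rfl
      ((SimpleGraph.deleteEdges_le _ hb : (InTree.bypass G x y z).Adj y b)).2.1⟩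
  · exact h2 A (fun c hc => Finset.mem_erase.2 ⟨fun e => hyA (e ▸ hc), hA hc⟩) hne

end Rules

/-! ### Change of the vertex set -/

section Transport

variable {V W : Type*} [DecidableEq V]

/-- Vertices without edges may be dropped if no terminal is among them, or if two other terminals
have no edges, in which case neither instance is positive. -/
theorem hasInducedTree_comap_iff [Finite W] {H : SimpleGraph V} {K : Finset V} (f : W → V)
    (hf : Function.Injective f) (hK : K.Nonempty) (hiso : ∀ v, v ∉ Set.range f → ∀ w, ¬ H.Adj v w)
    (hrange : (∀ k ∈ K, k ∈ Set.range f) ∨ ∃ a b, a ≠ b ∧ f a ∈ K ∧ f b ∈ K ∧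
      (∀ w, ¬ H.Adj (f a) w) ∧ ∀ w, ¬ H.Adj (f b) w)
    {L : Finset W} (hL : ∀ w, w ∈ L ↔ f w ∈ K) :
    HasInducedTree (H.comap f) L ↔ Yes H K := by
  classical
  have hfin : HasInducedTree (H.comap f) L ↔ Yes (H.comap f) L := by
    constructor
    · rintro ⟨S, hLS, hS⟩
      obtain ⟨T, rfl⟩ := S.toFinite.exists_finset_coe
      exact ⟨T, Finset.coe_subset.1 hLS, isTree_induce_iff.1 hS⟩
    · rintro ⟨T, hLT, hT⟩
      exact ⟨T, Finset.coe_subset.2 hLT, isTree_induce_iff.2 hT⟩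
  rw [hfin]
  rcases hrange with hrange | ⟨a, b, hab, ha, hb, ha', hb'⟩
  · constructor
    · rintro ⟨T, hLT, hT⟩
      refine ⟨T.image f, fun k hk => ?_, (conn_image f hf T).2 hT.1, (acyc_image f hf T).2 hT.2⟩
      obtain ⟨w, rfl⟩ := hrange k hk
      exact Finset.mem_image_of_mem f (hLT ((hL w).2 hk))
    · rintro ⟨S, hKS, hS⟩
      have hSr : ∀ v ∈ S, v ∈ Set.range f := by
        intro v hv
        by_contra hvr
        have hs := hS.1.eq_singleton hv fun w _ => hiso v hvr w
        obtain ⟨k, hk⟩ := hK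
        have := hKS hk
        rw [hs, Finset.mem_singleton] at this
        exact hvr (this ▸ hrange k hk)
      obtain ⟨T, rfl⟩ : ∃ T : Finset W, T.image f = S := by
        refine ⟨S.preimage f hf.injOn, ?_⟩
        rw [Finset.image_preimage, Finset.filter_true_of_mem hSr]
      refine ⟨T, fun w hw => ?_, (conn_image f hf T).1 hS.1, (acyc_image f hf T).1 hS.2⟩
      obtain ⟨u, hu, huw⟩ := Finset.mem_image.1 (hKS ((hL w).1 hw))
      exact hf huw ▸ hu
  · constructor
    · rintro ⟨T, hLT, hT⟩
      have hs := hT.1.eq_singleton (hLT ((hL a).2 ha)) fun w _ => ha' _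
      have := hLT ((hL b).2 hb)
      rw [hs, Finset.mem_singleton] at this
      exact absurd this.symm hab
    · rintro ⟨S, hKS, hS⟩
      have hs := hS.1.eq_singleton (hKS ha) fun w _ => ha' _
      have := hKS hb
      rw [hs, Finset.mem_singleton] at this
      exact absurd (hf this.symm) hab

theorem fes_of_comap {H : SimpleGraph V} (f : W → V) (hf : Function.Injective f)
    (hiso : ∀ v, v ∉ Set.range f → ∀ w, ¬ H.Adj v w) {F : Finset (Sym2 W)} {q : ℕ}
    (hF : IsFeedbackEdgeSet (H.comap f) F) (hq : F.card ≤ q) : Fes H q := by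
  classical
  refine ⟨F.image (Sym2.map f), Finset.card_image_le.trans hq, fun S A hA hne => ?_⟩
  by_cases hr : ∀ v ∈ A, v ∈ Set.range f
  · obtain ⟨B, rfl⟩ : ∃ B : Finset W, B.image f = A := by
      refine ⟨A.preimage f hf.injOn, ?_⟩
      rw [Finset.image_preimage, Finset.filter_true_of_mem hr]
    refine (acyc_image f hf B).2 ?_ _ subset_rfl hne
    refine (isAcyclic_iff_acyc.1 hF.2 B).anti fun a _ b _ hab => ?_
    rw [SimpleGraph.comap_adj, SimpleGraph.deleteEdges_adj] at hab
    rw [SimpleGraph.deleteEdges_adj]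
    exact ⟨hab.1, fun h => hab.2 (by simpa using ⟨_, h, rfl⟩)⟩
  · push Not at hr
    obtain ⟨v, hv, hvr⟩ := hr
    exact ⟨v, hv, fun b _ c _ hb _ => absurd (SimpleGraph.deleteEdges_le _ hb) (hiso v hvr b)⟩

theorem Fes.comap [Finite W] {H : SimpleGraph V} (f : W → V) (hf : Function.Injective f) {q : ℕ}
    (h : Fes H q) : ∃ F : Finset (Sym2 W), IsFeedbackEdgeSet (H.comap f) F ∧ F.card ≤ q := by
  classical
  obtain ⟨F, hF, hA⟩ := h
  have hinj := Sym2.map.injective hf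
  refine ⟨(F.preimage (Sym2.map f) hinj.injOn).filter (· ∈ (H.comap f).edgeSet), ⟨?_, ?_⟩, ?_⟩
  · intro e he
    exact (Finset.mem_filter.1 (Finset.mem_coe.1 he)).2
  · refine isAcyclic_iff_acyc.2 fun S => ?_
    refine ((acyc_image f hf S).1 (hA _)).anti fun a _ b _ hab => ?_
    rw [SimpleGraph.deleteEdges_adj] at hab
    rw [SimpleGraph.comap_adj, SimpleGraph.deleteEdges_adj]
    refine ⟨hab.1, fun h => hab.2 ?_⟩
    rw [Finset.mem_coe, Finset.mem_filter, Finset.mem_preimage]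
    exact ⟨h, hab.1⟩
  · refine (Finset.card_filter_le _ _).trans (le_trans ?_ hF)
    rw [Finset.card_preimage]
    exact Finset.card_filter_le _ _

end Transport

/-! ### The size of a reduced graph -/

section Counting

variable {V W : Type*}

/-- The vertex `v` has at least three neighbours. -/
def Branch (G : SimpleGraph V) (v : V) : Prop :=
  ∃ a b c, a ≠ b ∧ a ≠ c ∧ b ≠ c ∧ G.Adj v a ∧ G.Adj v b ∧ G.Adj v c

/-- The neighbours of `v` are the two vertices `x` and `z`. -/
def Link (G : SimpleGraph V) (v x z : V) : Prop :=
  x ≠ z ∧ ∀ w, G.Adj v w ↔ w = x ∨ w = z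

/-- The vertex `v` has exactly two neighbours, and one of these has at least three neighbours or
`v` lies in a triangle that is a connected component. -/
def Settled (G : SimpleGraph V) (v : V) : Prop :=
  ∃ x z, Link G v x z ∧ (Branch G x ∨ Branch G z ∨ Link G x v z ∧ Link G z v x)

/-- No vertex is a leaf, and no path of vertices of degree two can be shortened. -/
def Reduced (G : SimpleGraph V) : Prop :=
  ∀ v, (∀ w, ¬ G.Adj v w) ∨ Branch G v ∨ Settled G v

theorem Reduced.comap {H : SimpleGraph V} (h : Reduced H) (f : W → V) (hf : Function.Injective f)
    (hiso : ∀ v, v ∉ Set.range f → ∀ w, ¬ H.Adj v w) : Reduced (H.comap f) := by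
  have hr : ∀ v w, H.Adj v w → ∃ u, f u = w := fun v w hvw => by
    by_contra hw
    exact hiso w hw v hvw.symm
  have hB : ∀ v, Branch H (f v) → Branch (H.comap f) v := by
    rintro v ⟨a, b, c, hab, hac, hbc, ha, hb, hc⟩
    obtain ⟨a, rfl⟩ := hr _ _ ha
    obtain ⟨b, rfl⟩ := hr _ _ hb
    obtain ⟨c, rfl⟩ := hr _ _ hc
    exact ⟨a, b, c, ne_of_apply_ne f hab, ne_of_apply_ne f hac, ne_of_apply_ne f hbc, ha, hb, hc⟩
  have hL : ∀ v x z, Link H (f v) (f x) (f z) → Link (H.comap f) v x z := fun v x z h =>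
    ⟨ne_of_apply_ne f h.1, fun w => by rw [SimpleGraph.comap_adj, h.2, hf.eq_iff, hf.eq_iff]⟩
  intro v
  rcases h (f v) with h' | h' | ⟨x, z, h1, h2⟩
  · exact Or.inl fun w => h' _
  · exact Or.inr (Or.inl (hB v h'))
  · obtain ⟨x, rfl⟩ := hr _ _ ((h1.2 x).2 (Or.inl rfl))
    obtain ⟨z, rfl⟩ := hr _ _ ((h1.2 z).2 (Or.inr rfl))
    exact Or.inr (Or.inr ⟨x, z, hL _ _ _ h1, h2.imp (hB x) (Or.imp (hB z)
      (And.imp (hL _ _ _) (hL _ _ _)))⟩)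

/-- A forest has average degree at most two. -/
theorem Acyc.sum_card_le {G : SimpleGraph V} [DecidableRel G.Adj] {S : Finset V} (h : Acyc G S) :
    ∑ a ∈ S, (S.filter (G.Adj a)).card ≤ 2 * S.card := by
  classical
  induction hn : S.card generalizing S with
  | zero => rw [Finset.card_eq_zero] at hn; simp [hn]
  | succ n ih =>
    obtain ⟨a, ha, h1⟩ := h S subset_rfl (Finset.card_pos.1 (by omega))
    have hle : (S.filter (G.Adj a)).card ≤ 1 := Finset.card_le_one.2 fun b hb c hc => by
      rw [Finset.mem_filter] at hb hc
      exact h1 b hb.1 c hc.1 hb.2 hc.2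
    have hcard : (S.erase a).card = n := by rw [Finset.card_erase_of_mem ha]; omega
    have ih' := ih (h.subset (Finset.erase_subset a S)) hcard
    have hsplit : ∀ b ∈ S.erase a, (S.filter (G.Adj b)).card =
        ((S.erase a).filter (G.Adj b)).card + if G.Adj a b then 1 else 0 := by
      intro b hb
      rw [← Finset.insert_erase ha, Finset.filter_insert, Finset.erase_insert_eq_erase,
        Finset.erase_idem]
      simp only [G.adj_comm b a]
      split_ifs with hab
      · rw [Finset.card_insert_of_notMem (by simp)]
      · simp
    rw [← Finset.add_sum_erase _ _ ha, Finset.sum_congr rfl hsplit, Finset.sum_add_distrib]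
    have : (∑ b ∈ S.erase a, if G.Adj a b then 1 else 0) ≤ 1 := by
      rw [← Finset.card_filter]
      refine (Finset.card_le_card fun b hb => ?_).trans hle
      rw [Finset.mem_filter] at hb ⊢
      exact ⟨Finset.mem_of_mem_erase hb.1, hb.2⟩
    omega

/-- The edges outside a feedback edge set form a forest, so the sum of the degrees exceeds twice the
number of nonisolated vertices by at most twice the size of the feedback edge set. -/
theorem IsFeedbackEdgeSet.sum_degree_le [Fintype W] {G : SimpleGraph W} [DecidableRel G.Adj]
    {F : Finset (Sym2 W)} (hF : IsFeedbackEdgeSet G F) {B : Finset W}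
    (hB : ∀ v w, G.Adj v w → w ∈ B) : ∑ v, G.degree v ≤ 2 * B.card + 2 * F.card := by
  classical
  have hforest : ∑ v, (G.deleteEdges (F : Set (Sym2 W))).degree v ≤ 2 * B.card := by
    have hB' : ∀ v w, (G.deleteEdges (F : Set (Sym2 W))).Adj v w → w ∈ B := fun v w hvw =>
      hB v w (SimpleGraph.deleteEdges_le _ hvw)
    refine le_trans (le_of_eq ?_) (isAcyclic_iff_acyc.1 hF.2 B).sum_card_le
    rw [← Finset.sum_subset (Finset.subset_univ B)]
    · refine Finset.sum_congr rfl fun v _ => ?_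
      rw [← SimpleGraph.card_neighborFinset_eq_degree]
      congr 1
      ext w
      rw [SimpleGraph.mem_neighborFinset, Finset.mem_filter]
      exact ⟨fun h => ⟨hB' v w h, h⟩, fun h => h.2⟩
    · intro v _ hv
      rw [← SimpleGraph.card_neighborFinset_eq_degree, Finset.card_eq_zero]
      ext w
      rw [SimpleGraph.mem_neighborFinset]
      exact ⟨fun h => absurd (hB' w v h.symm) hv, by simp⟩
  have hedges : G.edgeFinset.card ≤
      (G.deleteEdges (F : Set (Sym2 W))).edgeFinset.card + F.card := by
    refine (Finset.card_le_card fun e he => ?_).trans (Finset.card_union_le _ _)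
    rw [SimpleGraph.mem_edgeFinset] at he
    rw [Finset.mem_union, SimpleGraph.mem_edgeFinset, SimpleGraph.edgeSet_deleteEdges]
    by_cases heF : e ∈ F
    · exact Or.inr heF
    · exact Or.inl ⟨he, heF⟩
  have h1 := G.sum_degrees_eq_twice_card_edges
  have h2 := (G.deleteEdges (F : Set (Sym2 W))).sum_degrees_eq_twice_card_edges
  omega

/-- Twice the number of edges of a reduced graph exceeds twice the number of its nonisolated
vertices by at most `2 * q`. This bounds the vertices of degree at least three and the sum of their
degrees, hence the vertices of degree two next to them; every triangle component contains an edge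
of the feedback edge set. -/
theorem Reduced.card_le [Fintype W] {G : SimpleGraph W} (h : Reduced G) {F : Finset (Sym2 W)}
    {q : ℕ} (hF : IsFeedbackEdgeSet G F) (hq : F.card ≤ q) [DecidablePred fun v => ∃ w, G.Adj v w] :
    (Finset.univ.filter fun v => ∃ w, G.Adj v w).card ≤ 14 * q ∧ G.edgeSet.ncard ≤ 15 * q := by
  classical
  set B := Finset.univ.filter fun v => ∃ w, G.Adj v w with hBdef
  set B3 := Finset.univ.filter fun v => Branch G v with hB3
  set B2 := B3.biUnion fun v => G.neighborFinset v with hB2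
  set T := F.biUnion fun e => e.toFinset.biUnion fun a =>
    if G.degree a = 2 then insert a (G.neighborFinset a) else ∅ with hT
  have hdeg3 : ∀ v, Branch G v → 3 ≤ G.degree v := by
    rintro v ⟨a, b, c, hab, hac, hbc, ha, hb, hc⟩
    rw [← SimpleGraph.card_neighborFinset_eq_degree,
      ← Finset.card_eq_three.2 ⟨a, b, c, hab, hac, hbc, rfl⟩]
    refine Finset.card_le_card fun x hx => ?_
    simp only [Finset.mem_insert, Finset.mem_singleton] at hx
    rw [SimpleGraph.mem_neighborFinset]
    rcases hx with rfl | rfl | rfl <;> assumption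
  have hdeg2 : ∀ v x z, Link G v x z → G.neighborFinset v = {x, z} ∧ G.degree v = 2 := by
    intro v x z hl
    have : G.neighborFinset v = {x, z} := by
      ext w
      simp [hl.2]
    exact ⟨this, by rw [← SimpleGraph.card_neighborFinset_eq_degree, this,
      Finset.card_pair hl.1]⟩
  -- a triangle component contains an edge of `F`
  have htri : ∀ v x z, Link G v x z → Link G x v z → Link G z v x → v ∈ T := by
    intro v x z hv hx hz
    have hvx := (hv.2 x).2 (Or.inl rfl)
    have hvz := (hv.2 z).2 (Or.inr rfl)
    have hxz := (hx.2 z).2 (Or.inr rfl)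
    have key : ∀ a b, s(a, b) ∈ F → G.degree a = 2 → (v = a ∨ G.Adj a v) → v ∈ T := by
      intro a b hab hda hva
      simp only [hT, Finset.mem_biUnion]
      refine ⟨_, hab, a, by simp, ?_⟩
      rw [if_pos hda]
      simpa using hva
    obtain ⟨a, ha, h1⟩ := isAcyclic_iff_acyc.1 hF.2 {v, x, z} _ subset_rfl ⟨v, by simp⟩
    have key2 : ∀ a b c, b ≠ c → G.Adj a b → G.Adj a c → b ∈ ({v, x, z} : Finset W) →
        c ∈ ({v, x, z} : Finset W) → (∀ b ∈ ({v, x, z} : Finset W),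
        ∀ c ∈ ({v, x, z} : Finset W), (G.deleteEdges (F : Set (Sym2 W))).Adj a b →
        (G.deleteEdges (F : Set (Sym2 W))).Adj a c → b = c) → s(a, b) ∈ F ∨ s(a, c) ∈ F := by
      intro a b c hbc hab hac hb hc h1
      by_contra hcon
      push Not at hcon
      refine hbc (h1 b hb c hc ?_ ?_) <;> rw [SimpleGraph.deleteEdges_adj]
      · exact ⟨hab, hcon.1⟩
      · exact ⟨hac, hcon.2⟩
    simp only [Finset.mem_insert, Finset.mem_singleton] at ha
    rcases ha with rfl | rfl | rfl
    · rcases key2 _ _ _ hv.1 hvx hvz (by simp) (by simp) h1 with h' | h' <;>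
        exact key _ _ h' (hdeg2 _ _ _ hv).2 (Or.inl rfl)
    · rcases key2 _ _ _ hx.1 hvx.symm hxz (by simp) (by simp) h1 with h' | h' <;>
        exact key _ _ h' (hdeg2 _ _ _ hx).2 (Or.inr hvx.symm)
    · rcases key2 _ _ _ hz.1 hvz.symm hxz.symm (by simp) (by simp) h1 with h' | h' <;>
        exact key _ _ h' (hdeg2 _ _ _ hz).2 (Or.inr hvz.symm)
  have hTcard : T.card ≤ 6 * q := by
    have h1 : T.card ≤ F.card * 6 := Finset.card_biUnion_le_card_mul _ _ _ fun e _ => by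
      have h2 : e.toFinset.card ≤ 2 := by
        rw [Sym2.card_toFinset]
        split_ifs <;> simp
      refine (Finset.card_biUnion_le_card_mul _ _ 3 fun a _ => ?_).trans
        (Nat.mul_le_mul_right 3 h2)
      split_ifs with hd
      · refine (Finset.card_insert_le _ _).trans ?_
        rw [SimpleGraph.card_neighborFinset_eq_degree, hd]
      · simp
    omega
  -- the vertices of degree two
  have hrest : ∀ v ∈ B \ B3, G.degree v = 2 := by
    intro v hv
    simp only [hBdef, hB3, Finset.mem_sdiff, Finset.mem_filter, Finset.mem_univ, true_and] at hv
    rcases h v with h' | h' | ⟨x, z, hl, -⟩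
    · obtain ⟨w, hw⟩ := hv.1
      exact absurd hw (h' w)
    · exact absurd h' hv.2
    · exact (hdeg2 _ _ _ hl).2
  have hB3B : B3 ⊆ B := by
    intro v hv
    simp only [hBdef, hB3, Finset.mem_filter, Finset.mem_univ, true_and] at hv ⊢
    obtain ⟨a, b, c, -, -, -, ha, -⟩ := hv
    exact ⟨a, ha⟩
  have hcover : B ⊆ B3 ∪ (B2 ∪ T) := by
    intro v hv
    simp only [hBdef, Finset.mem_filter, Finset.mem_univ, true_and] at hv
    simp only [Finset.mem_union]
    rcases h v with h' | h' | ⟨x, z, hl, h' | h' | h'⟩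
    · obtain ⟨w, hw⟩ := hv
      exact absurd hw (h' w)
    · exact Or.inl (by simpa [hB3] using h')
    · refine Or.inr (Or.inl (Finset.mem_biUnion.2 ⟨x, by simpa [hB3] using h', ?_⟩))
      rw [SimpleGraph.mem_neighborFinset]
      exact ((hl.2 x).2 (Or.inl rfl)).symm
    · refine Or.inr (Or.inl (Finset.mem_biUnion.2 ⟨z, by simpa [hB3] using h', ?_⟩))
      rw [SimpleGraph.mem_neighborFinset]
      exact ((hl.2 z).2 (Or.inr rfl)).symm
    · exact Or.inr (Or.inr (htri v x z hl h'.1 h'.2))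
  have hcard : B.card ≤ B3.card + (B2.card + T.card) :=
    (Finset.card_le_card hcover).trans ((Finset.card_union_le _ _).trans
      (Nat.add_le_add_left (Finset.card_union_le _ _) _))
  have hB2card : B2.card ≤ ∑ v ∈ B3, G.degree v := by
    refine Finset.card_biUnion_le.trans (le_of_eq (Finset.sum_congr rfl fun v _ => ?_))
    rw [SimpleGraph.card_neighborFinset_eq_degree]
  have hsum3 : B3.card * 3 ≤ ∑ v ∈ B3, G.degree v := by
    refine Finset.card_nsmul_le_sum B3 _ 3 fun v hv => hdeg3 v (by simpa [hB3] using hv)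
  have hsumB : ∑ v, G.degree v = ∑ v ∈ B3, G.degree v + 2 * (B.card - B3.card) := by
    rw [← Finset.card_sdiff_of_subset hB3B, ← Finset.sum_subset (Finset.subset_univ B),
      ← Finset.sum_sdiff hB3B, Finset.sum_congr rfl hrest, Finset.sum_const, smul_eq_mul]
    · ring
    · intro v _ hv
      simp only [hBdef, Finset.mem_filter, Finset.mem_univ, true_and, not_exists] at hv
      rw [← SimpleGraph.card_neighborFinset_eq_degree, Finset.card_eq_zero]
      ext w
      simpa using hv w
  have hforest := hF.sum_degree_le (B := B) fun v w hvw =>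
    Finset.mem_filter.2 ⟨Finset.mem_univ w, v, hvw.symm⟩
  have h1 := G.sum_degrees_eq_twice_card_edges
  have h3 : G.edgeSet.ncard = G.edgeFinset.card := by
    rw [← SimpleGraph.coe_edgeFinset, Set.ncard_coe_finset]
  have h4 := Finset.card_le_card hB3B
  constructor <;> omega

end Counting

/-! ### Halting within a time bound -/

/-- Started in `s`, the program `p` halts within `T` steps in a memory that satisfies `Q`. -/
def Halts (p : Prog) (s : Mem) (T : ℕ) (Q : Mem → Prop) : Prop :=
  ∃ t s', Exec p s t s' ∧ t ≤ T ∧ Q s'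

theorem Halts.seq {p q : Prog} {s : Mem} {T U : ℕ} {Q R : Mem → Prop} (hp : Halts p s T Q)
    (hq : ∀ s', Q s' → Halts q s' U R) : Halts (Prog.seq p q) s (T + U + 1) R := by
  obtain ⟨t, s', h1, h2, h3⟩ := hp
  obtain ⟨u, s'', h4, h5, h6⟩ := hq s' h3
  exact ⟨_, s'', Exec.seq h1 h4, by omega, h6⟩

theorem Halts.mono {p : Prog} {s : Mem} {T : ℕ} {Q R : Mem → Prop} (hp : Halts p s T Q)
    (hQ : ∀ s', Q s' → R s') : Halts p s T R := by
  obtain ⟨t, s', h1, h2, h3⟩ := hp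
  exact ⟨t, s', h1, h2, hQ s' h3⟩

theorem Halts.run {p : Prog} {s : Mem} {Q : Mem → Prop} (hp : p.LoopFree) (hQ : Q (p.run s)) :
    Halts p s p.bound Q := by
  obtain ⟨t, h1, h2⟩ := Prog.exec_run hp s
  exact ⟨t, _, h1, h2, hQ⟩

/-- An upper bound on the number of steps of one round of a loop. -/
def Prog.roundCost : Prog → ℕ
  | loop b p => b.cost + p.bound + 1
  | _ => 0

theorem Halts.loop {b : Test} {p : Prog} (hp : p.LoopFree) (I : Mem → Prop) (r : Mem → ℕ)
    (step : ∀ s, I s → b.Holds s → I (p.run s) ∧ r (p.run s) < r s) {s : Mem} (hs : I s) {m : ℕ}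
    (hr : r s ≤ m) :
    Halts (Prog.loop b p) s ((Prog.loop b p).roundCost * (m + 1)) fun s' => I s' ∧ ¬ b.Holds s' := by
  obtain ⟨t, s', h1, h2, h3, h4⟩ := exec_loop hp I r step s hs
  exact ⟨t, s', h1, h4.trans (Nat.mul_le_mul_left _ (by omega)), h2, h3⟩

/-! ### Lists stored in array segments -/

theorem bijOn_update_of_notMem {f : ℕ → ℕ} {A S : Set ℕ} {k x : ℕ} (hk : k ∉ A)
    (h : Set.BijOn f A S) : Set.BijOn (Function.update f k x) A S :=
  h.congr fun j hj => (Function.update_of_ne (fun e : j = k => hk (e ▸ hj)) _ _).symm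

theorem bijOn_push {f : ℕ → ℕ} {S : Set ℕ} {a k x : ℕ} (hak : a ≤ k) (hx : x ∉ S)
    (h : Set.BijOn f (Set.Ico a k) S) :
    Set.BijOn (Function.update f k x) (Set.Ico a (k + 1)) (insert x S) := by
  have h1 : Set.Ico a (k + 1) = insert k (Set.Ico a k) := by
    ext j
    simp only [Set.mem_Ico, Set.mem_insert_iff]
    omega
  have h2 := bijOn_update_of_notMem (x := x) (k := k) (by simp) h
  rw [h1]
  have h3 := h2.insert (a := k) (by simpa using hx)
  simpa using h3

theorem bijOn_pair {f : ℕ → ℕ} {S : Set ℕ} {a : ℕ} :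
    Set.BijOn f (Set.Ico a (a + 2)) S ↔ f a ≠ f (a + 1) ∧ S = {f a, f (a + 1)} := by
  have h1 : Set.Ico a (a + 2) = {a, a + 1} := by
    ext j
    simp only [Set.mem_Ico, Set.mem_insert_iff, Set.mem_singleton_iff]
    omega
  rw [h1]
  constructor
  · intro h
    refine ⟨fun e => ?_, by rw [← h.image_eq, Set.image_pair]⟩
    have := h.injOn (by simp) (by simp) e
    omega
  · rintro ⟨h2, rfl⟩
    rw [← Set.image_pair]
    refine Set.InjOn.bijOn_image ?_
    rintro b (rfl | rfl) c (rfl | rfl) e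
    · rfl
    · exact absurd e h2
    · exact absurd e.symm h2
    · rfl

theorem ncard_of_bijOn_Ico {f : ℕ → ℕ} {S : Set ℕ} {a b : ℕ} (h : Set.BijOn f (Set.Ico a b) S) :
    S.ncard = b - a := by
  rw [← h.image_eq, h.injOn.ncard_image, ← Finset.coe_Ico, Set.ncard_coe_finset,
    Nat.card_Ico]

/-- In the list with two entries that starts at position `a`, replace the entry `y` by `z`. -/
def replaceIn (f : ℕ → ℕ) (a y z : ℕ) : ℕ → ℕ :=
  if f a = y then Function.update f a z else Function.update f (a + 1) z

theorem replaceIn_of_notMem {f : ℕ → ℕ} {a y z j : ℕ} (hj : j < a ∨ a + 2 ≤ j) :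
    replaceIn f a y z j = f j := by
  unfold replaceIn
  split_ifs
  · exact Function.update_of_ne (by omega) _ _
  · exact Function.update_of_ne (by omega) _ _

theorem bijOn_replaceIn {f : ℕ → ℕ} {S : Set ℕ} {a y z : ℕ}
    (h : Set.BijOn f (Set.Ico a (a + 2)) S) (hy : y ∈ S) (hz : z ∉ S) :
    Set.BijOn (replaceIn f a y z) (Set.Ico a (a + 2)) (insert z (S \ {y})) := by
  rw [bijOn_pair] at h ⊢
  obtain ⟨hne, rfl⟩ := h
  simp only [Set.mem_insert_iff, Set.mem_singleton_iff, not_or] at hy hz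
  unfold replaceIn
  split_ifs with h
  · subst h
    refine ⟨by simpa using hz.2, ?_⟩
    ext w
    simp
    grind
  · have hy' : y = f (a + 1) := hy.resolve_left fun e => h e.symm
    subst hy'
    refine ⟨by simpa using fun e => hz.1 e.symm, ?_⟩
    ext w
    simp
    grind

/-! ### The program -/

section Program

open InTree.Expr InTree.Test InTree.Prog

/-- Count the length of each list in array `7`, and set register `5` if there is a terminal. -/
def degreeLoop : Prog :=
  loop (lt (reg 2) (reg 0))
    (ite (lt (reg 4) (read 0 (succ (reg 2))))
      (seq (write 7 (reg 2) (succ (read 7 (reg 2)))) (assign 4 (succ (reg 4))))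
      (seq (ite (Test.eq (read 2 (reg 2)) (const 1)) (assign 5 (const 1)) skip)
        (assign 2 (succ (reg 2)))))

/-- Without terminals, vertex `0` becomes a terminal. -/
def ensureTerminal : Prog :=
  ite (Test.eq (reg 5) (const 0)) (write 2 (const 0) (const 1)) skip

/-- Start a pass over the lists. -/
def startPass : Prog :=
  seq (assign 2 (const 0)) (seq (assign 3 (const 0)) (assign 4 (const 0)))

/-- Delete leaves. Register `2` runs through all vertices. From each of them a chain of leaves is
followed: register `3` is its current vertex, and register `4` is the position in the list of that
vertex up to which its neighbours have been found to be deleted. A vertex counts as deleted if its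
degree in array `7` is `0`. -/
def pruneLoop : Prog :=
  loop (lt (reg 2) (reg 0))
    (ite (Test.eq (read 7 (reg 3)) (const 1))
      (ite (Test.eq (read 7 (read 1 (reg 4))) (const 0))
        (assign 4 (succ (reg 4)))
        (seq (assign 7 (read 1 (reg 4)))
          (seq (write 7 (reg 3) (const 0))
            (seq (write 7 (reg 7) (pred (read 7 (reg 7))))
              (seq (ite (Test.eq (read 2 (reg 3)) (const 1))
                  (seq (write 2 (reg 7) (const 1)) (write 2 (reg 3) (const 0)))
                  skip)
                (seq (assign 3 (reg 7)) (assign 4 (read 0 (reg 7)))))))))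
      (seq (assign 2 (succ (reg 2)))
        (seq (assign 3 (reg 2)) (assign 4 (read 0 (reg 2))))))

/-- Copy the lists to array `6`, each to the same starting position, without deleted vertices. -/
def compactLoop : Prog :=
  loop (lt (reg 2) (reg 0))
    (ite (lt (reg 4) (read 0 (succ (reg 2))))
      (seq
        (ite (conj (lt (const 0) (read 7 (reg 2))) (lt (const 0) (read 7 (read 1 (reg 4)))))
          (seq (write 6 (reg 3) (read 1 (reg 4))) (assign 3 (succ (reg 3))))
          skip)
        (assign 4 (succ (reg 4))))
      (seq (assign 2 (succ (reg 2))) (assign 3 (read 0 (reg 2)))))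

/-- Replace the entry `reg 2` by `reg w` in the list with two entries of the vertex `reg v`. -/
def replaceProg (v w : ℕ) : Prog :=
  ite (Test.eq (read 6 (read 0 (reg v))) (reg 2))
    (write 6 (read 0 (reg v)) (reg w))
    (write 6 (succ (read 0 (reg v))) (reg w))

/-- Bypass the vertex in register `2`, whose neighbours are in the registers `7` and `8`. -/
def bypassStep : Prog :=
  seq (write 7 (reg 2) (const 0))
    (seq (ite (Test.eq (read 2 (reg 7)) (read 2 (reg 8))) (write 2 (reg 7) (read 2 (reg 2))) skip)
      (seq (write 2 (reg 2) (const 0)) (seq (replaceProg 7 8) (replaceProg 8 7))))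

/-- The vertices in the registers `2`, `7` and `8` have degree two, and that in register `8` is not
in the list of that in register `7`. -/
def bypassTest : Test :=
  conj (conj (Test.eq (read 7 (reg 2)) (const 2))
      (conj (Test.eq (read 7 (reg 7)) (const 2)) (Test.eq (read 7 (reg 8)) (const 2))))
    (conj (neg (Test.eq (read 6 (read 0 (reg 7))) (reg 8)))
      (neg (Test.eq (read 6 (succ (read 0 (reg 7)))) (reg 8))))

/-- Bypass vertices of degree two whose neighbours are nonadjacent vertices of degree two. -/
def bypassLoop : Prog :=
  loop (lt (reg 2) (reg 0))
    (seq
      (seq (assign 7 (read 6 (read 0 (reg 2)))) (assign 8 (read 6 (succ (read 0 (reg 2))))))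
      (seq (ite bypassTest bypassStep skip) (assign 2 (succ (reg 2)))))

/-- Number the vertices that are kept: all vertices of positive degree, and the first two isolated
terminals. Array `9` holds the successor of the number, or `0` for a vertex that is dropped. -/
def numberLoop : Prog :=
  loop (lt (reg 2) (reg 0))
    (seq
      (ite (lt (const 0) (read 7 (reg 2)))
        (seq (write 5 (reg 1) (read 2 (reg 2)))
          (seq (assign 1 (succ (reg 1))) (write 9 (reg 2) (reg 1))))
        (ite (conj (Test.eq (read 2 (reg 2)) (const 1)) (lt (const 0) (reg 6)))
          (seq (assign 6 (pred (reg 6)))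
            (seq (write 5 (reg 1) (read 2 (reg 2)))
              (seq (assign 1 (succ (reg 1))) (write 9 (reg 2) (reg 1)))))
          skip))
      (assign 2 (succ (reg 2))))

/-- Write the lists of the kept vertices. Register `3` is the position in the output, and register
`6` the number of entries of the current list that are still to be copied. -/
def outputLoop : Prog :=
  loop (lt (reg 2) (reg 0))
    (ite (lt (const 0) (reg 6))
      (seq (write 4 (reg 3) (pred (read 9 (read 6 (reg 4)))))
        (seq (assign 3 (succ (reg 3)))
          (seq (assign 4 (succ (reg 4))) (assign 6 (pred (reg 6))))))
      (seq (ite (lt (const 0) (read 9 (reg 2))) (write 3 (read 9 (reg 2)) (reg 3)) skip)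
        (seq (assign 2 (succ (reg 2)))
          (seq (assign 4 (read 0 (reg 2))) (assign 6 (read 7 (reg 2)))))))

/-- The kernelization. -/
def kernelize : Prog :=
  seq (seq degreeLoop ensureTerminal)
    (seq (seq startPass pruneLoop)
      (seq (seq startPass compactLoop)
        (seq (seq startPass bypassLoop)
          (seq (seq (seq startPass (assign 6 (const 2))) numberLoop)
            (seq (seq startPass (assign 6 (read 7 (const 0)))) outputLoop)))))

end Program

/-! ### Stored graphs and terminals -/

/-- The adjacency lists of the graph `G` on `0, …, n - 1`: the list of `v` occupies the cells
`off v, …, off v + len v - 1` of `adj`, in the block between `off v` and `off (v + 1)`. -/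
structure Lists (n : ℕ) (off len adj : ℕ → ℕ) (G : SimpleGraph ℕ) : Prop where
  zero : off 0 = 0
  le : ∀ v < n, off v + len v ≤ off (v + 1)
  bij : ∀ v < n, Set.BijOn adj (Set.Ico (off v) (off v + len v)) (G.neighborSet v)
  lt : ∀ a b, G.Adj a b → a < n

/-- The set with characteristic vector `k`. -/
def terminals (n : ℕ) (k : ℕ → ℕ) : Finset ℕ :=
  (Finset.range n).filter fun v => k v = 1

/-- The graph `H` with the terminals described by `k` is an instance with the answer `Y`, and its
feedback edge number is at most that of `G`. -/
structure Instance (n : ℕ) (G : SimpleGraph ℕ) (Y : Prop) (H : SimpleGraph ℕ) (k : ℕ → ℕ) :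
    Prop where
  le_one : ∀ v < n, k v ≤ 1
  nonempty : 0 < n → (terminals n k).Nonempty
  yes : 0 < n → (Yes H (terminals n k) ↔ Y)
  fes : ∀ q, Fes G q → Fes H q

variable {n : ℕ} {off len adj k deg : ℕ → ℕ} {G H : SimpleGraph ℕ} {Y : Prop}

theorem mem_terminals {v : ℕ} : v ∈ terminals n k ↔ v < n ∧ k v = 1 := by
  simp [terminals]

theorem Lists.mono (h : Lists n off len adj G) {v w : ℕ} (hvw : v ≤ w) (hw : w ≤ n) :
    off v ≤ off w := by
  induction w, hvw using Nat.le_induction with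
  | base => rfl
  | succ w hvw ih => have := ih (by omega); have := h.le w (by omega); omega

theorem Lists.ncard (h : Lists n off len adj G) {v : ℕ} (hv : v < n) :
    (G.neighborSet v).ncard = len v := by
  rw [ncard_of_bijOn_Ico (h.bij v hv)]
  omega

theorem Lists.adj_iff (h : Lists n off len adj G) {v w : ℕ} (hv : v < n) :
    G.Adj v w ↔ ∃ j, off v ≤ j ∧ j < off v + len v ∧ adj j = w := by
  rw [← SimpleGraph.mem_neighborSet, ← (h.bij v hv).image_eq]
  simp [and_assoc]

theorem Lists.adj_of (h : Lists n off len adj G) {v j : ℕ} (hv : v < n) (h1 : off v ≤ j)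
    (h2 : j < off v + len v) : G.Adj v (adj j) :=
  (h.adj_iff hv).2 ⟨j, h1, h2, rfl⟩

theorem Lists.finite (h : Lists n off len adj G) (v : ℕ) : (G.neighborSet v).Finite :=
  (Set.finite_Iio n).subset fun w hw => h.lt w v (SimpleGraph.Adj.symm hw)

/-- The part of the memory that all passes before the last two leave alone. -/
structure Frame (n : ℕ) (off : ℕ → ℕ) (s : Mem) : Prop where
  size : s.reg 0 = n
  outSize : s.reg 1 = 0
  offsets : s.arr 0 = off
  outOffsets : s.arr 3 = 0
  numbers : s.arr 9 = 0

/-! ### Counting degrees -/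

/-- The state while the degrees are counted: the vertices before `v` are done, position `i` of the
list of `v` is next, and `f` is nonzero once a terminal has been seen. -/
structure DegreeInv (n : ℕ) (off k : ℕ → ℕ) (v i f : ℕ) (deg : ℕ → ℕ) : Prop where
  le : v ≤ n
  pos : off v ≤ i
  pos_le : v < n → i ≤ off (v + 1)
  pos_end : i ≤ off n
  done : ∀ w < v, off w + deg w = off (w + 1)
  current : off v + deg v = i
  rest : ∀ w, v < w → deg w = 0
  flag : f = 0 ↔ ∀ w < v, k w ≠ 1

theorem DegreeInv.step_count {v i f : ℕ} (h : DegreeInv n off k v i f deg)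
    (hi : i < off (v + 1)) (hend : off (v + 1) ≤ off n) :
    DegreeInv n off k v (i + 1) f (Function.update deg v (deg v + 1)) where
  le := h.le
  pos := by have := h.pos; omega
  pos_le := fun _ => hi
  pos_end := by omega
  done := fun w hw => by rw [Function.update_of_ne (by omega)]; exact h.done w hw
  current := by rw [Function.update_self]; have := h.current; omega
  rest := fun w hw => by rw [Function.update_of_ne (by omega)]; exact h.rest w hw
  flag := h.flag

theorem DegreeInv.step_next {v i f : ℕ} (h : DegreeInv n off k v i f deg) (hv : v < n)
    (hi : ¬ i < off (v + 1)) (hend : v + 1 < n → off (v + 1) ≤ off (v + 1 + 1)) :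
    DegreeInv n off k (v + 1) i (if k v = 1 then 1 else f) deg where
  le := hv
  pos := by omega
  pos_le := fun h' => by have := h.pos_le hv; have := hend h'; omega
  pos_end := h.pos_end
  done := fun w hw => by
    rcases Nat.lt_succ_iff_lt_or_eq.1 hw with hw | rfl
    · exact h.done w hw
    · have := h.current; have := h.pos_le hv; omega
  current := by rw [h.rest _ (Nat.lt_succ_self v)]; have := h.pos_le hv; omega
  rest := fun w hw => h.rest w (by omega)
  flag := by
    have hf := h.flag
    split_ifs with hk
    · simp only [false_iff, not_forall]
      exact ⟨v, Nat.lt_succ_self v, by simpa using hk⟩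
    · rw [hf]
      refine ⟨fun h' w hw => ?_, fun h' w hw => h' w (by omega)⟩
      rcases Nat.lt_succ_iff_lt_or_eq.1 hw with hw | rfl
      · exact h' w hw
      · exact hk

theorem halts_degree (hG : Lists n off len adj G) {s : Mem} (hs : Frame n off s)
    (h1 : s.arr 1 = adj) (h2 : s.reg 2 = 0) (h4 : s.reg 4 = 0) (h5 : s.reg 5 = 0)
    (h7 : s.arr 7 = 0) :
    Halts degreeLoop s (degreeLoop.roundCost * (n + off n + 1)) fun s' =>
      Frame n off s' ∧ s'.arr 1 = adj ∧ s'.arr 2 = s.arr 2 ∧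
      (∀ v < n, off v + s'.arr 7 v = off (v + 1)) ∧
      (s'.reg 5 = 0 ↔ ∀ w < n, s.arr 2 w ≠ 1) := by
  refine (Halts.loop (by simp [Prog.LoopFree]) (fun s' => Frame n off s' ∧ s'.arr 1 = adj ∧
      s'.arr 2 = s.arr 2 ∧
      DegreeInv n off (s.arr 2) (s'.reg 2) (s'.reg 4) (s'.reg 5) (s'.arr 7))
      (fun s' => (n - s'.reg 2) + (off n - s'.reg 4)) ?_ ?_ ?_).mono ?_
  · rintro s' ⟨hF, ha1, ha2, hI⟩ hb
    simp only [Test.Holds, Expr.eval, hF.size] at hb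
    have hend := hG.mono (v := s'.reg 2 + 1) (w := n) hb le_rfl
    have hpos := hI.pos
    by_cases hi : s'.reg 4 < off (s'.reg 2 + 1)
    · simp only [Prog.run, Test.Holds, Expr.eval, hF.offsets, hi, if_true]
      refine ⟨⟨⟨?_, ?_, ?_, ?_, ?_⟩, ?_, ?_, ?_⟩, ?_⟩
      all_goals simp [hF.size, hF.outSize, hF.offsets, hF.outOffsets, hF.numbers, ha1, ha2]
      · exact hI.step_count hi hend
      · omega
    · have hnext := hI.step_next hb hi fun h => hG.mono (by omega) h
      simp only [Prog.run, Test.Holds, Expr.eval, hF.offsets, hi, if_false, ha2]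
      split_ifs with hk
      · rw [if_pos hk] at hnext
        refine ⟨⟨⟨?_, ?_, ?_, ?_, ?_⟩, ?_, ?_, ?_⟩, ?_⟩
        all_goals simp [hF.size, hF.outSize, hF.offsets, hF.outOffsets, hF.numbers, ha1, ha2]
        · exact hnext
        · omega
      · rw [if_neg hk] at hnext
        refine ⟨⟨⟨?_, ?_, ?_, ?_, ?_⟩, ?_, ?_, ?_⟩, ?_⟩
        all_goals simp [hF.size, hF.outSize, hF.offsets, hF.outOffsets, hF.numbers, ha1, ha2]
        · exact hnext
        · omega
  · refine ⟨hs, h1, rfl, ?_⟩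
    rw [h2, h4, h5, h7]
    exact ⟨by simp, by simp [hG.zero], by simp, by simp, by simp, by simp [hG.zero], by simp,
      by simp⟩
  · simp [h2, h4]
  · rintro s' ⟨⟨hF, ha1, ha2, hI⟩, hb⟩
    simp only [Test.Holds, Expr.eval, hF.size] at hb
    have hv : s'.reg 2 = n := le_antisymm hI.le (by omega)
    refine ⟨hF, ha1, ha2, fun v hv' => hI.done v (by omega), ?_⟩
    rw [hI.flag, hv]

/-- Making a vertex of a graph without terminals a terminal gives another positive instance. -/
theorem halts_prepare (hG : Lists n off len adj G) (hlen : ∀ v < n, off v + len v = off (v + 1))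
    {s : Mem} (hs : Frame n off s) (h1 : s.arr 1 = adj) (h2 : s.reg 2 = 0) (h4 : s.reg 4 = 0)
    (h5 : s.reg 5 = 0) (h7 : s.arr 7 = 0) (hk : ∀ v < n, s.arr 2 v ≤ 1)
    (hY : (terminals n (s.arr 2)).Nonempty → (Yes G (terminals n (s.arr 2)) ↔ Y))
    (hY' : 0 < n → terminals n (s.arr 2) = ∅ → Y) :
    Halts (Prog.seq degreeLoop ensureTerminal) s
      (degreeLoop.roundCost * (n + off n + 1) + ensureTerminal.bound + 1) fun s' =>
        Frame n off s' ∧ s'.arr 1 = adj ∧ (∀ v < n, s'.arr 7 v = len v) ∧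
        Instance n G Y G (s'.arr 2) := by
  refine (halts_degree hG hs h1 h2 h4 h5 h7).seq fun s' ⟨hF, ha1, ha2, hd, hf⟩ =>
    Halts.run (by simp [Prog.LoopFree, ensureTerminal]) ?_
  have hdeg : ∀ v < n, s'.arr 7 v = len v := fun v hv => by
    have := hd v hv; have := hlen v hv; omega
  by_cases h : s'.reg 5 = 0
  · have hT : terminals n (s.arr 2) = ∅ := by
      rw [Finset.eq_empty_iff_forall_notMem]
      intro v hv
      rw [mem_terminals] at hv
      exact hf.1 h v hv.1 hv.2
    simp only [ensureTerminal, Prog.run, Test.Holds, Expr.eval, h, if_true]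
    refine ⟨⟨?_, ?_, ?_, ?_, ?_⟩, ?_, ?_, ?_⟩
    all_goals simp [hF.size, hF.outSize, hF.offsets, hF.outOffsets, hF.numbers, ha1, ha2]
    · exact hdeg
    · have hT' : 0 < n → terminals n (Function.update (s.arr 2) 0 1) = {0} := by
        intro hn
        ext v
        rw [mem_terminals, Finset.mem_singleton]
        by_cases hv : v = 0
        · simp [hv, hn]
        · rw [Function.update_of_ne hv, ← mem_terminals, hT]
          simp [hv]
      refine ⟨fun v hv => ?_, fun hn => by simp [hT' hn], fun hn => ?_, fun q => id⟩
      · rw [Function.update_apply]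
        split_ifs
        · exact le_rfl
        · exact hk v hv
      · rw [hT' hn]
        exact iff_of_true ⟨{0}, subset_rfl, conn_singleton 0, acyc_singleton 0⟩ (hY' hn hT)
  · have hT : (terminals n (s.arr 2)).Nonempty := by
      rw [hf] at h
      push Not at h
      obtain ⟨v, hv, hv'⟩ := h
      exact ⟨v, mem_terminals.2 ⟨hv, hv'⟩⟩
    simp only [ensureTerminal, Prog.run, Test.Holds, Expr.eval, h, if_false]
    rw [ha2]
    exact ⟨hF, ha1, hdeg, hk, fun _ => hT, fun _ => hY hT, fun q => id⟩

/-! ### Deleting leaves -/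

/-- The graph that remains of `G` when the vertices with `deg v = 0` are deleted. -/
def remaining (G : SimpleGraph ℕ) (deg : ℕ → ℕ) : SimpleGraph ℕ where
  Adj a b := G.Adj a b ∧ deg a ≠ 0 ∧ deg b ≠ 0
  symm := ⟨fun _ _ h => ⟨h.1.symm, h.2.2, h.2.1⟩⟩
  loopless := ⟨fun _ h => h.1.ne rfl⟩

theorem remaining_adj {a b : ℕ} :
    (remaining G deg).Adj a b ↔ G.Adj a b ∧ deg a ≠ 0 ∧ deg b ≠ 0 := Iff.rfl

/-- The state while leaves are deleted: all vertices up to `v` have been visited, and `u` is the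
current vertex of the chain of leaves that was entered at `v`. In the list of `u`, the neighbours
before position `i` are deleted. Only `u` can be a leaf among the visited vertices. -/
structure PruneInv (n : ℕ) (off adj : ℕ → ℕ) (G : SimpleGraph ℕ) (Y : Prop) (v u i : ℕ)
    (deg k : ℕ → ℕ) : Prop where
  le : v ≤ n
  current : v < n → u < n
  last : v = n → u = n
  degree : ∀ a < n, ((remaining G deg).neighborSet a).ncard = deg a
  inst : Instance n G Y (remaining G deg) k
  no_leaf : ∀ x ≤ v, x < n → x ≠ u → deg x ≠ 1
  pos : off u ≤ i
  seen : ∀ j, off u ≤ j → j < i → deg (adj j) = 0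
  start : deg u ≠ 1 → i = off u

/-- An upper bound on the number of rounds that scanning the lists of the remaining vertices and
deleting them can take. -/
def potential (n : ℕ) (len deg : ℕ → ℕ) : ℕ :=
  ∑ x ∈ Finset.range n, if deg x = 0 then 0 else len x + 1

theorem potential_le_of_le {deg' : ℕ → ℕ} {u : ℕ} (hu : u < n) (h0 : deg u ≠ 0) (h0' : deg' u = 0)
    (h : ∀ x, deg x = 0 → deg' x = 0) :
    potential n len deg' + (len u + 1) ≤ potential n len deg := by
  have hu' := Finset.mem_range.2 hu
  unfold potential
  rw [← Finset.add_sum_erase _ _ hu', ← Finset.add_sum_erase (Finset.range n)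
    (fun x => if deg x = 0 then 0 else len x + 1) hu', if_pos h0', if_neg h0]
  have : ∑ x ∈ (Finset.range n).erase u, (if deg' x = 0 then 0 else len x + 1) ≤
      ∑ x ∈ (Finset.range n).erase u, (if deg x = 0 then 0 else len x + 1) := by
    refine Finset.sum_le_sum fun x _ => ?_
    by_cases hx : deg x = 0
    · rw [if_pos hx, if_pos (h x hx)]
    · rw [if_neg hx]
      split_ifs <;> omega
  omega

theorem potential_le (hG : Lists n off len adj G) : potential n len deg ≤ n + off n := by
  have : ∀ m ≤ n, potential m len deg ≤ m + off m := by
    intro m hm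
    induction m with
    | zero => simp [potential]
    | succ m ih =>
      have := ih (by omega)
      have := hG.le m (by omega)
      unfold potential at *
      rw [Finset.sum_range_succ]
      split_ifs <;> omega
  exact this n le_rfl

namespace PruneInv

variable {v u i : ℕ}

theorem finite (hG : Lists n off len adj G) (a : ℕ) : ((remaining G deg).neighborSet a).Finite :=
  (hG.finite a).subset fun _ h => h.1

/-- A leaf has not been scanned completely without finding its neighbour. -/
theorem lt_of_leaf (hG : Lists n off len adj G)
    (h : PruneInv n off adj G Y v u i deg k) (hv : v < n) (hu : deg u = 1) :
    i < off u + len u := by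
  have hun := h.current hv
  have h1 := h.degree u hun
  rw [hu, Set.ncard_eq_one] at h1
  obtain ⟨w, hw⟩ := h1
  have huw : (remaining G deg).Adj u w := by
    rw [← SimpleGraph.mem_neighborSet, hw]
    rfl
  obtain ⟨j, hj1, hj2, rfl⟩ := (hG.adj_iff hun).1 huw.1
  by_contra hi
  exact huw.2.2 (h.seen j hj1 (by omega))

theorem step_scan (h : PruneInv n off adj G Y v u i deg k) (hu : deg u = 1)
    (hi : deg (adj i) = 0) : PruneInv n off adj G Y v u (i + 1) deg k where
  le := h.le
  current := h.current
  last := h.last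
  degree := h.degree
  inst := h.inst
  no_leaf := h.no_leaf
  pos := by have := h.pos; omega
  seen := fun j h1 h2 => by
    rcases Nat.lt_succ_iff_lt_or_eq.1 h2 with h2 | rfl
    · exact h.seen j h1 h2
    · exact hi
  start := fun h' => absurd hu h'

theorem step_next (h : PruneInv n off adj G Y v u i deg k)
    (hv : v < n) (hu : deg u ≠ 1) :
    PruneInv n off adj G Y (v + 1) (v + 1) (off (v + 1)) deg k where
  le := hv
  current := id
  last := id
  degree := h.degree
  inst := h.inst
  no_leaf := fun x hx hxn hne => by
    by_cases hxu : x = u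
    · rwa [hxu]
    · exact h.no_leaf x (by omega) hxn hxu
  pos := le_rfl
  seen := fun j h1 h2 => by omega
  start := fun _ => rfl

/-- The leaf `u` is deleted, and its neighbour `adj i` becomes the current vertex. If it is now
isolated itself, it counts as deleted, which does not change the graph. -/
theorem step_prune (hG : Lists n off len adj G)
    (h : PruneInv n off adj G Y v u i deg k) (hv : v < n) (hu : deg u = 1)
    (hi : deg (adj i) ≠ 0) :
    PruneInv n off adj G Y v (adj i) (off (adj i))
      (Function.update (Function.update deg u 0) (adj i)
        (Function.update deg u 0 (adj i) - 1))
      (if k u = 1 then Function.update (Function.update k (adj i) 1) u 0 else k) := by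
  have hun := h.current hv
  set w := adj i with hw
  have hGuw : G.Adj u w := hG.adj_of hun h.pos (h.lt_of_leaf hG hv hu)
  have hwn : w < n := hG.lt w u hGuw.symm
  have huw : (remaining G deg).Adj u w := ⟨hGuw, by omega, hi⟩
  have hwu : w ≠ u := hGuw.ne'
  set deg' := Function.update (Function.update deg u 0) w (Function.update deg u 0 w - 1) with hdeg'
  have hdu : deg' u = 0 := by rw [hdeg', Function.update_of_ne hwu.symm, Function.update_self]
  have hdw : deg' w = deg w - 1 := by rw [hdeg', Function.update_self, Function.update_of_ne hwu]
  have hda : ∀ a, a ≠ u → a ≠ w → deg' a = deg a := fun a h1 h2 => by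
    rw [hdeg', Function.update_of_ne h2, Function.update_of_ne h1]
  have hleaf : ∀ b, (remaining G deg).Adj u b ↔ b = w := by
    have h1 := h.degree u hun
    rw [hu, Set.ncard_eq_one] at h1
    obtain ⟨w', hw'⟩ := h1
    have h2 : w ∈ (remaining G deg).neighborSet u := huw
    rw [hw', Set.mem_singleton_iff] at h2
    intro b
    rw [← SimpleGraph.mem_neighborSet, hw', h2, Set.mem_singleton_iff]
  -- a second neighbour of `w` keeps its degree positive
  have hw2 : ∀ b, b ≠ u → (remaining G deg).Adj w b → 2 ≤ deg w := by
    intro b hb hwb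
    rw [← h.degree w hwn, ← Set.ncard_pair hb]
    refine Set.ncard_le_ncard ?_ (finite hG w)
    rintro c (rfl | rfl)
    · exact hwb
    · exact huw.symm
  have hpos : ∀ a b, a ≠ u → b ≠ u → (remaining G deg).Adj a b → deg' a ≠ 0 := by
    intro a b ha hb hab
    by_cases haw : a = w
    · have := hw2 b hb (haw ▸ hab)
      rw [haw, hdw]
      omega
    · rw [hda a ha haw]
      exact hab.2.1
  have hadj : remaining G deg' = isolate (remaining G deg) u := by
    ext a b
    rw [isolate_adj]
    constructor
    · rintro ⟨h1, h2, h3⟩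
      have key : ∀ a, deg' a ≠ 0 → a ≠ u ∧ deg a ≠ 0 := by
        intro a ha
        have hau : a ≠ u := fun e => ha (e ▸ hdu)
        refine ⟨hau, ?_⟩
        by_cases haw : a = w
        · rwa [haw]
        · rwa [hda a hau haw] at ha
      exact ⟨⟨h1, (key a h2).2, (key b h3).2⟩, (key a h2).1, (key b h3).1⟩
    · rintro ⟨h1, h2, h3⟩
      exact ⟨h1.1, hpos a b h2 h3 h1, hpos b a h3 h2 h1.symm⟩
  refine ⟨h.le, fun _ => hwn, fun e => absurd e hv.ne, fun a ha => ?_, ?_, fun x hx hxn hxw => ?_,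
    le_rfl, fun j h1 h2 => by omega, fun _ => rfl⟩
  · rw [hadj]
    by_cases hau : a = u
    · have h1 : (isolate (remaining G deg) u).neighborSet u = ∅ := by
        ext b
        simp [isolate_adj]
      rw [hau, hdu, h1, Set.ncard_empty]
    by_cases haw : a = w
    · rw [haw, hdw, ← h.degree w hwn]
      have h1 : (isolate (remaining G deg) u).neighborSet w =
          (remaining G deg).neighborSet w \ {u} := by
        ext b
        simp [isolate_adj, hwu]
      have h2 : u ∈ (remaining G deg).neighborSet w := huw.symm
      rw [h1, Set.ncard_sdiff_singleton_of_mem h2]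
    · rw [hda a hau haw, ← h.degree a ha]
      congr 1
      ext b
      simp only [SimpleGraph.mem_neighborSet, isolate_adj]
      refine ⟨fun h => h.1, fun hab => ⟨hab, hau, fun e => haw ?_⟩⟩
      exact (hleaf a).1 (e ▸ hab.symm)
  · have hT : ∀ a < n, (if k u = 1 then Function.update (Function.update k w 1) u 0 else k) a = 1 ↔
        a ∈ if u ∈ terminals n k then insert w ((terminals n k).erase u) else terminals n k := by
      intro a ha
      have huT : u ∈ terminals n k ↔ k u = 1 := by simp [mem_terminals, hun]
      simp only [huT]
      split_ifs with hku
      · rw [Finset.mem_insert, Finset.mem_erase, mem_terminals]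
        by_cases hau : a = u
        · simp [hau, hwu.symm]
        · rw [Function.update_of_ne hau]
          by_cases haw : a = w
          · simp [haw]
          · rw [Function.update_of_ne haw]
            simp [haw, hau, ha]
      · simp [mem_terminals, ha]
    have hT' : terminals n (if k u = 1 then Function.update (Function.update k w 1) u 0 else k) =
        if u ∈ terminals n k then insert w ((terminals n k).erase u) else terminals n k := by
      ext a
      rw [mem_terminals]
      refine ⟨fun ⟨h1, h2⟩ => (hT a h1).1 h2, fun h' => ?_⟩
      have han : a < n := by
        split_ifs at h'
        · rw [Finset.mem_insert, Finset.mem_erase, mem_terminals] at h'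
          rcases h' with rfl | h'
          · exact hwn
          · exact h'.2.1
        · exact (mem_terminals.1 h').1
      exact ⟨han, (hT a han).2 h'⟩
    refine ⟨fun a ha => ?_, fun hn => ?_, fun hn => ?_, fun q hq => ?_⟩
    · have := h.inst.le_one a ha
      split_ifs
      · rw [Function.update_apply, Function.update_apply]
        split_ifs <;> omega
      · exact this
    · rw [hT']
      split_ifs
      · simp
      · exact h.inst.nonempty hn
    · rw [hT', hadj, yes_isolate_leaf (h.inst.nonempty hn) hleaf]
      exact h.inst.yes hn
    · rw [hadj]
      exact (h.inst.fes q hq).anti isolate_le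
  · by_cases hxu : x = u
    · rw [hxu, hdu]
      omega
    · rw [hda x hxu hxw]
      exact h.no_leaf x hx hxn hxu

end PruneInv

/-- Leaves are deleted exhaustively in linear time. Only the list of a leaf is ever scanned, and the
scan ends with the deletion of that leaf, so the scans take time proportional to the sum of the
`len v + 1` over all vertices `v`. -/
theorem halts_prune (hG : Lists n off len adj G)
    {s : Mem} (hs : Frame n off s) (h1 : s.arr 1 = adj) (h7 : ∀ v < n, s.arr 7 v = len v)
    (hI : Instance n G Y G (s.arr 2)) :
    Halts (Prog.seq startPass pruneLoop) s
      (startPass.bound + pruneLoop.roundCost * (2 * (n + off n) + 1) + 1) fun s' =>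
        Frame n off s' ∧ s'.arr 1 = adj ∧
        (∀ v < n, ((remaining G (s'.arr 7)).neighborSet v).ncard = s'.arr 7 v) ∧
        (∀ v < n, s'.arr 7 v ≠ 1) ∧ Instance n G Y (remaining G (s'.arr 7)) (s'.arr 2) := by
  refine (Halts.run (Q := fun s' => s' = startPass.run s) (by simp [Prog.LoopFree, startPass])
    rfl).seq fun s0 hs0 => ?_
  have hrem : remaining G (s.arr 7) = G := by
    ext a b
    rw [remaining_adj, and_iff_left_iff_imp]
    have key : ∀ a b, G.Adj a b → s.arr 7 a ≠ 0 := by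
      intro a b hab
      have ha := hG.lt a b hab
      rw [h7 a ha, ← hG.ncard ha]
      exact (Set.ncard_pos (hG.finite a)).2 ⟨b, hab⟩ |>.ne'
    exact fun hab => ⟨key a b hab, key b a hab.symm⟩
  -- each round advances `reg 2`, or advances in the list of a leaf, or deletes the leaf
  refine (Halts.loop (by simp [Prog.LoopFree]) (fun s' => Frame n off s' ∧ s'.arr 1 = adj ∧
      PruneInv n off adj G Y (s'.reg 2) (s'.reg 3) (s'.reg 4) (s'.arr 7) (s'.arr 2))
      (fun s' => (n - s'.reg 2) + (potential n len (s'.arr 7) - (s'.reg 4 - off (s'.reg 3))))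
      ?_ ?_ ?_).mono ?_
  · rintro s' ⟨hF, ha1, hI⟩ hb
    simp only [Test.Holds, Expr.eval, hF.size] at hb
    by_cases hu : s'.arr 7 (s'.reg 3) = 1
    · have hlt := hI.lt_of_leaf hG hb hu
      have hpos := hI.pos
      have hpot := fun d h1 h2 => potential_le_of_le (len := len) (deg := s'.arr 7) (deg' := d)
        (hI.current hb) (by omega) h1 h2
      by_cases hi : s'.arr 7 (adj (s'.reg 4)) = 0
      · simp only [Prog.run, Test.Holds, Expr.eval, hu, hi, if_true, ha1]
        have hpot' := hpot (fun _ => 0) rfl fun _ _ => rfl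
        refine ⟨⟨⟨?_, ?_, ?_, ?_, ?_⟩, ?_, ?_⟩, ?_⟩
        all_goals simp [hF.size, hF.outSize, hF.offsets, hF.outOffsets, hF.numbers, ha1]
        · exact hI.step_scan hu hi
        · omega
      · have hstep := hI.step_prune hG hb hu hi
        have hwu : adj (s'.reg 4) ≠ s'.reg 3 := (hG.adj_of (hI.current hb) hpos hlt).ne'
        have hpot' := hpot (Function.update (Function.update (s'.arr 7) (s'.reg 3) 0)
            (adj (s'.reg 4))
            (Function.update (s'.arr 7) (s'.reg 3) 0 (adj (s'.reg 4)) - 1)) (by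
          rw [Function.update_of_ne hwu.symm, Function.update_self]) (by
          intro x hx
          simp only [Function.update_apply]
          split_ifs <;> simp_all)
        simp only [Prog.run, Test.Holds, Expr.eval, hu, hi, if_true, if_false, ha1]
        split_ifs with hk
        · rw [if_pos (by simpa [hwu.symm] using hk)] at hstep
          refine ⟨⟨⟨?_, ?_, ?_, ?_, ?_⟩, ?_, ?_⟩, ?_⟩
          all_goals simp [hF.size, hF.outSize, hF.offsets, hF.outOffsets, hF.numbers, ha1]
          · exact hstep
          · omega
        · rw [if_neg (by simpa [hwu.symm] using hk)] at hstep
          refine ⟨⟨⟨?_, ?_, ?_, ?_, ?_⟩, ?_, ?_⟩, ?_⟩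
          all_goals simp [hF.size, hF.outSize, hF.offsets, hF.outOffsets, hF.numbers, ha1]
          · exact hstep
          · omega
    · have hstep := hI.step_next hb hu
      have hstart := hI.start hu
      simp only [Prog.run, Test.Holds, Expr.eval, hu, if_false]
      refine ⟨⟨⟨?_, ?_, ?_, ?_, ?_⟩, ?_, ?_⟩, ?_⟩
      all_goals simp [hF.size, hF.outSize, hF.offsets, hF.outOffsets, hF.numbers, ha1]
      · exact hstep
      · omega
  · subst hs0
    simp only [startPass, Prog.run, Expr.eval]
    refine ⟨⟨?_, ?_, ?_, ?_, ?_⟩, ?_, ?_⟩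
    all_goals simp [hs.size, hs.outSize, hs.offsets, hs.outOffsets, hs.numbers, h1]
    refine ⟨by simp, id, id, fun a ha => ?_, ?_, fun x hx hxn h0 => by omega, by simp [hG.zero],
      by simp, by simp [hG.zero]⟩
    · rw [hrem, hG.ncard ha, h7 a ha]
    · rwa [hrem]
  · subst hs0
    have := potential_le (deg := s.arr 7) hG
    simp [startPass, Prog.run, Expr.eval, hG.zero]
    omega
  · rintro s' ⟨⟨hF, ha1, hI⟩, hb⟩
    simp only [Test.Holds, Expr.eval, hF.size] at hb
    have hv : s'.reg 2 = n := le_antisymm hI.le (by omega)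
    have hu := hI.last hv
    exact ⟨hF, ha1, hI.degree, fun v hv' => hI.no_leaf v (by omega) hv' (by omega), hI.inst⟩

/-! ### Removing deleted vertices from the lists -/

/-- The state while the lists are compacted: the lists before `v` are done, and those entries of the
list of `v` before position `i` that are still present have been copied, up to position `p`. -/
structure CompactInv (n : ℕ) (off adj : ℕ → ℕ) (G : SimpleGraph ℕ) (deg : ℕ → ℕ) (v p i : ℕ)
    (adj' : ℕ → ℕ) : Prop where
  le : v ≤ n
  pos : off v ≤ p
  pos_le : p ≤ i
  scan_le : v < n → i ≤ off (v + 1)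
  scan_end : i ≤ off n
  done : ∀ w < v, Set.BijOn adj' (Set.Ico (off w) (off w + deg w))
    ((remaining G deg).neighborSet w)
  current : Set.BijOn adj' (Set.Ico (off v) p)
    {x | (∃ j, off v ≤ j ∧ j < i ∧ adj j = x) ∧ (remaining G deg).Adj v x}

namespace CompactInv

variable {v p i : ℕ} {adj' : ℕ → ℕ}

theorem step_keep (hG : Lists n off len adj G) (hlen : ∀ v < n, off v + len v = off (v + 1))
    (hdeg : ∀ v < n, off v + deg v ≤ off (v + 1))
    (h : CompactInv n off adj G deg v p i adj') (hv : v < n) (hi : i < off (v + 1))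
    (h0 : deg v ≠ 0) (h0' : deg (adj i) ≠ 0) :
    CompactInv n off adj G deg v (p + 1) (i + 1) (Function.update adj' p (adj i)) := by
  have hp := h.pos
  have hpi := h.pos_le
  have hbij := hG.bij v hv
  rw [hlen v hv] at hbij
  have hGi : G.Adj v (adj i) := hG.adj_of hv (by omega) (by rw [hlen v hv]; exact hi)
  have hend := hG.mono (v := v + 1) (w := n) hv le_rfl
  refine ⟨h.le, by omega, by omega, fun _ => hi, by omega, fun w hw => ?_, ?_⟩
  · refine bijOn_update_of_notMem ?_ (h.done w hw)
    have h1 := hdeg w (by omega)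
    have h2 := hG.mono (v := w + 1) (w := v) hw hv.le
    rw [Set.mem_Ico]
    omega
  · convert bijOn_push hp ?_ h.current using 1
    · ext x
      simp only [Set.mem_ofPred_eq, Set.mem_insert_iff]
      constructor
      · rintro ⟨⟨j, hj1, hj2, rfl⟩, hx⟩
        rcases Nat.lt_succ_iff_lt_or_eq.1 hj2 with hj2 | rfl
        · exact Or.inr ⟨⟨j, hj1, hj2, rfl⟩, hx⟩
        · exact Or.inl rfl
      · rintro (rfl | ⟨⟨j, hj1, hj2, rfl⟩, hx⟩)
        · exact ⟨⟨i, by omega, by omega, rfl⟩, hGi, h0, h0'⟩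
        · exact ⟨⟨j, hj1, by omega, rfl⟩, hx⟩
    · rintro ⟨⟨j, hj1, hj2, hj⟩, -⟩
      have := hbij.injOn (Set.mem_Ico.2 ⟨hj1, by omega⟩) (Set.mem_Ico.2 ⟨by omega, hi⟩) hj
      omega

theorem step_drop (hG : Lists n off len adj G) (h : CompactInv n off adj G deg v p i adj')
    (hv : v < n) (hi : i < off (v + 1)) (h0 : ¬ (deg v ≠ 0 ∧ deg (adj i) ≠ 0)) :
    CompactInv n off adj G deg v p (i + 1) adj' := by
  have hpi := h.pos_le
  have hend := hG.mono (v := v + 1) (w := n) hv le_rfl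
  refine ⟨h.le, h.pos, by omega, fun _ => hi, by omega, h.done, ?_⟩
  convert h.current using 1
  ext x
  simp only [Set.mem_ofPred_eq]
  refine ⟨?_, fun ⟨⟨j, hj1, hj2, hj⟩, hx⟩ => ⟨⟨j, hj1, by omega, hj⟩, hx⟩⟩
  rintro ⟨⟨j, hj1, hj2, rfl⟩, hx⟩
  rcases Nat.lt_succ_iff_lt_or_eq.1 hj2 with hj2 | rfl
  · exact ⟨⟨j, hj1, hj2, rfl⟩, hx⟩
  · exact absurd hx.2 h0

theorem step_next (hG : Lists n off len adj G) (hlen : ∀ v < n, off v + len v = off (v + 1))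
    (hdeg : ∀ v < n, ((remaining G deg).neighborSet v).ncard = deg v)
    (h : CompactInv n off adj G deg v p i adj') (hv : v < n) (hi : ¬ i < off (v + 1)) :
    CompactInv n off adj G deg (v + 1) (off (v + 1)) i adj' := by
  have hi' : i = off (v + 1) := le_antisymm (h.scan_le hv) (by omega)
  have hset : {x | (∃ j, off v ≤ j ∧ j < i ∧ adj j = x) ∧ (remaining G deg).Adj v x} =
      (remaining G deg).neighborSet v := by
    ext x
    simp only [Set.mem_ofPred_eq, SimpleGraph.mem_neighborSet, and_iff_right_iff_imp]
    intro hx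
    rw [hi', ← hlen v hv]
    exact (hG.adj_iff hv).1 hx.1
  have hcur := h.current
  rw [hset] at hcur
  refine ⟨hv, le_rfl, by omega, fun h' => by rw [hi']; exact hG.mono (by omega) h', h.scan_end,
    fun w hw => ?_, ?_⟩
  · rcases Nat.lt_succ_iff_lt_or_eq.1 hw with hw | rfl
    · exact h.done w hw
    · have h1 := ncard_of_bijOn_Ico hcur
      rw [hdeg w hv] at h1
      have := h.pos
      rwa [show off w + deg w = p by omega]
  · convert Set.bijOn_empty adj' using 1
    · simp
    · ext x
      simp only [Set.mem_ofPred_eq, Set.mem_empty_iff_false, iff_false]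
      rintro ⟨⟨j, hj1, hj2, -⟩, -⟩
      omega

end CompactInv

theorem halts_compact (hG : Lists n off len adj G) (hlen : ∀ v < n, off v + len v = off (v + 1))
    {s : Mem} (hs : Frame n off s) (h1 : s.arr 1 = adj) (h7 : s.arr 7 = deg) (h2 : s.arr 2 = k)
    (hdeg : ∀ v < n, ((remaining G deg).neighborSet v).ncard = deg v) :
    Halts (Prog.seq startPass compactLoop) s
      (startPass.bound + compactLoop.roundCost * (n + off n + 1) + 1) fun s' =>
        Frame n off s' ∧ s'.arr 7 = deg ∧ s'.arr 2 = k ∧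
        Lists n off deg (s'.arr 6) (remaining G deg) := by
  refine (Halts.run (Q := fun s' => s' = startPass.run s) (by simp [Prog.LoopFree, startPass])
    rfl).seq fun s0 hs0 => ?_
  have hle : ∀ v < n, off v + deg v ≤ off (v + 1) := fun v hv => by
    rw [← hlen v hv, ← hdeg v hv, ← hG.ncard hv]
    exact Nat.add_le_add_left (Set.ncard_le_ncard (fun _ h => h.1) (hG.finite v)) _
  refine (Halts.loop (by simp [Prog.LoopFree]) (fun s' => Frame n off s' ∧ s'.arr 1 = adj ∧
      s'.arr 7 = deg ∧ s'.arr 2 = k ∧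
      CompactInv n off adj G deg (s'.reg 2) (s'.reg 3) (s'.reg 4) (s'.arr 6))
      (fun s' => (n - s'.reg 2) + (off n - s'.reg 4)) ?_ ?_ ?_).mono ?_
  · rintro s' ⟨hF, ha1, ha7, ha2, hI⟩ hb
    simp only [Test.Holds, Expr.eval, hF.size] at hb
    have hend := hG.mono (v := s'.reg 2 + 1) (w := n) hb le_rfl
    by_cases hi : s'.reg 4 < off (s'.reg 2 + 1)
    · by_cases h0 : deg (s'.reg 2) ≠ 0 ∧ deg (adj (s'.reg 4)) ≠ 0
      · have hstep := hI.step_keep hG hlen hle hb hi h0.1 h0.2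
        simp only [Prog.run, Test.Holds, Expr.eval, hF.offsets, hi, if_true, ha1, ha7,
          Nat.pos_iff_ne_zero, h0, and_self, ne_eq, not_false_eq_true]
        refine ⟨⟨⟨?_, ?_, ?_, ?_, ?_⟩, ?_, ?_, ?_, ?_⟩, ?_⟩
        all_goals simp [hF.size, hF.outSize, hF.offsets, hF.outOffsets, hF.numbers, ha1, ha7, ha2]
        · exact hstep
        · omega
      · have hstep := hI.step_drop hG hb hi h0
        simp only [Prog.run, Test.Holds, Expr.eval, hF.offsets, hi, if_true, ha1, ha7,
          Nat.pos_iff_ne_zero, if_neg h0]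
        refine ⟨⟨⟨?_, ?_, ?_, ?_, ?_⟩, ?_, ?_, ?_, ?_⟩, ?_⟩
        all_goals simp [hF.size, hF.outSize, hF.offsets, hF.outOffsets, hF.numbers, ha1, ha7, ha2]
        · exact hstep
        · omega
    · have hstep := hI.step_next hG hlen hdeg hb hi
      simp only [Prog.run, Test.Holds, Expr.eval, hF.offsets, hi, if_false]
      refine ⟨⟨⟨?_, ?_, ?_, ?_, ?_⟩, ?_, ?_, ?_, ?_⟩, ?_⟩
      all_goals simp [hF.size, hF.outSize, hF.offsets, hF.outOffsets, hF.numbers, ha1, ha7, ha2]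
      · exact hstep
      · omega
  · subst hs0
    simp only [startPass, Prog.run, Expr.eval]
    refine ⟨⟨?_, ?_, ?_, ?_, ?_⟩, ?_, ?_, ?_, ?_⟩
    all_goals simp [hs.size, hs.outSize, hs.offsets, hs.outOffsets, hs.numbers, h1, h7, h2]
    refine ⟨by simp, by simp [hG.zero], by simp, by simp, by simp, by simp, ?_⟩
    simp [hG.zero]
  · subst hs0
    simp [startPass, Prog.run, Expr.eval]
  · rintro s' ⟨⟨hF, ha1, ha7, ha2, hI⟩, hb⟩
    simp only [Test.Holds, Expr.eval, hF.size] at hb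
    have hv : s'.reg 2 = n := le_antisymm hI.le (by omega)
    exact ⟨hF, ha7, ha2, hG.zero, hle, fun v hv' => hI.done v (by omega),
      fun a b hab => hG.lt a b hab.1⟩

/-! ### Shortening paths -/

section Settled

variable {V : Type*} {H : SimpleGraph V} {a b p r v x y z : V}

theorem not_branch (hx : ∀ w, H.Adj x w ↔ w = a ∨ w = b) : ¬ Branch H x := by
  rintro ⟨c, d, e, hcd, hce, hde, hc, hd, he⟩
  rw [hx] at hc hd he
  grind

theorem Link.symm (h : Link H v x z) : Link H v z x :=
  ⟨h.1.symm, fun w => (h.2 w).trans or_comm⟩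

theorem bypass_adj_of_ne (hy : Link H y x z) (hpx : p ≠ x) (hpy : p ≠ y) (hpz : p ≠ z) (w : V) :
    (bypass H x y z).Adj p w ↔ H.Adj p w := by
  rw [bypass_adj]
  constructor
  · rintro ⟨-, -, -, h | h | h⟩
    · exact h
    · exact absurd h.1 hpx
    · exact absurd h.1 hpz
  · intro h
    refine ⟨h.ne, hpy, ?_, Or.inl h⟩
    rintro rfl
    exact ((hy.2 p).1 h.symm).elim hpx hpz

/-- After `y` has been bypassed, its former neighbour `x` has the neighbour `z` in place of `y`. -/
theorem link_bypass_end (hy : Link H y x z) (hx : Link H x a y) (hnxz : ¬ H.Adj x z) :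
    Link (bypass H x y z) x a z := by
  have hxa := (hx.2 a).2 (Or.inl rfl)
  have hxy := (hx.2 y).2 (Or.inr rfl)
  refine ⟨fun e => hnxz (e ▸ hxa), fun w => ?_⟩
  rw [bypass_adj, hx.2]
  constructor
  · rintro ⟨-, -, h1, (h | h) | h | h⟩
    · exact Or.inl h
    · exact absurd h h1
    · exact Or.inr h.2
    · exact absurd h.1 hy.1
  · rintro (rfl | rfl)
    · exact ⟨hxa.ne, hxy.ne, hx.1, by simp⟩
    · exact ⟨hy.1, hxy.ne, ((hy.2 w).2 (Or.inr rfl)).ne', by simp⟩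

variable [DecidableEq V]

/-- A vertex that needs no bypassing stays so when another vertex is bypassed: vertices with three
neighbours and triangle components are not affected. -/
theorem Settled.bypass (hv : Settled H v) (hvy : v ≠ y) (hy : Link H y x z) (hx : Link H x a y)
    (hz : Link H z b y) (hnxz : ¬ H.Adj x z) : Settled (bypass H x y z) v := by
  have hnz : ¬ H.Adj z x := fun h => hnxz h.symm
  have hBne : ∀ p, Branch H p → p ≠ x ∧ p ≠ y ∧ p ≠ z := fun p hp =>
    ⟨fun e => not_branch hx.2 (e ▸ hp), fun e => not_branch hy.2 (e ▸ hp),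
      fun e => not_branch hz.2 (e ▸ hp)⟩
  have hB : ∀ p, Branch H p → Branch (InTree.bypass H x y z) p := by
    intro p hp
    have hne := hBne p hp
    unfold Branch
    simp only [bypass_adj_of_ne hy hne.1 hne.2.1 hne.2.2]
    exact hp
  have hL : ∀ p r s, p ≠ x → p ≠ y → p ≠ z → Link H p r s → Link (InTree.bypass H x y z) p r s :=
    fun p r s h1 h2 h3 h => ⟨h.1, fun w => by rw [bypass_adj_of_ne hy h1 h2 h3, h.2]⟩
  -- a settled neighbour `x` of the bypassed vertex `y` owes this to its other neighbour `a`
  have key : ∀ x z a, Link H y x z → Link H x a y → ¬ H.Adj x z → Settled H x → Branch H a := by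
    rintro x z a hy hx hnxz ⟨p, r, hl, h⟩
    have hp := (hx.2 p).1 ((hl.2 p).2 (Or.inl rfl))
    have hr := (hx.2 r).1 ((hl.2 r).2 (Or.inr rfl))
    rcases h with h | h | h
    · rcases hp with rfl | rfl
      · exact h
      · exact absurd h (not_branch hy.2)
    · rcases hr with rfl | rfl
      · exact h
      · exact absurd h (not_branch hy.2)
    · have hxp := (hl.2 p).2 (Or.inl rfl)
      have hxr := (hl.2 r).2 (Or.inr rfl)
      rcases (hl.2 y).1 ((hx.2 y).2 (Or.inr rfl)) with rfl | rfl
      · rcases (hy.2 r).1 ((h.1.2 r).2 (Or.inr rfl)) with rfl | rfl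
        · exact absurd rfl hxr.ne
        · exact absurd hxr hnxz
      · rcases (hy.2 p).1 ((h.2.2 p).2 (Or.inr rfl)) with rfl | rfl
        · exact absurd rfl hxp.ne
        · exact absurd hxp hnxz
  by_cases hvx : v = x
  · subst hvx
    exact ⟨a, z, link_bypass_end hy hx hnxz, Or.inl (hB a (key _ _ _ hy hx hnxz hv))⟩
  by_cases hvz : v = z
  · subst hvz
    refine ⟨b, x, ?_, Or.inl (hB b (key _ _ _ hy.symm hz hnz hv))⟩
    rw [bypass_comm]
    exact link_bypass_end hy.symm hz hnz
  obtain ⟨p, r, hl, h⟩ := hv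
  refine ⟨p, r, hL _ _ _ hvx hvy hvz hl, h.imp (hB p) (Or.imp (hB r) fun h => ?_)⟩
  have hne : ∀ p r, Link H v p r → Link H p v r → Link H r v p → p ≠ x ∧ p ≠ y ∧ p ≠ z := by
    intro p r hl h1 h2
    have hpr := (h1.2 r).2 (Or.inr rfl)
    refine ⟨?_, ?_, ?_⟩
    · rintro rfl
      rcases (h1.2 y).1 ((hx.2 y).2 (Or.inr rfl)) with e | rfl
      · exact hvy e.symm
      rcases (hy.2 v).1 ((h2.2 v).2 (Or.inl rfl)) with e | e
      · exact hvx e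
      · exact hvz e
    · rintro rfl
      rcases (hy.2 v).1 ((h1.2 v).2 (Or.inl rfl)) with e | e
      · exact hvx e
      · exact hvz e
    · rintro rfl
      rcases (h1.2 y).1 ((hz.2 y).2 (Or.inr rfl)) with e | rfl
      · exact hvy e.symm
      rcases (hy.2 v).1 ((h2.2 v).2 (Or.inl rfl)) with e | e
      · exact hvx e
      · exact hvz e
  have hp := hne p r hl h.1 h.2
  have hr := hne r p hl.symm h.2 h.1
  exact ⟨hL _ _ _ hp.1 hp.2.1 hp.2.2 h.1, hL _ _ _ hr.1 hr.2.1 hr.2.2 h.2⟩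

end Settled

theorem Lists.link (hH : Lists n off deg adj H) {v : ℕ} (hv : v < n) (h2 : deg v = 2) :
    Link H v (adj (off v)) (adj (off v + 1)) := by
  have h := hH.bij v hv
  rw [h2, bijOn_pair] at h
  refine ⟨h.1, fun w => ?_⟩
  rw [← SimpleGraph.mem_neighborSet, h.2]
  simp

theorem Lists.branch (hH : Lists n off deg adj H) {v : ℕ} (hv : v < n) (h3 : 3 ≤ deg v) :
    Branch H v := by
  have hinj := (hH.bij v hv).injOn
  have hne : ∀ i j, i < j → j < 3 → adj (off v + i) ≠ adj (off v + j) := by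
    intro i j hij hj e
    have := hinj (Set.mem_Ico.2 ⟨by omega, by omega⟩) (Set.mem_Ico.2 ⟨by omega, by omega⟩) e
    omega
  exact ⟨_, _, _, hne 0 1 (by omega) (by omega), hne 0 2 (by omega) (by omega),
    hne 1 2 (by omega) (by omega), hH.adj_of hv (by omega) (by omega),
    hH.adj_of hv (by omega) (by omega), hH.adj_of hv (by omega) (by omega)⟩

theorem Lists.deg_ne_zero (hH : Lists n off deg adj H) {v w : ℕ} (h : H.Adj v w) : deg v ≠ 0 := by
  have hv := hH.lt v w h
  obtain ⟨j, h1, h2, -⟩ := (hH.adj_iff hv).1 h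
  omega

/-- The lists after `v` has been bypassed. -/
theorem Lists.bypass (hH : Lists n off deg adj H) {v x z a b : ℕ} (hv : v < n)
    (hl : Link H v x z) (hlx : Link H x a v) (hlz : Link H z b v) (h2x : deg x = 2)
    (h2z : deg z = 2) (hnxz : ¬ H.Adj x z) :
    Lists n off (Function.update deg v 0) (replaceIn (replaceIn adj (off x) v z) (off z) v x)
      (bypass H x v z) := by
  have hvx := (hl.2 x).2 (Or.inl rfl)
  have hvz := (hl.2 z).2 (Or.inr rfl)
  have hxn := hH.lt x v hvx.symm
  have hzn := hH.lt z v hvz.symm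
  have hdisj : ∀ u w, u < n → w < n → u ≠ w → off u + deg u ≤ off w ∨ off w + deg w ≤ off u := by
    intro u w hu hw huw
    rcases lt_or_gt_of_ne huw with h | h
    · have := hH.le u hu; have := hH.mono (v := u + 1) (w := w) h hw.le; omega
    · have := hH.le w hw; have := hH.mono (v := w + 1) (w := u) h hu.le; omega
  have hdxz := hdisj x z hxn hzn hl.1
  refine ⟨hH.zero, fun w hw => ?_, fun w hw => ?_, fun p w h => ?_⟩
  · have := hH.le w hw
    rw [Function.update_apply]
    split_ifs <;> omega
  · by_cases hwv : w = v
    · subst hwv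
      rw [Function.update_self]
      convert Set.bijOn_empty _ using 1
      · simp
      · ext p
        simp [bypass_adj]
    rw [Function.update_of_ne hwv]
    by_cases hwx : w = x
    · subst hwx
      have h1 := hH.bij w hw
      rw [h2x] at h1 ⊢
      have h3 := bijOn_replaceIn (y := v) (z := z) h1 hvx.symm hnxz
      have h4 := h3.congr (f₂ := replaceIn (replaceIn adj (off w) v z) (off z) v w)
        fun j hj => (replaceIn_of_notMem (by rw [Set.mem_Ico] at hj; omega)).symm
      convert h4 using 1
      ext p
      rw [SimpleGraph.mem_neighborSet, (link_bypass_end hl hlx hnxz).2]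
      simp only [Set.mem_insert_iff, Set.mem_sdiff, SimpleGraph.mem_neighborSet, hlx.2,
        Set.mem_singleton_iff]
      have := hlx.1
      grind
    by_cases hwz : w = z
    · subst hwz
      have h1 := hH.bij w hw
      rw [h2z] at h1 ⊢
      have h3 := h1.congr (f₂ := replaceIn adj (off x) v w)
        fun j hj => (replaceIn_of_notMem (by rw [Set.mem_Ico] at hj; omega)).symm
      have h4 := bijOn_replaceIn (y := v) (z := x) h3 hvz.symm fun h => hnxz h.symm
      convert h4 using 1
      ext p
      rw [SimpleGraph.mem_neighborSet, bypass_comm,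
        (link_bypass_end hl.symm hlz fun h => hnxz h.symm).2]
      simp only [Set.mem_insert_iff, Set.mem_sdiff, SimpleGraph.mem_neighborSet, hlz.2,
        Set.mem_singleton_iff]
      have := hlz.1
      grind
    · have hdx := hdisj w x hw hxn hwx
      have hdz := hdisj w z hw hzn hwz
      have h3 := (hH.bij w hw).congr (f₂ := replaceIn (replaceIn adj (off x) v z) (off z) v x)
        fun j hj => by
          rw [Set.mem_Ico] at hj
          rw [replaceIn_of_notMem (by omega), replaceIn_of_notMem (by omega)]
      convert h3 using 1
      ext p
      exact bypass_adj_of_ne hl hwx hwv hwz p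
  · rcases h.2.2.2 with h | ⟨rfl, -⟩ | ⟨rfl, -⟩
    · exact hH.lt p w h
    · exact hxn
    · exact hzn

/-- The statuses that the program writes are those of `yes_bypass_status`. -/
theorem terminals_bypass {v x z : ℕ} (hv : v < n) (hx : x < n) (hz : z < n) (hvx : x ≠ v)
    (hk : ∀ v < n, k v ≤ 1) :
    terminals n (Function.update (if k x = k z then Function.update k x (k v) else k) v 0) =
      (if x ∈ terminals n k ↔ z ∈ terminals n k then
        (if v ∈ terminals n k then insert x (terminals n k) else (terminals n k).erase x)
        else terminals n k).erase v := by
  have hkv := hk v hv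
  have hkx := hk x hx
  have hkz := hk z hz
  have hiff : (x ∈ terminals n k ↔ z ∈ terminals n k) ↔ k x = k z := by
    simp only [mem_terminals, hx, hz, true_and]
    omega
  have hkv' : v ∈ terminals n k ↔ k v = 1 := by simp [mem_terminals, hv]
  simp only [hiff, hkv']
  ext w
  by_cases hwv : w = v
  · simp [hwv, mem_terminals]
  rw [mem_terminals, Function.update_of_ne hwv, Finset.mem_erase, and_iff_right hwv]
  by_cases hwx : w = x
  · subst hwx
    split_ifs with h1 h2
    · simp [h2, hx]
    · simp [h2]
    · rw [mem_terminals]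
  · split_ifs with h1 h2
    · simp [hwx, mem_terminals]
    · simp [hwx, mem_terminals]
    · rw [mem_terminals]

/-- The state while vertices of degree two are bypassed: the vertices before `v` are done. -/
structure BypassInv (n : ℕ) (off : ℕ → ℕ) (G : SimpleGraph ℕ) (Y : Prop) (v : ℕ)
    (deg k adj : ℕ → ℕ) (H : SimpleGraph ℕ) : Prop where
  le : v ≤ n
  lists : Lists n off deg adj H
  inst : Instance n G Y H k
  no_leaf : ∀ x < n, deg x ≠ 1
  settled : ∀ w < v, deg w = 2 → Settled H w

namespace BypassInv

variable {v : ℕ}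

theorem step_bypass (h : BypassInv n off G Y v deg k adj H) (hv : v < n) {x z : ℕ}
    (hx : adj (off v) = x) (hz : adj (off v + 1) = z) (h2 : deg v = 2) (h2x : deg x = 2)
    (h2z : deg z = 2) (h1 : adj (off x) ≠ z) (h1' : adj (off x + 1) ≠ z) :
    BypassInv n off G Y (v + 1) (Function.update deg v 0)
      (Function.update (if k x = k z then Function.update k x (k v) else k) v 0)
      (replaceIn (replaceIn adj (off x) v z) (off z) v x) (bypass H x v z) := by
  have hl := h.lists.link hv h2
  rw [hx, hz] at hl
  have hvx := (hl.2 x).2 (Or.inl rfl)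
  have hvz := (hl.2 z).2 (Or.inr rfl)
  have hxn := h.lists.lt x v hvx.symm
  have hzn := h.lists.lt z v hvz.symm
  have hother : ∀ u, u < n → deg u = 2 → H.Adj u v → ∃ a, Link H u a v := by
    intro u hu h2u huv
    have hlu := h.lists.link hu h2u
    rcases (hlu.2 v).1 huv with e | e
    · exact ⟨_, e ▸ hlu.symm⟩
    · exact ⟨_, e ▸ hlu⟩
  obtain ⟨a, hlx⟩ := hother x hxn h2x hvx.symm
  obtain ⟨b, hlz⟩ := hother z hzn h2z hvz.symm
  have hnxz : ¬ H.Adj x z := by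
    rw [(h.lists.link hxn h2x).2]
    rintro (e | e)
    · exact h1 e.symm
    · exact h1' e.symm
  refine ⟨hv, h.lists.bypass hv hl hlx hlz h2x h2z hnxz, ⟨fun w hw => ?_, fun hn => ?_,
    fun hn => ?_, fun q hq => ?_⟩, fun w hw => ?_, fun w hw hdw => ?_⟩
  · have hkw := h.inst.le_one w hw
    have hkv := h.inst.le_one v hv
    rw [Function.update_apply]
    split_ifs
    · omega
    · rw [Function.update_apply]
      split_ifs <;> omega
    · exact hkw
  · have h0 := h.inst.nonempty hn
    rw [terminals_bypass hv hxn hzn hvx.ne' h.inst.le_one]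
    -- two of the three vertices have the same status, so a terminal remains
    split_ifs with h3 h4
    · exact ⟨x, Finset.mem_erase.2 ⟨hvx.ne', Finset.mem_insert_self _ _⟩⟩
    · by_cases hxT : x ∈ terminals n k
      · exact ⟨z, Finset.mem_erase.2 ⟨hvz.ne', Finset.mem_erase.2 ⟨hl.1.symm, h3.1 hxT⟩⟩⟩
      · obtain ⟨w, hw⟩ := h0
        exact ⟨w, Finset.mem_erase.2 ⟨fun e => h4 (e ▸ hw), Finset.mem_erase.2
          ⟨fun e => hxT (e ▸ hw), hw⟩⟩⟩
    · by_cases hxT : x ∈ terminals n k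
      · exact ⟨x, Finset.mem_erase.2 ⟨hvx.ne', hxT⟩⟩
      · exact ⟨z, Finset.mem_erase.2 ⟨hvz.ne', by tauto⟩⟩
  · rw [terminals_bypass hv hxn hzn hvx.ne' h.inst.le_one,
      yes_bypass_status (h.inst.nonempty hn) hlx.2 hl.2 hlz.2 hlx.1 hl.1 hnxz]
    exact h.inst.yes hn
  · exact (h.inst.fes q hq).bypass hl.2 hl.1 hnxz
  · have := h.no_leaf w hw
    rw [Function.update_apply]
    split_ifs <;> omega
  · have hwv : w ≠ v := by
      rintro rfl
      rw [Function.update_self] at hdw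
      omega
    rw [Function.update_of_ne hwv] at hdw
    exact (h.settled w (by omega) hdw).bypass hwv hl hlx hlz hnxz

/-- A vertex that is not bypassed is settled: it has a neighbour of degree at least three, or its two
neighbours have degree two and are adjacent. -/
theorem step_skip (h : BypassInv n off G Y v deg k adj H) (hv : v < n) {x z : ℕ}
    (hx : adj (off v) = x) (hz : adj (off v + 1) = z)
    (hc : ¬ ((deg v = 2 ∧ deg x = 2 ∧ deg z = 2) ∧ ¬ adj (off x) = z ∧ ¬ adj (off x + 1) = z)) :
    BypassInv n off G Y (v + 1) deg k adj H := by
  refine ⟨hv, h.lists, h.inst, h.no_leaf, fun w hw h2 => ?_⟩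
  rcases Nat.lt_succ_iff_lt_or_eq.1 hw with hw | rfl
  · exact h.settled w hw h2
  have hl := h.lists.link hv h2
  rw [hx, hz] at hl
  have hvx := (hl.2 x).2 (Or.inl rfl)
  have hvz := (hl.2 z).2 (Or.inr rfl)
  have hxn := h.lists.lt x w hvx.symm
  have hzn := h.lists.lt z w hvz.symm
  have hbr : ∀ u, H.Adj u w → deg u ≠ 2 → Branch H u := by
    intro u huw hu
    have hun := h.lists.lt u w huw
    have := h.no_leaf u hun
    have := h.lists.deg_ne_zero huw
    exact h.lists.branch hun (by omega)
  refine ⟨x, z, hl, ?_⟩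
  by_cases h2x : deg x = 2
  · by_cases h2z : deg z = 2
    · have hxz : H.Adj x z := by
        rw [(h.lists.link hxn h2x).2]
        by_contra hcon
        exact hc ⟨⟨h2, h2x, h2z⟩, fun e => hcon (Or.inl e.symm), fun e => hcon (Or.inr e.symm)⟩
      have key : ∀ u p r, u < n → deg u = 2 → H.Adj u p → H.Adj u r → p ≠ r → Link H u p r := by
        intro u p r hu h2u hp hr hpr
        have hlu := h.lists.link hu h2u
        refine ⟨hpr, fun t => ?_⟩
        rw [hlu.2] at hp hr ⊢
        have := hlu.1
        grind
      exact Or.inr (Or.inr ⟨key x w z hxn h2x hvx.symm hxz hvz.ne,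
        key z w x hzn h2z hvz.symm hxz.symm hvx.ne⟩)
    · exact Or.inr (Or.inl (hbr z hvz.symm h2z))
  · exact Or.inl (hbr x hvx.symm h2x)

theorem reduced (h : BypassInv n off G Y n deg k adj H) : Reduced H := by
  intro v
  by_cases hv : ∃ w, H.Adj v w
  · obtain ⟨w, hw⟩ := hv
    have hvn := h.lists.lt v w hw
    have := h.no_leaf v hvn
    have := h.lists.deg_ne_zero hw
    by_cases h2 : deg v = 2
    · exact Or.inr (Or.inr (h.settled v hvn h2))
    · exact Or.inr (Or.inl (h.lists.branch hvn (by omega)))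
  · push Not at hv
    exact Or.inl hv

end BypassInv

theorem reg_run_replaceProg (s : Mem) (v w : ℕ) : ((replaceProg v w).run s).reg = s.reg := by
  simp only [replaceProg, Prog.run]
  split_ifs <;> rfl

theorem arr_run_replaceProg (s : Mem) (v w a : ℕ) : ((replaceProg v w).run s).arr a =
    if a = 6 then replaceIn (s.arr 6) (s.arr 0 (s.reg v)) (s.reg 2) (s.reg w) else s.arr a := by
  unfold replaceIn replaceProg
  by_cases h : (Test.eq (Expr.read 6 (Expr.read 0 (Expr.reg v))) (Expr.reg 2)).Holds s
  · have h' : s.arr 6 (s.arr 0 (s.reg v)) = s.reg 2 := h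
    rw [Prog.run_ite_pos h, if_pos h']
    simp [Prog.run, Expr.eval]
  · have h' : ¬ s.arr 6 (s.arr 0 (s.reg v)) = s.reg 2 := h
    rw [Prog.run_ite_neg h, if_neg h']
    simp [Prog.run, Expr.eval]

theorem run_bypassStep (s : Mem) {v x z : ℕ} (hv : s.reg 2 = v) (hx : s.reg 7 = x)
    (hz : s.reg 8 = z) :
    (bypassStep.run s).reg = s.reg ∧
    (bypassStep.run s).arr 7 = Function.update (s.arr 7) v 0 ∧
    (bypassStep.run s).arr 2 = Function.update (if s.arr 2 x = s.arr 2 z then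
      Function.update (s.arr 2) x (s.arr 2 v) else s.arr 2) v 0 ∧
    (bypassStep.run s).arr 6 =
      replaceIn (replaceIn (s.arr 6) (s.arr 0 x) v z) (s.arr 0 z) v x ∧
    ∀ a, a ≠ 7 → a ≠ 2 → a ≠ 6 → (bypassStep.run s).arr a = s.arr a := by
  have hite : (Prog.ite (Test.eq (Expr.read 2 (Expr.reg 7)) (Expr.read 2 (Expr.reg 8)))
        (Prog.write 2 (Expr.reg 7) (Expr.read 2 (Expr.reg 2))) Prog.skip).run (s.setArr 7 v 0) =
      if s.arr 2 x = s.arr 2 z then (s.setArr 7 v 0).setArr 2 x (s.arr 2 v)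
        else s.setArr 7 v 0 := by
    subst hv hx hz
    by_cases h : s.arr 2 (s.reg 7) = s.arr 2 (s.reg 8)
    · rw [if_pos h, Prog.run_ite_pos (by simpa [Test.Holds, Expr.eval] using h)]
      simp [Prog.run, Expr.eval]
    · rw [if_neg h, Prog.run_ite_neg (by simpa [Test.Holds, Expr.eval] using h)]
      simp [Prog.run]
  have hrun : bypassStep.run s = (fun s2 : Mem => (replaceProg 8 7).run ((replaceProg 7 8).run
      (s2.setArr 2 (s2.reg 2) 0))) ((Prog.ite (Test.eq (Expr.read 2 (Expr.reg 7))
        (Expr.read 2 (Expr.reg 8))) (Prog.write 2 (Expr.reg 7) (Expr.read 2 (Expr.reg 2)))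
        Prog.skip).run (s.setArr 7 v 0)) := by
    subst hv
    rfl
  rw [hrun, hite]
  split_ifs with h
  all_goals
    simp [reg_run_replaceProg, arr_run_replaceProg, hv, hx, hz]
    intro a h7 h2 h6
    simp [h7, h2, h6]

theorem halts_bypass {s : Mem} (hs : Frame n off s) (hH : Lists n off (s.arr 7) (s.arr 6) H)
    (hI : Instance n G Y H (s.arr 2)) (hleaf : ∀ v < n, s.arr 7 v ≠ 1) :
    Halts (Prog.seq startPass bypassLoop) s
      (startPass.bound + bypassLoop.roundCost * (n + 1) + 1) fun s' =>
        Frame n off s' ∧ ∃ H, Lists n off (s'.arr 7) (s'.arr 6) H ∧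
          Instance n G Y H (s'.arr 2) ∧ Reduced H := by
  refine (Halts.run (Q := fun s' => s' = startPass.run s) (by simp [Prog.LoopFree, startPass])
    rfl).seq fun s0 hs0 => ?_
  refine (Halts.loop (by simp [Prog.LoopFree, bypassStep, replaceProg]) (fun s' => Frame n off s' ∧
      ∃ H, BypassInv n off G Y (s'.reg 2) (s'.arr 7) (s'.arr 2) (s'.arr 6) H)
      (fun s' => n - s'.reg 2) ?_ ?_ ?_).mono ?_
  · rintro s' ⟨hF, H, hI⟩ hb
    simp only [Test.Holds, Expr.eval, hF.size] at hb
    obtain ⟨s1, hs1, hx, hz, hreg, harr⟩ : ∃ s1,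
        s1 = (Prog.seq (Prog.assign 7 (Expr.read 6 (Expr.read 0 (Expr.reg 2))))
          (Prog.assign 8 (Expr.read 6 (Expr.succ (Expr.read 0 (Expr.reg 2)))))).run s' ∧
        s'.arr 6 (off (s'.reg 2)) = s1.reg 7 ∧ s'.arr 6 (off (s'.reg 2) + 1) = s1.reg 8 ∧
        (∀ r, r ≠ 7 → r ≠ 8 → s1.reg r = s'.reg r) ∧ s1.arr = s'.arr := by
      refine ⟨_, rfl, ?_, ?_, fun r h7 h8 => ?_, ?_⟩
      · simp [Prog.run, Expr.eval, hF.offsets]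
      · simp [Prog.run, Expr.eval, hF.offsets]
      · simp [Prog.run, h7, h8]
      · ext a
        simp [Prog.run]
    have h2 : s1.reg 2 = s'.reg 2 := hreg 2 (by simp) (by simp)
    have hrun : ∀ p q : Prog, (Prog.seq (Prog.seq (Prog.assign 7 (Expr.read 6
        (Expr.read 0 (Expr.reg 2)))) (Prog.assign 8 (Expr.read 6 (Expr.succ
        (Expr.read 0 (Expr.reg 2)))))) (Prog.seq p q)).run s' = q.run (p.run s1) := by
      intro p q
      rw [hs1]
      rfl
    rw [hrun]
    by_cases hc : bypassTest.Holds s1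
    · rw [Prog.run_ite_pos hc]
      simp only [bypassTest, Test.Holds, Expr.eval, harr, h2, hF.offsets] at hc
      have hstep := hI.step_bypass hb hx hz hc.1.1 hc.1.2.1 hc.1.2.2 hc.2.1 hc.2.2
      obtain ⟨e1, e2, e3, e4, e5⟩ := run_bypassStep s1 h2 rfl rfl
      rw [harr] at e2 e3 e4 e5
      simp only [Prog.run, Expr.eval]
      refine ⟨⟨⟨?_, ?_, ?_, ?_, ?_⟩, bypass H (s1.reg 7) (s'.reg 2) (s1.reg 8), ?_⟩, ?_⟩
      all_goals simp [hF.size, hF.outSize, hF.offsets, hF.outOffsets, hF.numbers, e1, e2, e3, e4,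
        e5, h2, hreg]
      · exact hstep
      · omega
    · rw [Prog.run_ite_neg hc]
      simp only [bypassTest, Test.Holds, Expr.eval, harr, h2, hF.offsets] at hc
      have hstep := hI.step_skip hb hx hz hc
      simp only [Prog.run, Expr.eval]
      refine ⟨⟨⟨?_, ?_, ?_, ?_, ?_⟩, H, ?_⟩, ?_⟩
      all_goals simp [hF.size, hF.outSize, hF.offsets, hF.outOffsets, hF.numbers, harr, h2, hreg]
      · exact hstep
      · omega
  · subst hs0
    simp only [startPass, Prog.run, Expr.eval]
    refine ⟨⟨?_, ?_, ?_, ?_, ?_⟩, H, ?_⟩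
    all_goals simp [hs.size, hs.outSize, hs.offsets, hs.outOffsets, hs.numbers]
    exact ⟨Nat.zero_le _, hH, hI, hleaf, by simp⟩
  · subst hs0
    simp [startPass, Prog.run, Expr.eval]
  · rintro s' ⟨⟨hF, H, hI⟩, hb⟩
    simp only [Test.Holds, Expr.eval, hF.size] at hb
    have hv : s'.reg 2 = n := le_antisymm hI.le (by omega)
    rw [hv] at hI
    exact ⟨hF, H, hI.lists, hI.inst, hI.reduced⟩

/-! ### The vertices of the output -/

open scoped Classical in
/-- The number of `w < v` with `p w`. -/
noncomputable def below (p : ℕ → Prop) (v : ℕ) : ℕ := Nat.count p v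

section Below

variable {p : ℕ → Prop} {v w : ℕ}

theorem below_zero : below p 0 = 0 := by
  classical exact Nat.count_zero _

theorem below_succ_of (h : p v) : below p (v + 1) = below p v + 1 := by
  simp [below, Nat.count_succ, h]

theorem below_succ_of_not (h : ¬ p v) : below p (v + 1) = below p v := by
  simp [below, Nat.count_succ, h]

theorem below_lt (h : p v) (hvw : v < w) : below p v < below p w := by
  classical exact Nat.count_strict_mono h hvw

theorem below_injOn (hv : p v) (hw : p w) (h : below p v = below p w) : v = w := by
  classical exact Nat.count_injective hv hw h

theorem below_surj {j : ℕ} (h : j < below p n) : ∃ v < n, p v ∧ below p v = j := by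
  induction n with
  | zero => rw [below_zero] at h; omega
  | succ n ih =>
    by_cases hn : p n
    · rw [below_succ_of hn] at h
      rcases Nat.lt_succ_iff_lt_or_eq.1 h with h | rfl
      · obtain ⟨v, h1, h2⟩ := ih h
        exact ⟨v, by omega, h2⟩
      · exact ⟨n, by omega, hn, rfl⟩
    · rw [below_succ_of_not hn] at h
      obtain ⟨v, h1, h2⟩ := ih h
      exact ⟨v, by omega, h2⟩

end Below

/-- The vertex `v` is an isolated terminal. -/
def IsolatedTerminal (deg k : ℕ → ℕ) (v : ℕ) : Prop := deg v = 0 ∧ k v = 1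

/-- The vertex `v` is kept in the output: it is not isolated, or it is one of the first two isolated
terminals. -/
def Kept (deg k : ℕ → ℕ) (v : ℕ) : Prop :=
  deg v ≠ 0 ∨ IsolatedTerminal deg k v ∧ below (IsolatedTerminal deg k) v < 2

/-- The state while the vertices are numbered: the vertices before `v` are done, `m` of them are kept,
and `c` more isolated terminals may be kept. -/
structure NumberInv (n : ℕ) (deg k : ℕ → ℕ) (v m c : ℕ) (num k' : ℕ → ℕ) : Prop where
  le : v ≤ n
  count : m = below (Kept deg k) v
  rest : c = 2 - below (IsolatedTerminal deg k) v
  kept : ∀ w < v, Kept deg k w → num w = below (Kept deg k) w + 1 ∧ k' (below (Kept deg k) w) = k w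
  dropped : ∀ w, v ≤ w ∨ ¬ Kept deg k w → num w = 0

namespace NumberInv

variable {v m c : ℕ} {num k' : ℕ → ℕ}

theorem step_keep (h : NumberInv n deg k v m c num k') (hv : v < n) (hk : Kept deg k v) {c' : ℕ}
    (hc : c' = 2 - below (IsolatedTerminal deg k) (v + 1)) :
    NumberInv n deg k (v + 1) (m + 1) c' (Function.update num v (m + 1))
      (Function.update k' m (k v)) where
  le := hv
  count := by rw [below_succ_of hk, h.count]
  rest := hc
  kept := fun w hw hkw => by
    rcases Nat.lt_succ_iff_lt_or_eq.1 hw with hw | rfl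
    · have h1 := below_lt hkw hw
      rw [Function.update_of_ne (by omega), Function.update_of_ne (by rw [h.count]; omega)]
      exact h.kept w hw hkw
    · rw [Function.update_self, h.count, Function.update_self]
      exact ⟨rfl, rfl⟩
  dropped := fun w hw => by
    have hwv : w ≠ v := by
      rintro rfl
      rcases hw with hw | hw
      · omega
      · exact hw hk
    rw [Function.update_of_ne hwv]
    exact h.dropped w (hw.imp_left (by omega))

theorem step_drop (h : NumberInv n deg k v m c num k') (hv : v < n) (hk : ¬ Kept deg k v)
    (hc : c = 2 - below (IsolatedTerminal deg k) (v + 1)) :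
    NumberInv n deg k (v + 1) m c num k' where
  le := hv
  count := by rw [below_succ_of_not hk, h.count]
  rest := hc
  kept := fun w hw hkw => by
    rcases Nat.lt_succ_iff_lt_or_eq.1 hw with hw | rfl
    · exact h.kept w hw hkw
    · exact absurd hkw hk
  dropped := fun w hw => h.dropped w (hw.imp_left (by omega))

end NumberInv

theorem halts_number {s : Mem} (hs : Frame n off s) (h7 : s.arr 7 = deg) (h6 : s.arr 6 = adj)
    (h2 : s.arr 2 = k) :
    Halts (Prog.seq (Prog.seq startPass (Prog.assign 6 (Expr.const 2))) numberLoop) s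
      ((Prog.seq startPass (Prog.assign 6 (Expr.const 2))).bound +
        numberLoop.roundCost * (n + 1) + 1) fun s' =>
        s'.reg 0 = n ∧ s'.arr 0 = off ∧ s'.arr 3 = 0 ∧ s'.arr 7 = deg ∧ s'.arr 6 = adj ∧
        s'.reg 1 = below (Kept deg k) n ∧
        (∀ w < n, Kept deg k w →
          s'.arr 9 w = below (Kept deg k) w + 1 ∧ s'.arr 5 (below (Kept deg k) w) = k w) ∧
        (∀ w, ¬ Kept deg k w → s'.arr 9 w = 0) := by
  refine (Halts.run (Q := fun s' => s' = (Prog.seq startPass (Prog.assign 6 (Expr.const 2))).run s)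
    (by simp [Prog.LoopFree, startPass]) rfl).seq fun s0 hs0 => ?_
  refine (Halts.loop (by simp [Prog.LoopFree]) (fun s' => s'.reg 0 = n ∧ s'.arr 0 = off ∧
      s'.arr 3 = 0 ∧ s'.arr 7 = deg ∧ s'.arr 6 = adj ∧ s'.arr 2 = k ∧
      NumberInv n deg k (s'.reg 2) (s'.reg 1) (s'.reg 6) (s'.arr 9) (s'.arr 5))
      (fun s' => n - s'.reg 2) ?_ ?_ ?_).mono ?_
  · rintro s' ⟨h0, ha0, ha3, ha7, ha6, ha2, hI⟩ hb
    simp only [Test.Holds, Expr.eval, h0] at hb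
    have hrest := hI.rest
    by_cases hd : 0 < deg (s'.reg 2)
    · have hni : ¬ IsolatedTerminal deg k (s'.reg 2) := fun h => by have := h.1; omega
      have hstep := hI.step_keep hb (Or.inl (by omega)) (by rw [below_succ_of_not hni, ← hrest])
      simp only [Prog.run, Test.Holds, Expr.eval, ha7, hd, if_true]
      refine ⟨⟨?_, ?_, ?_, ?_, ?_, ?_, ?_⟩, ?_⟩
      all_goals simp [h0, ha0, ha3, ha7, ha6, ha2]
      · exact hstep
      · omega
    · by_cases hc : k (s'.reg 2) = 1 ∧ 0 < s'.reg 6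
      · have hi : IsolatedTerminal deg k (s'.reg 2) := ⟨by omega, hc.1⟩
        have hstep := hI.step_keep (c' := s'.reg 6 - 1) hb (Or.inr ⟨hi, by omega⟩) (by
          rw [below_succ_of hi]
          omega)
        simp only [Prog.run, Test.Holds, Expr.eval, ha7, ha2, hd, if_false, if_pos hc]
        refine ⟨⟨?_, ?_, ?_, ?_, ?_, ?_, ?_⟩, ?_⟩
        all_goals simp [h0, ha0, ha3, ha7, ha6, ha2]
        · exact hstep
        · omega
      · have hstep := hI.step_drop hb (by
          rintro (h | ⟨h, h'⟩)
          · omega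
          · exact hc ⟨h.2, by omega⟩) (by
          by_cases hi : IsolatedTerminal deg k (s'.reg 2)
          · have : ¬ 0 < s'.reg 6 := fun h => hc ⟨hi.2, h⟩
            rw [below_succ_of hi]
            omega
          · rw [below_succ_of_not hi, ← hrest])
        simp only [Prog.run, Test.Holds, Expr.eval, ha7, ha2, hd, if_false, if_neg hc]
        refine ⟨⟨?_, ?_, ?_, ?_, ?_, ?_, ?_⟩, ?_⟩
        all_goals simp [h0, ha0, ha3, ha7, ha6, ha2]
        · exact hstep
        · omega
  · subst hs0
    simp only [startPass, Prog.run, Expr.eval]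
    refine ⟨?_, ?_, ?_, ?_, ?_, ?_, ?_⟩
    all_goals simp [hs.size, hs.outSize, hs.offsets, hs.outOffsets, hs.numbers, h7, h6, h2]
    exact ⟨Nat.zero_le _, below_zero.symm, by rw [below_zero], by simp, by simp⟩
  · subst hs0
    simp [startPass, Prog.run, Expr.eval]
  · rintro s' ⟨⟨h0, ha0, ha3, ha7, ha6, ha2, hI⟩, hb⟩
    simp only [Test.Holds, Expr.eval, h0] at hb
    have hv : s'.reg 2 = n := le_antisymm hI.le (by omega)
    rw [hv] at hI
    exact ⟨h0, ha0, ha3, ha7, ha6, hI.count, hI.kept, fun w hw => hI.dropped w (Or.inr hw)⟩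

/-! ### The lists of the output -/

/-- The state while the lists of the vertices with property `P` are written: the lists of the vertices
before `v` are done, and the list of `v` is copied from position `i`, where `c` entries are left, to
position `p`. The vertices without the property have empty lists. -/
structure OutputInv (n : ℕ) (off deg adj : ℕ → ℕ) (H : SimpleGraph ℕ) (P : ℕ → Prop)
    (v p i c : ℕ) (off' adj' : ℕ → ℕ) : Prop where
  le : v ≤ n
  pos : off v ≤ i
  left : v < n → i + c = off v + deg v
  length : off' (below P v) + i = p + off v
  zero : off' 0 = 0
  mono : ∀ w < v, P w → off' (below P w) ≤ off' (below P w + 1) ∧ off' (below P w + 1) ≤ p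
  done : ∀ w < v, P w → Set.BijOn adj' (Set.Ico (off' (below P w)) (off' (below P w + 1)))
    (below P '' H.neighborSet w)
  current : Set.BijOn adj' (Set.Ico (off' (below P v)) p)
    ((fun j => below P (adj j)) '' Set.Ico (off v) i)

namespace OutputInv

variable {v p i c : ℕ} {off' adj' num : ℕ → ℕ} {P : ℕ → Prop}

theorem step_copy (hH : Lists n off deg adj H) (hP : ∀ v, deg v ≠ 0 → P v)
    (h : OutputInv n off deg adj H P v p i c off' adj') (hv : v < n) (hc : 0 < c) :
    OutputInv n off deg adj H P v (p + 1) (i + 1) (c - 1) off'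
      (Function.update adj' p (below P (adj i))) := by
  have hleft := h.left hv
  have hpos := h.pos
  have hlen := h.length
  have hend := hH.mono (v := v + 1) (w := n) hv le_rfl
  have hle := hH.le v hv
  have hPadj : ∀ j, off v ≤ j → j < off v + deg v → P (adj j) := fun j h1 h2 =>
    hP _ (hH.deg_ne_zero (hH.adj_of hv h1 h2).symm)
  refine ⟨h.le, by omega, fun _ => by omega, by omega, h.zero, fun w hw hPw => ?_,
    fun w hw hPw => ?_, ?_⟩
  · have := h.mono w hw hPw
    exact ⟨this.1, by omega⟩
  · have := h.mono w hw hPw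
    refine bijOn_update_of_notMem ?_ (h.done w hw hPw)
    rw [Set.mem_Ico]
    omega
  · have h1 : Set.Ico (off v) (i + 1) = insert i (Set.Ico (off v) i) := by
      ext j
      simp only [Set.mem_Ico, Set.mem_insert_iff]
      omega
    rw [h1, Set.image_insert_eq]
    refine bijOn_push (by omega) ?_ h.current
    rintro ⟨j, hj, hij⟩
    rw [Set.mem_Ico] at hj
    have h2 := below_injOn (hPadj j hj.1 (by omega)) (hPadj i hpos (by omega)) hij
    have := (hH.bij v hv).injOn (Set.mem_Ico.2 ⟨hj.1, by omega⟩)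
      (Set.mem_Ico.2 ⟨hpos, by omega⟩) h2
    omega

theorem step_drop (hP : ∀ v, deg v ≠ 0 → P v)
    (h : OutputInv n off deg adj H P v p i c off' adj') (hv : v < n) (hc : c = 0)
    (hPv : ¬ P v) :
    OutputInv n off deg adj H P (v + 1) p (off (v + 1)) (deg (v + 1)) off' adj' := by
  have hleft := h.left hv
  have hlen := h.length
  have hd : deg v = 0 := by
    by_contra hd
    exact hPv (hP v hd)
  refine ⟨hv, le_rfl, fun _ => rfl, ?_, h.zero, fun w hw hPw => ?_,
    fun w hw hPw => ?_, ?_⟩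
  · rw [below_succ_of_not hPv]
    omega
  · have hwv : w ≠ v := fun e => hPv (e ▸ hPw)
    exact h.mono w (by omega) hPw
  · have hwv : w ≠ v := fun e => hPv (e ▸ hPw)
    exact h.done w (by omega) hPw
  · rw [below_succ_of_not hPv, show off' (below P v) = p by omega]
    simp

theorem step_close (hH : Lists n off deg adj H)
    (h : OutputInv n off deg adj H P v p i c off' adj') (hv : v < n) (hc : c = 0) (hPv : P v) :
    OutputInv n off deg adj H P (v + 1) p (off (v + 1)) (deg (v + 1))
      (Function.update off' (below P v + 1) p) adj' := by
  have hleft := h.left hv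
  have hlen := h.length
  have hcur := h.current
  rw [show i = off v + deg v by omega] at hcur
  have himg : (fun j => below P (adj j)) '' Set.Ico (off v) (off v + deg v) =
      below P '' H.neighborSet v := by
    rw [← (hH.bij v hv).image_eq, Set.image_image]
  rw [himg] at hcur
  have hoff : ∀ j, j ≤ below P v → Function.update off' (below P v + 1) p j = off' j :=
    fun j hj => Function.update_of_ne (by omega) _ _
  refine ⟨hv, le_rfl, fun _ => rfl, ?_, ?_, fun w hw hPw => ?_,
    fun w hw hPw => ?_, ?_⟩
  · rw [below_succ_of hPv, Function.update_self]
  · rw [hoff 0 (Nat.zero_le _)]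
    exact h.zero
  · rcases Nat.lt_succ_iff_lt_or_eq.1 hw with hw | rfl
    · have h1 := below_lt hPw hw
      rw [hoff _ h1.le, hoff _ h1]
      exact h.mono w hw hPw
    · rw [hoff _ le_rfl, Function.update_self]
      have := h.pos
      omega
  · rcases Nat.lt_succ_iff_lt_or_eq.1 hw with hw | rfl
    · have h1 := below_lt hPw hw
      rw [hoff _ h1.le, hoff _ h1]
      exact h.done w hw hPw
    · rw [hoff _ le_rfl, Function.update_self]
      exact hcur
  · rw [below_succ_of hPv, Function.update_self]
    simp

end OutputInv

theorem halts_output {P : ℕ → Prop} (hH : Lists n off deg adj H) (hP : ∀ v, deg v ≠ 0 → P v)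
    {s : Mem} (h0 : s.reg 0 = n) (ha0 : s.arr 0 = off) (ha3 : s.arr 3 = 0) (ha7 : s.arr 7 = deg)
    (ha6 : s.arr 6 = adj) (hnum : ∀ w < n, P w → s.arr 9 w = below P w + 1)
    (hnum' : ∀ w, ¬ P w → s.arr 9 w = 0) :
    Halts (Prog.seq (Prog.seq startPass (Prog.assign 6 (Expr.read 7 (Expr.const 0)))) outputLoop) s
      ((Prog.seq startPass (Prog.assign 6 (Expr.read 7 (Expr.const 0)))).bound +
        outputLoop.roundCost * (n + off n + 1) + 1) fun s' =>
        s'.reg 1 = s.reg 1 ∧ s'.arr 5 = s.arr 5 ∧ s'.arr 3 0 = 0 ∧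
        ∀ w < n, P w → s'.arr 3 (below P w) ≤ s'.arr 3 (below P w + 1) ∧
          Set.BijOn (s'.arr 4) (Set.Ico (s'.arr 3 (below P w)) (s'.arr 3 (below P w + 1)))
            (below P '' H.neighborSet w) := by
  refine (Halts.run (Q := fun s' => s' =
    (Prog.seq startPass (Prog.assign 6 (Expr.read 7 (Expr.const 0)))).run s)
    (by simp [Prog.LoopFree, startPass]) rfl).seq fun s0 hs0 => ?_
  refine (Halts.loop (by simp [Prog.LoopFree]) (fun s' => s'.reg 0 = n ∧ s'.arr 0 = off ∧
      s'.arr 7 = deg ∧ s'.arr 6 = adj ∧ s'.arr 9 = s.arr 9 ∧ s'.reg 1 = s.reg 1 ∧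
      s'.arr 5 = s.arr 5 ∧ OutputInv n off deg adj H P (s'.reg 2) (s'.reg 3) (s'.reg 4) (s'.reg 6)
        (s'.arr 3) (s'.arr 4))
      (fun s' => (n - s'.reg 2) + (off n - s'.reg 4)) ?_ ?_ ?_).mono ?_
  · rintro s' ⟨h0, ha0, ha7, ha6, ha9, h1, ha5, hI⟩ hb
    simp only [Test.Holds, Expr.eval, h0] at hb
    have hleft := hI.left hb
    have hle := hH.le _ hb
    have hend := hH.mono (v := s'.reg 2 + 1) (w := n) hb le_rfl
    by_cases hc : 0 < s'.reg 6
    · have hstep := hI.step_copy hH hP hb hc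
      have hadj := hH.adj_of hb hI.pos (by omega)
      have hnum1 : s.arr 9 (adj (s'.reg 4)) - 1 = below P (adj (s'.reg 4)) := by
        rw [hnum _ (hH.lt _ _ hadj.symm) (hP _ (hH.deg_ne_zero hadj.symm)), Nat.add_sub_cancel]
      simp only [Prog.run, Test.Holds, Expr.eval, hc, if_true]
      refine ⟨⟨?_, ?_, ?_, ?_, ?_, ?_, ?_, ?_⟩, ?_⟩
      all_goals simp [h0, ha0, ha7, ha6, ha9, h1, ha5, hnum1]
      · exact hstep
      · omega
    · by_cases hPv : P (s'.reg 2)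
      · have hstep := hI.step_close hH hb (by omega) hPv
        simp only [Prog.run, Test.Holds, Expr.eval, hc, if_false, ha9, hnum _ hb hPv,
          Nat.succ_pos, if_true]
        refine ⟨⟨?_, ?_, ?_, ?_, ?_, ?_, ?_, ?_⟩, ?_⟩
        all_goals simp [h0, ha0, ha7, ha6, ha9, h1, ha5]
        · exact hstep
        · omega
      · have hstep := hI.step_drop hP hb (by omega) hPv
        simp only [Prog.run, Test.Holds, Expr.eval, hc, if_false, ha9, hnum' _ hPv, lt_irrefl]
        refine ⟨⟨?_, ?_, ?_, ?_, ?_, ?_, ?_, ?_⟩, ?_⟩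
        all_goals simp [h0, ha0, ha7, ha6, ha9, h1, ha5]
        · exact hstep
        · omega
  · subst hs0
    simp only [startPass, Prog.run, Expr.eval]
    refine ⟨?_, ?_, ?_, ?_, ?_, ?_, ?_, ?_⟩
    all_goals simp [h0, ha0, ha3, ha7, ha6]
    exact ⟨Nat.zero_le _, by simp [hH.zero], by simp [hH.zero], by simp [hH.zero], rfl,
      by simp, by simp, by simp [hH.zero]⟩
  · subst hs0
    simp [startPass, Prog.run, Expr.eval]
  · rintro s' ⟨⟨h0, ha0, ha7, ha6, ha9, h1, ha5, hI⟩, hb⟩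
    simp only [Test.Holds, Expr.eval, h0] at hb
    have hv : s'.reg 2 = n := le_antisymm hI.le (by omega)
    rw [hv] at hI
    exact ⟨h1, ha5, hI.zero, fun w hw hPw => ⟨(hI.mono w hw hPw).1, hI.done w hw hPw⟩⟩

/-! ### The whole program -/

/-- The memory `s` holds the subgraph of `H` induced by the kept vertices, in the format of an
output. -/
structure Written (n : ℕ) (deg k : ℕ → ℕ) (H : SimpleGraph ℕ) (s : Mem) : Prop where
  size : s.reg 1 = below (Kept deg k) n
  zero : s.arr 3 0 = 0
  kept : ∀ w < n, Kept deg k w →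
    s.arr 3 (below (Kept deg k) w) ≤ s.arr 3 (below (Kept deg k) w + 1) ∧
    Set.BijOn (s.arr 4)
      (Set.Ico (s.arr 3 (below (Kept deg k) w)) (s.arr 3 (below (Kept deg k) w + 1)))
      (below (Kept deg k) '' H.neighborSet w) ∧
    s.arr 5 (below (Kept deg k) w) = k w

/-- The passes are chained; each takes time linear in the number of vertices and the total length of
the lists. -/
theorem exists_halts_kernelize : ∃ c : ℕ, ∀ {n : ℕ} {off len adj : ℕ → ℕ} {G : SimpleGraph ℕ}
    {Y : Prop} {s : Mem}, Lists n off len adj G → (∀ v < n, off v + len v = off (v + 1)) →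
    Frame n off s → s.arr 1 = adj → s.reg 2 = 0 → s.reg 4 = 0 → s.reg 5 = 0 → s.arr 7 = 0 →
    (∀ v < n, s.arr 2 v ≤ 1) →
    ((terminals n (s.arr 2)).Nonempty → (Yes G (terminals n (s.arr 2)) ↔ Y)) →
    (0 < n → terminals n (s.arr 2) = ∅ → Y) →
    Halts kernelize s (c * (n + off n + 1)) fun s' => ∃ H deg adj' k, Lists n off deg adj' H ∧
      Instance n G Y H k ∧ Reduced H ∧ Written n deg k H s' := by
  -- the factor `2` is for the pass that deletes leaves, whose rank is at most `2 * (n + off n)`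
  refine ⟨2 * (degreeLoop.roundCost + ensureTerminal.bound + pruneLoop.roundCost +
    compactLoop.roundCost + bypassLoop.roundCost + numberLoop.roundCost + outputLoop.roundCost +
    3 * startPass.bound + (Prog.seq startPass (Prog.assign 6 (Expr.const 2))).bound +
    (Prog.seq startPass (Prog.assign 6 (Expr.read 7 (Expr.const 0)))).bound + 11), ?_⟩
  intro n off len adj G Y s hG hlen hs h1 h2 h4 h5 h7 hk hY hY'
  have key : Halts kernelize s _ fun s' => ∃ H deg adj' k, Lists n off deg adj' H ∧
      Instance n G Y H k ∧ Reduced H ∧ Written n deg k H s' :=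
    (halts_prepare hG hlen hs h1 h2 h4 h5 h7 hk hY hY').seq fun s1 ⟨hF1, ha1, hd1, hI1⟩ =>
    (halts_prune hG hF1 ha1 hd1 hI1).seq fun s2 ⟨hF2, ha2, hd2, hl2, hI2⟩ =>
    (halts_compact hG hlen hF2 ha2 rfl rfl hd2).seq fun s3 ⟨hF3, h73, h23, hH3⟩ =>
    (halts_bypass (H := remaining G (s2.arr 7)) hF3 (by rw [h73]; exact hH3)
      (by rw [h23]; exact hI2) (by rw [h73]; exact hl2)).seq
      fun s4 ⟨hF4, H, hH, hI, hR⟩ =>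
    (halts_number hF4 rfl rfl rfl).seq fun s5 ⟨h0, ha0, ha3, ha7, ha6, h1, hn, hn'⟩ =>
    (halts_output (P := Kept (s4.arr 7) (s4.arr 2)) hH (fun _ => Or.inl) h0 ha0 ha3 ha7 ha6
      (fun w hw hP => (hn w hw hP).1) hn').mono fun s6 ⟨h16, h56, h36, hout⟩ =>
    ⟨H, _, _, _, hH, hI, hR, h16.trans h1, h36, fun w hw hP =>
      ⟨(hout w hw hP).1, (hout w hw hP).2, by rw [h56, (hn w hw hP).2]⟩⟩
  obtain ⟨t, s', hE, ht, hQ⟩ := key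
  refine ⟨t, s', hE, ht.trans ?_, hQ⟩
  generalize degreeLoop.roundCost = c1, ensureTerminal.bound = c2, pruneLoop.roundCost = c3,
    compactLoop.roundCost = c4, bypassLoop.roundCost = c5, numberLoop.roundCost = c6,
    outputLoop.roundCost = c7, startPass.bound = c8,
    (Prog.seq startPass (Prog.assign 6 (Expr.const 2))).bound = c9,
    (Prog.seq startPass (Prog.assign 6 (Expr.read 7 (Expr.const 0)))).bound = c10, off n = m
  nlinarith

/-! ### The output as a graph on an initial segment -/

/-- Among the natural numbers below `n`, those with property `p` are enumerated by `below p`. -/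
theorem exists_enumeration (p : ℕ → Prop) (n : ℕ) : ∃ e : Fin (below p n) → ℕ,
    Function.Injective e ∧ (∀ j, e j < n ∧ p (e j) ∧ below p (e j) = j) ∧
    ∀ v < n, p v → v ∈ Set.range e := by
  choose e he using fun j : Fin (below p n) => below_surj j.2
  refine ⟨e, fun i j hij => Fin.ext ?_, he, fun v hv hp => ⟨⟨below p v, below_lt hp hv⟩, ?_⟩⟩
  · rw [← (he i).2.2, hij, (he j).2.2]
  · exact below_injOn (he _).2.1 hp (he _).2.2

/-- Among the kept vertices there are two isolated terminals unless all terminals are kept. -/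
theorem kept_or_exists_isolated (k deg : ℕ → ℕ) (n : ℕ) :
    (∀ v < n, k v = 1 → Kept deg k v) ∨ ∃ v < n, ∃ w < n, v ≠ w ∧ Kept deg k v ∧ Kept deg k w ∧
      IsolatedTerminal deg k v ∧ IsolatedTerminal deg k w := by
  by_cases h : 1 < below (IsolatedTerminal deg k) n
  · obtain ⟨v, hv, hv1, hv2⟩ := below_surj (zero_lt_one.trans h)
    obtain ⟨w, hw, hw1, hw2⟩ := below_surj h
    refine Or.inr ⟨v, hv, w, hw, ?_, Or.inr ⟨hv1, by omega⟩, Or.inr ⟨hw1, by omega⟩, hv1, hw1⟩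
    rintro rfl
    omega
  · refine Or.inl fun v hv hk => ?_
    by_cases hd : deg v = 0
    · have := below_lt (p := IsolatedTerminal deg k) ⟨hd, hk⟩ hv
      exact Or.inr ⟨⟨hd, hk⟩, by omega⟩
    · exact Or.inl hd

/-- The kept vertices induce an equivalent instance. They are the nonisolated vertices and at most two
isolated ones, and `14 * q + 2 ≤ 16 * q`. -/
theorem exists_isOutput {s : Mem} (hH : Lists n off deg adj H) (hI : Instance n G Y H k)
    (hR : Reduced H) (hs : Written n deg k H s) (hY : n = 0 → ¬ Y) :
    ∃ (n' : ℕ) (G' : SimpleGraph (Fin n')) (K' : Finset (Fin n')), IsOutput s G' K' ∧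
      (HasInducedTree G' K' ↔ Y) ∧ ∀ q, 1 ≤ q → Fes G q → n' ≤ 16 * q ∧
        G'.edgeSet.ncard ≤ 15 * q ∧
        ∃ F : Finset (Sym2 (Fin n')), IsFeedbackEdgeSet G' F ∧ F.card ≤ q := by
  classical
  obtain ⟨e, he, hb, hr⟩ := exists_enumeration (Kept deg k) n
  have hadj : ∀ v w, H.Adj v w → v ∈ Set.range e := fun v w h =>
    hr v (hH.lt v w h) (Or.inl (hH.deg_ne_zero h))
  have hiso : ∀ v, v ∉ Set.range e → ∀ w, ¬ H.Adj v w := fun v hv w h => hv (hadj v w h)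
  have hdeg : ∀ v < n, deg v = 0 → ∀ w, ¬ H.Adj v w := fun v _ h w hvw => hH.deg_ne_zero hvw h
  refine ⟨_, H.comap e, Finset.univ.filter fun j => k (e j) = 1, ⟨hs.size, hs.zero, fun j => ?_,
    fun j => ?_, fun j => ?_⟩, ?_, fun q hq hF => ?_⟩
  · have := (hs.kept _ (hb j).1 (hb j).2.1).1
    rwa [(hb j).2.2] at this
  · have h1 := (hs.kept _ (hb j).1 (hb j).2.1).2.1
    rw [(hb j).2.2] at h1
    convert h1 using 1
    ext i
    simp only [Set.mem_image, SimpleGraph.mem_neighborSet, SimpleGraph.comap_adj]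
    constructor
    · rintro ⟨l, hl, rfl⟩
      exact ⟨e l, hl, (hb l).2.2⟩
    · rintro ⟨w, hw, rfl⟩
      obtain ⟨l, rfl⟩ := hadj w _ hw.symm
      exact ⟨l, hw, (hb l).2.2.symm⟩
  · have h1 := (hs.kept _ (hb j).1 (hb j).2.1).2.2
    have h2 := hI.le_one _ (hb j).1
    rw [(hb j).2.2] at h1
    refine h1.trans ?_
    simp only [Finset.mem_filter, Finset.mem_univ, true_and]
    split_ifs <;> omega
  · -- a tree has at least one vertex
    rcases n.eq_zero_or_pos with rfl | hn
    · refine iff_of_false ?_ (hY rfl)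
      rintro ⟨S, -, hS⟩
      obtain ⟨v⟩ := hS.connected.nonempty
      exact absurd (hb v).1 (Nat.not_lt_zero _)
    · refine (hasInducedTree_comap_iff e he (hI.nonempty hn) hiso ?_ fun j => ?_).trans (hI.yes hn)
      · rcases kept_or_exists_isolated k deg n with h | ⟨v, hv, w, hw, hvw, hv1, hw1, hv2, hw2⟩
        · refine Or.inl fun v hv => ?_
          rw [mem_terminals] at hv
          exact hr v hv.1 (h v hv.1 hv.2)
        · obtain ⟨a, rfl⟩ := hr v hv hv1
          obtain ⟨b, rfl⟩ := hr w hw hw1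
          exact Or.inr ⟨a, b, ne_of_apply_ne e hvw, mem_terminals.2 ⟨hv, hv2.2⟩,
            mem_terminals.2 ⟨hw, hw2.2⟩, hdeg _ hv hv2.1, hdeg _ hw hw2.1⟩
      · simp [mem_terminals, (hb j).1]
  · obtain ⟨F, hF, hFq⟩ := (hI.fes q hF).comap e he
    obtain ⟨h1, h2⟩ := (hR.comap e he hiso).card_le hF hFq
    -- an isolated vertex that is kept is one of the first two isolated terminals
    have h3 : (Finset.univ.filter fun j => ¬ ∃ l, (H.comap e).Adj j l).card ≤ 2 := by
      rw [← Finset.card_range 2]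
      refine Finset.card_le_card_of_injOn (fun j => below (IsolatedTerminal deg k) (e j)) ?_ ?_
      all_goals
        have key : ∀ j, (¬ ∃ l, (H.comap e).Adj j l) → IsolatedTerminal deg k (e j) ∧
            below (IsolatedTerminal deg k) (e j) < 2 := fun j hj => by
          refine (hb j).2.1.resolve_left fun hd => hj ?_
          have h := hH.adj_of (hb j).1 le_rfl (by omega)
          obtain ⟨l, hl⟩ := hadj _ _ h.symm
          exact ⟨l, by rwa [SimpleGraph.comap_adj, hl]⟩
      · intro j hj
        simpa using (key j (by simpa using hj)).2
      · intro i hi j hj hij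
        exact he (below_injOn (key i (by simpa using hi)).1 (key j (by simpa using hj)).1 hij)
    have h4 := Finset.card_filter_add_card_filter_not (s := Finset.univ)
      fun j => ∃ l, (H.comap e).Adj j l
    rw [Finset.card_univ, Fintype.card_fin] at h4
    exact ⟨by omega, h2, F, hF, hFq⟩

/-! ### The input as a graph on the natural numbers -/

section Input

variable {s : Mem} {G : SimpleGraph (Fin n)} {K : Finset (Fin n)}

theorem notMem_range_val {v : ℕ} (hv : v ∉ Set.range (Fin.val : Fin n → ℕ)) (w : ℕ) :
    ¬ (G.map Fin.valEmbedding).Adj v w := by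
  rw [SimpleGraph.map_adj]
  rintro ⟨a, b, -, rfl, -⟩
  exact hv ⟨a, rfl⟩

theorem comap_val_map : (G.map Fin.valEmbedding).comap (Fin.val : Fin n → ℕ) = G :=
  G.comap_map_eq Fin.valEmbedding

theorem Stores.lists (h : Stores 0 s G K) :
    Lists n (s.arr 0) (fun v => s.arr 0 (v + 1) - s.arr 0 v) (s.arr 1)
      (G.map Fin.valEmbedding) where
  zero := h.2.1
  le := fun v hv => (Nat.add_sub_of_le (h.2.2.1 ⟨v, hv⟩)).le
  bij := fun v hv => by
    rw [Nat.add_sub_of_le (h.2.2.1 ⟨v, hv⟩)]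
    convert h.2.2.2.1 ⟨v, hv⟩ using 1
    exact G.neighborSet_map Fin.valEmbedding ⟨v, hv⟩
  lt := fun a b hab => by
    rw [SimpleGraph.map_adj] at hab
    obtain ⟨a, b, -, rfl, -⟩ := hab
    exact a.2

theorem Stores.mem_terminals (h : Stores 0 s G K) {v : Fin n} :
    (v : ℕ) ∈ terminals n (s.arr 2) ↔ v ∈ K := by
  have : s.arr 2 v = _ := h.2.2.2.2 v
  rw [InTree.mem_terminals, this]
  simp

/-- The total length of the adjacency lists is the sum of the degrees. -/
theorem Stores.offset_eq [DecidableRel G.Adj] (h : Stores 0 s G K) :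
    s.arr 0 n = ∑ v, G.degree v := by
  have key : ∀ m ≤ n, s.arr 0 m = ∑ v ∈ Finset.range m, (s.arr 0 (v + 1) - s.arr 0 v) := by
    intro m hm
    induction m with
    | zero => exact h.2.1
    | succ m ih =>
      rw [Finset.sum_range_succ, ← ih (by omega)]
      exact (Nat.add_sub_of_le (h.2.2.1 ⟨m, hm⟩)).symm
  rw [key n le_rfl, Finset.sum_range]
  refine Finset.sum_congr rfl fun v _ => ?_
  rw [← SimpleGraph.card_neighborFinset_eq_degree, ← Set.ncard_coe_finset,
    SimpleGraph.coe_neighborFinset, ← Set.ncard_image_of_injective _ Fin.val_injective]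
  exact (ncard_of_bijOn_Ico (h.2.2.2.1 v)).symm

theorem hasInducedTree_singleton {V : Type*} (G : SimpleGraph V) (v : V) : HasInducedTree G ∅ := by
  classical
  exact ⟨(({v} : Finset V) : Set V), by simp,
    isTree_induce_iff.2 ⟨conn_singleton v, acyc_singleton v⟩⟩

end Input

end InTree

/-- One program kernelizes `k`-in-a-tree: on every instance `(G, K)` and for every `q ≥ 1` such that
`G` has a feedback edge set of at most `q` edges, it halts within `O(q ^ 2 + q * n)` steps with an
equivalent instance that has at most `16 * q` vertices, at most `17 * q` edges and a feedback edge
set of at most `q` edges. The program is not given `q`. -/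
theorem mainTheorem2 :
    ∃ (P : InTree.Prog) (c : ℕ),
      ∀ (n : ℕ) (G : SimpleGraph (Fin n)) (K : Finset (Fin n)) (s : InTree.Mem),
        InTree.IsInput s G K →
        ∃ (t : ℕ) (s' : InTree.Mem) (n' : ℕ) (G' : SimpleGraph (Fin n')) (K' : Finset (Fin n')),
          InTree.Exec P s t s' ∧
          InTree.IsOutput s' G' K' ∧
          (InTree.HasInducedTree G' K' ↔ InTree.HasInducedTree G K) ∧
          ∀ q : ℕ, 1 ≤ q →
            (∃ F : Finset (Sym2 (Fin n)), InTree.IsFeedbackEdgeSet G F ∧ F.card ≤ q) →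
            t ≤ c * (q ^ 2 + q * n) ∧
            n' ≤ 16 * q ∧
            G'.edgeSet.ncard ≤ 17 * q ∧
            ∃ F' : Finset (Sym2 (Fin n')), InTree.IsFeedbackEdgeSet G' F' ∧ F'.card ≤ q := by
  classical
  obtain ⟨c, hc⟩ := InTree.exists_halts_kernelize
  refine ⟨InTree.kernelize, 3 * c, fun n G K s ⟨hS, hreg, harr⟩ => ?_⟩
  have hzero : ∀ a, 3 ≤ a → s.arr a = 0 := fun a ha => funext (harr a ha)
  have hle : ∀ v < n, s.arr 2 v ≤ 1 := fun v hv => by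
    have : s.arr 2 v = _ := hS.2.2.2.2 ⟨v, hv⟩
    rw [this]
    split_ifs <;> simp
  have hYes : (InTree.terminals n (s.arr 2)).Nonempty →
      (InTree.Yes (G.map Fin.valEmbedding) (InTree.terminals n (s.arr 2)) ↔
        InTree.HasInducedTree G K) := fun hne => by
    rw [← InTree.hasInducedTree_comap_iff (Fin.val : Fin n → ℕ) Fin.val_injective hne
      (fun v hv => InTree.notMem_range_val hv) (Or.inl fun v hv => ?_)
      (fun v => hS.mem_terminals.symm), InTree.comap_val_map]
    exact ⟨⟨v, (InTree.mem_terminals.1 hv).1⟩, rfl⟩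
  have hYes' : 0 < n → InTree.terminals n (s.arr 2) = ∅ → InTree.HasInducedTree G K :=
    fun hn he => by
      have hK : K = ∅ := by
        rw [Finset.eq_empty_iff_forall_notMem]
        intro v hv
        have := hS.mem_terminals.2 hv
        rw [he] at this
        simp at this
      rw [hK]
      exact InTree.hasInducedTree_singleton G ⟨0, hn⟩
  obtain ⟨t, s', hE, ht, H, deg, adj, k, hH, hI, hR, hW⟩ := hc hS.lists
    (fun v hv => Nat.add_sub_of_le (hS.2.2.1 ⟨v, hv⟩))
    ⟨hS.1, hreg 1 (by simp), rfl, hzero 3 (by simp), hzero 9 (by simp)⟩ rfl (hreg 2 (by simp))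
    (hreg 4 (by simp)) (hreg 5 (by simp)) (hzero 7 (by simp)) hle hYes hYes'
  obtain ⟨n', G', K', hO, hiff, hq⟩ := InTree.exists_isOutput hH hI hR hW fun hn ⟨S, _, hT⟩ => by
    obtain ⟨v⟩ := hT.connected.nonempty
    exact absurd v.1.2 (by omega)
  refine ⟨t, s', n', G', K', hE, hO, hiff, fun q h1 ⟨F, hF, hFq⟩ => ?_⟩
  have hFes : InTree.Fes (G.map Fin.valEmbedding) q :=
    InTree.fes_of_comap (Fin.val : Fin n → ℕ) Fin.val_injective
      (fun v hv => InTree.notMem_range_val hv) (by rwa [InTree.comap_val_map]) hFq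
  obtain ⟨h2, h3, h4⟩ := hq q h1 hFes
  refine ⟨ht.trans ?_, h2, by omega, h4⟩
  -- a graph with a feedback edge set of size `q` has at most `n + q` edges
  have hoff := hF.sum_degree_le (B := Finset.univ) fun _ w _ => Finset.mem_univ w
  rw [← hS.offset_eq, Finset.card_univ, Fintype.card_fin] at hoff
  rw [mul_comm 3 c, mul_assoc]
  refine Nat.mul_le_mul_left c ?_
  nlinarith [Nat.mul_le_mul_right n h1, Nat.mul_le_mul_left q h1]
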